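/- For complex $p,\nu$ and $y>0$ let $W_{p,\nu}(y)$ be the Whittaker function of the second kind, that is, $$W_{p,\nu}(y)=\frac{\Gamma(-2\nu)}{\Gamma(\frac12-\nu-p)}M_{p,\nu}(y)+\frac{\Gamma(2\nu)}{\Gamma(\frac12+\nu-p)}M_{p,-\nu}(y),\qquad M_{p,\nu}(y)=y^{\nu+\frac12}e^{-y/2}\sum_{n\ge0}\frac{(\frac12+\nu-p)_n}{(1+2\nu)_n}\frac{y^n}{n!},$$ when $2\nu\notin\mathbb Z$, extended by continuity in $\nu$ when $2\nu\in\mathbb Z$. Here $1/\Gamma$ is regarded as an entire function, so it equals $0$ at the poles of $\Gamma$. There is an absolute constant $A>0$ such that for every $\epsilon>0$ there is a constant $C>0$ depending only on $\epsilon$ with the following properties, for all $0<y<1$. (i) (Principal series) For all $p,r\in\mathbb R$, $$\left|\frac{W_{p,ir}(y)}{\Gamma(\frac12+p+ir)}\right|\le C\,(|p|+|r|+1)^A\,y^{1/2-\epsilon}.$$ (ii) (Complementary series) For all $p\in\mathbb R$ and $0<\nu<\frac12$, $$\left|\frac{W_{p,\nu}(y)}{\Gamma(\frac12+p)}\right|\le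 C\,(|p|+1)^A\,y^{1/2-\nu-\epsilon}.$$ (iii) (Discrete series) For all $p,\nu\in\mathbb R$ with $p-\nu-\frac12\in\{0,1,2,\dots\}$ and $\nu>-\frac12$, $$\frac{|W_{p,\nu}(y)|}{|\Gamma(\frac12+p-\nu)\,\Gamma(\frac12+p+\nu)|^{1/2}}\le C\,(|p|+|\nu|+1)^A\,y^{1/2+\min(\nu,0)-\epsilon};$$ in particular the exponent of $y$ is $\frac12-\epsilon$ whenever $\nu\ge0$. -/

import Mathlib

noncomputable section

namespace Whittaker

/-- Kummer's confluent hypergeometric function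
`Φ(a, b; z) = ∑ₙ (a)ₙ zⁿ / ((b)ₙ n!)`, for `b ∉ {0, -1, -2, …}`, as `Γ(b)` times Mathlib's
regularized function `∑ₙ (a)ₙ zⁿ / (Γ(b + n) n!)`. -/
def kummerPhi (a b z : ℂ) : ℂ :=
  Complex.Gamma b * Complex.regularizedHGFun {a} {b} z

/-- The Whittaker function of the first kind, for `2 ν ∉ {-1, -2, …}` and `y > 0`:
`M_{p,ν}(y) = y^{ν+1/2} e^{-y/2} Φ(1/2 + ν - p, 1 + 2ν; y)`. -/
def whittakerM (p ν : ℂ) (y : ℝ) : ℂ :=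
  (y : ℂ) ^ (ν + 1 / 2) * Complex.exp (-(y : ℂ) / 2) *
    kummerPhi (1 / 2 + ν - p) (1 + 2 * ν) (y : ℂ)

/-- The formula for `W_{p,ν}(y)` when `2 ν ∉ ℤ`. A quotient by `Γ` at one of its poles is `0`
here (Mathlib's `Γ` vanishes at its poles and `x / 0 = 0`), which is the value of
the entire function `1 / Γ` there. -/
def whittakerWGeneric (p ν : ℂ) (y : ℝ) : ℂ :=
  Complex.Gamma (-2 * ν) / Complex.Gamma (1 / 2 - ν - p) * whittakerM p ν y +
    Complex.Gamma (2 * ν) / Complex.Gamma (1 / 2 + ν - p) * whittakerM p (-ν) y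

open Classical in
/-- The Whittaker function of the second kind `W_{p,ν}(y)`, for `y > 0` and all complex `p`, `ν`:
the formula above when `2 ν ∉ ℤ`, and its limit in `ν` when `2 ν ∈ ℤ`. -/
def whittakerW (p ν : ℂ) (y : ℝ) : ℂ :=
  if ∃ m : ℤ, 2 * ν = (m : ℂ) then
    Filter.limUnder (nhdsWithin ν {ν}ᶜ) (fun μ : ℂ => whittakerWGeneric p μ y)
  else whittakerWGeneric p ν y

end Whittaker

end

/-! Dividing Kummer's function by `Γ(b)` makes everything entire in `μ`: the reflection formula
turns the definition of `W` into `π / sin(2πμ)` times `H(μ)`, a combination of the regularized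
solutions `N_{±μ}` with coefficients `1 / Γ(1/2 ± μ - p)`. The poles at `2μ ∈ {0, 1}` are removable
because `H` vanishes at `μ = 0` and `μ = 1/2`. The estimates split at `y = 1/T`, where `T` is linear
in the sizes of the parameters.

For `y ≤ 1/T` the Kummer series is bounded, so `N_μ = O(y^{1/2 + Re μ})`. The Gamma quotients are
polynomially bounded, by reflection and the beta integral. Near a zero of the sine, the Schwarz
lemma for `H` on a disc of radius comparable to `ε` replaces division by the sine; `N_μ` on that
disc costs the factor `y^{-ε}` (`exists_principal_small`, `exists_complementary_small`). Away from
`r = 0` in the principal series, the exact value of `|Γ(1 + 2ir)|` balances the exponentials.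

For `1/T ≤ y ≤ 1` only Whittaker's equation `f'' = (1/4 - p/y - c/y²) f` is used, with `c = 1/4 - ν²
≥ 0`. Where `py + c ≥ 0`, the energy `|f'|² + (3/4 + p/y + c/y²)|f|²` grows at most like `e^{4y/3}`.
This covers everything if `p ≥ 0`, and everything up to the turning point if `p < 0`. Past the
turning point `|f|²` is convex, and a solution tending to `0` at infinity must decrease there
(`norm_le_rpow_of_initial`). The decay needed for `p < 0` comes from Tricomi's integral, identified
with `H` by comparing Wronskians (`whittakerH_eq_whittakerV`).

In the discrete series `1 / Γ(1/2 + ν - p)` vanishes and `W` is, up to sign, `Γ(n + 2ν + 1) N_ν`, a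
Laguerre function (`whittakerW_discrete`). For `ν ≥ 1/2` it is bounded pointwise by integrating the
derivative of `x^α e^{-x} L_n^α(x)²`, with `α = 2ν`, against the known Laguerre norms
(`weight_mul_lag_sq_le`). For `|ν| < 1/2` the series bound and the energy argument apply again; no
decay at infinity is needed, since `n ≥ 1` forces `p > 0` and `n = 0` is explicit. -/

set_option autoImplicit false

/-! ### Kummer's regularized series: bounds, differential relations, dependence on parameters -/

namespace Whittaker

open Complex Filter Topology Nat

/-- Coefficient of `z ^ n` in the regularized Kummer series. -/
noncomputable def kummerCoeff (a b : ℂ) (n : ℕ) : ℂ :=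
  (ascPochhammer ℂ n).eval a * (Gamma (b + n))⁻¹ / (n ! : ℂ)

/-- Kummer's function divided by `Γ(b)`, as an explicit series. -/
noncomputable def kummerR (a b z : ℂ) : ℂ := ∑' n : ℕ, kummerCoeff a b n * z ^ n

theorem regularizedHGFun_eq_kummerR (a b z : ℂ) :
    regularizedHGFun {a} {b} z = kummerR a b z := by
  unfold regularizedHGFun regularizedHGFunSeries kummerR
  rw [← FormalMultilinearSeries.ofScalarsSum, FormalMultilinearSeries.ofScalarsSum_eq_tsum]
  change ∑' n : ℕ, _ • z ^ n = _
  refine tsum_congr fun n => ?_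
  simp only [regularizedHGFunCoeff, kummerCoeff, Multiset.map_singleton, Multiset.prod_singleton,
    smul_eq_mul]
  field_simp

theorem norm_ascPochhammer_eval_le {a : ℂ} {T : ℝ} (hT : 1 ≤ T) (ha : ‖a‖ ≤ T) (n : ℕ) :
    ‖(ascPochhammer ℂ n).eval a‖ ≤ T ^ n * n ! := by
  induction n with
  | zero => simp
  | succ n ih =>
    rw [ascPochhammer_succ_eval, norm_mul, pow_succ, Nat.factorial_succ]
    have h1 : ‖a + n‖ ≤ T * (n + 1) := by
      calc ‖a + n‖ ≤ ‖a‖ + ‖(n : ℂ)‖ := norm_add_le _ _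
        _ ≤ T + n := by simpa using ha
        _ ≤ T * (n + 1) := by nlinarith [(Nat.cast_nonneg n : (0 : ℝ) ≤ n)]
    calc _ ≤ (T ^ n * n !) * (T * (n + 1)) := by gcongr
      _ = _ := by push_cast; ring

/-- `1 / Γ` is bounded on bounded sets. -/
theorem exists_norm_inv_Gamma_le (R : ℝ) :
    ∃ C : ℝ, 0 < C ∧ ∀ b : ℂ, ‖b‖ ≤ R → ‖(Gamma b)⁻¹‖ ≤ C := by
  obtain ⟨C, hC⟩ := (isCompact_closedBall (0 : ℂ) R).exists_bound_of_continuousOn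
    (f := fun b : ℂ => (Gamma b)⁻¹) differentiable_one_div_Gamma.continuous.continuousOn
  refine ⟨max C 1, by positivity, fun b hb => (hC b (by simpa using hb)).trans (le_max_left _ _)⟩

theorem norm_inv_Gamma_add_nat_le {b : ℂ} (hb : 1 ≤ b.re) (n : ℕ) :
    ‖(Gamma (b + n))⁻¹‖ ≤ ‖(Gamma b)⁻¹‖ / n ! := by
  induction n with
  | zero => simp
  | succ n ih =>
    have hre : (n : ℝ) + 1 ≤ (b + n).re := by simp; linarith
    have hn : (n : ℝ) + 1 ≤ ‖b + n‖ := hre.trans (Complex.re_le_norm _)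
    have hne : b + n ≠ 0 := by
      rw [← norm_pos_iff]; have : (0 : ℝ) ≤ n := n.cast_nonneg; linarith
    have : Gamma (b + (n + 1 : ℕ)) = (b + n) * Gamma (b + n) := by
      rw [← Gamma_add_one _ hne]; push_cast; ring_nf
    rw [this, mul_inv, norm_mul, norm_inv, Nat.factorial_succ]
    calc _ ≤ ((n : ℝ) + 1)⁻¹ * (‖(Gamma b)⁻¹‖ / n !) := by gcongr
      _ = _ := by push_cast; field_simp

theorem inv_Gamma_eq (s : ℂ) : (Gamma s)⁻¹ = s * (Gamma (s + 1))⁻¹ :=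
  one_div_Gamma_eq_self_mul_one_div_Gamma_add_one s

theorem norm_inv_Gamma_le_shift {R : ℝ} (hR : 0 ≤ R) {s : ℂ} (hs : ‖s‖ ≤ R) (N : ℕ) :
    ‖(Gamma s)⁻¹‖ ≤ (R + N) ^ N * ‖(Gamma (s + N))⁻¹‖ := by
  induction N with
  | zero => simp
  | succ N ih =>
    have h1 : ‖s + N‖ ≤ R + N := (norm_add_le _ _).trans (by simpa using hs)
    calc _ ≤ _ := ih
      _ = (R + N) ^ N * (‖s + N‖ * ‖(Gamma (s + (N + 1 : ℕ)))⁻¹‖) := by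
        rw [inv_Gamma_eq (s + N), norm_mul]; push_cast; ring_nf
      _ ≤ (R + (N + 1 : ℕ)) ^ N * ((R + (N + 1 : ℕ)) * ‖(Gamma (s + (N + 1 : ℕ)))⁻¹‖) := by
        gcongr <;> push_cast <;> linarith
      _ = _ := by ring

/-- Uniformity must include `b` near the poles of `Γ`, where the recurrence cannot be divided
through. Shifting by a fixed `N ≥ R + 1` moves `b` to `Re ≥ 1`; the polynomial price of the shift is
absorbed in `3 ^ n`. -/
theorem exists_norm_inv_Gamma_add_nat_le (R : ℝ) :
    ∃ C : ℝ, 0 < C ∧ ∀ b : ℂ, ‖b‖ ≤ R → ∀ n : ℕ, ‖(Gamma (b + n))⁻¹‖ ≤ C * 3 ^ n / n ! := by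
  by_cases hR : R < 0
  · exact ⟨1, one_pos, fun b hb => absurd (hb.trans_lt hR) (not_lt.2 (norm_nonneg b))⟩
  push Not at hR
  obtain ⟨N, hN⟩ := exists_nat_ge (R + 1)
  obtain ⟨C, hC0, hC⟩ := exists_norm_inv_Gamma_le (R + N)
  refine ⟨N ! * Real.exp (R + N) * C, by positivity, fun b hb n => ?_⟩
  have h1 : ‖b + n‖ ≤ R + n := (norm_add_le _ _).trans (by simpa using hb)
  have hre : 1 ≤ (b + N).re := by
    have := (abs_le.1 ((Complex.abs_re_le_norm b).trans hb)).1
    simp; linarith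
  have h2 : ‖(Gamma (b + n + N))⁻¹‖ ≤ C / n ! := by
    have := norm_inv_Gamma_add_nat_le hre n
    rw [show b + n + N = b + N + n by ring]
    refine this.trans ?_
    gcongr
    exact hC _ ((norm_add_le _ _).trans (by simpa using hb))
  have h3 : (R + n + N) ^ N ≤ N ! * (Real.exp (R + N) * 3 ^ n) := by
    have := Real.pow_div_factorial_le_exp (x := R + n + N) (by positivity) N
    rw [div_le_iff₀ (by positivity)] at this
    have h3 : Real.exp (R + n + N) ≤ Real.exp (R + N) * 3 ^ n := by
      rw [show R + n + N = (R + N) + n * 1 by ring, Real.exp_add, Real.exp_nat_mul]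
      gcongr
      exact Real.exp_one_lt_three.le
    calc _ ≤ _ := this
      _ ≤ _ := by rw [mul_comm]; gcongr
  calc _ ≤ (R + n + N) ^ N * ‖(Gamma (b + n + N))⁻¹‖ :=
        norm_inv_Gamma_le_shift (by positivity) h1 N
    _ ≤ N ! * (Real.exp (R + N) * 3 ^ n) * (C / n !) := by gcongr
    _ = _ := by ring

theorem exists_norm_kummerCoeff_le (R : ℝ) :
    ∃ C : ℝ, 0 < C ∧ ∀ b : ℂ, ‖b‖ ≤ R → ∀ (a : ℂ) (T : ℝ), 1 ≤ T → ‖a‖ ≤ T → ∀ n : ℕ,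
      ‖kummerCoeff a b n‖ ≤ C * ((3 * T) ^ n / n !) := by
  obtain ⟨C, hC0, hC⟩ := exists_norm_inv_Gamma_add_nat_le R
  refine ⟨C, hC0, fun b hb a T hT ha n => ?_⟩
  unfold kummerCoeff
  rw [norm_div, norm_mul, norm_natCast]
  calc _ ≤ (T ^ n * n !) * (C * 3 ^ n / n !) / n ! := by
        gcongr
        · exact norm_ascPochhammer_eval_le hT ha n
        · exact hC b hb n
    _ = _ := by rw [mul_pow]; field_simp

theorem summable_norm_kummer (a b z : ℂ) : Summable fun n => ‖kummerCoeff a b n * z ^ n‖ := by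
  obtain ⟨C, hC0, hC⟩ := exists_norm_kummerCoeff_le ‖b‖
  have := (Real.summable_pow_div_factorial (3 * (max 1 ‖a‖) * ‖z‖)).mul_left C
  refine this.of_nonneg_of_le (fun n => norm_nonneg _) fun n => ?_
  rw [norm_mul, norm_pow, mul_pow]
  calc _ ≤ C * ((3 * (max 1 ‖a‖)) ^ n / n !) * ‖z‖ ^ n := by
        gcongr; exact hC b le_rfl a _ (le_max_left _ _) (le_max_right _ _) n
    _ = _ := by ring

theorem summable_kummer (a b z : ℂ) : Summable fun n => kummerCoeff a b n * z ^ n :=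
  (summable_norm_kummer a b z).of_norm

/-- The right side is bounded exactly as long as `T‖z‖` is, which is why the series is only used for
`y ≤ 1/T`. -/
theorem exists_norm_kummerR_le (R : ℝ) :
    ∃ C : ℝ, 0 < C ∧ ∀ b : ℂ, ‖b‖ ≤ R → ∀ (a : ℂ) (T : ℝ), 1 ≤ T → ‖a‖ ≤ T → ∀ z : ℂ,
      ‖kummerR a b z‖ ≤ C * Real.exp (3 * T * ‖z‖) := by
  obtain ⟨C, hC0, hC⟩ := exists_norm_kummerCoeff_le R
  refine ⟨C, hC0, fun b hb a T hT ha z => ?_⟩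
  have hs : HasSum (fun n : ℕ => C * ((3 * T * ‖z‖) ^ n / n !)) (C * Real.exp (3 * T * ‖z‖)) := by
    have := NormedSpace.expSeries_div_hasSum_exp (𝔸 := ℝ) (3 * T * ‖z‖)
    rw [← Real.exp_eq_exp_ℝ] at this
    exact this.mul_left C
  refine tsum_of_norm_bounded hs fun n => ?_
  rw [norm_mul, norm_pow, mul_pow]
  calc _ ≤ C * ((3 * T) ^ n / n !) * ‖z‖ ^ n := by gcongr; exact hC b hb a T hT ha n
    _ = _ := by ring

/-- Keeping the factor `1 / Γ(b)` explicit matters for `b = 1 + 2ir`: there it grows exponentially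
in `r` and has to be cancelled exactly. -/
theorem norm_kummerR_le_of_one_le_re {a b z : ℂ} {T : ℝ} (hT : 1 ≤ T) (ha : ‖a‖ ≤ T)
    (hb : 1 ≤ b.re) : ‖kummerR a b z‖ ≤ ‖(Gamma b)⁻¹‖ * Real.exp (T * ‖z‖) := by
  have hs : HasSum (fun n : ℕ => ‖(Gamma b)⁻¹‖ * ((T * ‖z‖) ^ n / n !))
      (‖(Gamma b)⁻¹‖ * Real.exp (T * ‖z‖)) := by
    have := NormedSpace.expSeries_div_hasSum_exp (𝔸 := ℝ) (T * ‖z‖)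
    rw [← Real.exp_eq_exp_ℝ] at this
    exact this.mul_left _
  refine tsum_of_norm_bounded hs fun n => ?_
  unfold kummerCoeff
  rw [norm_mul, norm_pow, mul_pow, norm_div, norm_mul, norm_natCast]
  calc _ ≤ (T ^ n * n !) * (‖(Gamma b)⁻¹‖ / n !) / n ! * ‖z‖ ^ n := by
        gcongr
        · exact norm_ascPochhammer_eval_le hT ha n
        · exact norm_inv_Gamma_add_nat_le hb n
    _ = _ := by field_simp

theorem ascPochhammer_eval_succ_left (a : ℂ) (n : ℕ) :
    (ascPochhammer ℂ (n + 1)).eval a = a * (ascPochhammer ℂ n).eval (a + 1) := by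
  simp [ascPochhammer_succ_left, Polynomial.eval_comp]

theorem kummerCoeff_succ (a b : ℂ) (n : ℕ) :
    (n + 1) * kummerCoeff a b (n + 1) = a * kummerCoeff (a + 1) (b + 1) n := by
  unfold kummerCoeff
  rw [ascPochhammer_eval_succ_left, show b + ((n + 1 : ℕ) : ℂ) = b + 1 + n by push_cast; ring,
    Nat.factorial_succ]
  push_cast
  field_simp

theorem hasDerivAt_kummerR (a b z : ℂ) :
    HasDerivAt (kummerR a b) (a * kummerR (a + 1) (b + 1) z) z := by
  -- Termwise differentiation on the disc of radius `‖z‖ + 1`; after an index shift the derived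
  -- series is `a` times the Kummer series with both parameters raised by one.
  have hbd : Summable fun n : ℕ => ‖kummerCoeff a b n * (n * ((‖z‖ + 1 : ℝ) : ℂ) ^ (n - 1))‖ := by
    rw [← summable_nat_add_iff 1]
    have := (summable_norm_kummer (a + 1) (b + 1) ((‖z‖ + 1 : ℝ) : ℂ)).mul_left ‖a‖
    refine this.congr fun n => ?_
    rw [← norm_mul, ← mul_assoc, ← kummerCoeff_succ]
    push_cast
    congr 1; ring
  have key := hasDerivAt_tsum_of_isPreconnected (t := Metric.ball (0 : ℂ) (‖z‖ + 1))
    (g := fun n z => kummerCoeff a b n * z ^ n)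
    (g' := fun n z => kummerCoeff a b n * (n * z ^ (n - 1))) (y₀ := 0) (y := z) hbd
    Metric.isOpen_ball (convex_ball _ _).isPreconnected
    (fun n y _ => (hasDerivAt_pow n y).const_mul _)
    (fun n y hy => ?_) (by simp; positivity) (summable_kummer a b 0) (by simp)
  · suffices h : a * kummerR (a + 1) (b + 1) z =
        ∑' n : ℕ, kummerCoeff a b n * (n * z ^ (n - 1)) by rw [h]; exact key
    rw [kummerR, ← tsum_mul_left]
    have hs : Summable fun n : ℕ => kummerCoeff a b n * (n * z ^ (n - 1)) := by
      rw [← summable_nat_add_iff 1]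
      refine ((summable_kummer (a + 1) (b + 1) z).mul_left a).congr fun n => ?_
      rw [← mul_assoc, ← kummerCoeff_succ]; push_cast; ring
    rw [hs.tsum_eq_zero_add]
    simp only [CharP.cast_eq_zero, zero_mul, mul_zero, zero_add]
    refine tsum_congr fun n => ?_
    rw [← mul_assoc, ← kummerCoeff_succ]; push_cast; ring
  · rw [norm_mul, norm_mul, norm_mul, norm_mul, norm_pow, norm_pow]
    have : ‖y‖ ≤ ‖((‖z‖ + 1 : ℝ) : ℂ)‖ := by
      rw [Complex.norm_real, Real.norm_of_nonneg (by positivity)]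
      exact (mem_ball_zero_iff.1 hy).le
    gcongr

/-- Multiplied by `a`, this is Kummer's equation `z u'' + (b - z) u' - a u = 0`, with the
derivatives written through raised parameters. Not multiplying by `a` lets it also serve as a
recurrence for Laguerre polynomials. -/
theorem kummerR_lower (a b z : ℂ) :
    kummerR a b z = b * kummerR (a + 1) (b + 1) z +
      z * ((a + 1) * kummerR (a + 1 + 1) (b + 1 + 1) z - kummerR (a + 1) (b + 1) z) := by
  have hA := (summable_kummer (a + 1) (b + 1) z).mul_left b
  have hB := (summable_kummer (a + 1 + 1) (b + 1 + 1) z).mul_left (a + 1)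
  have hC := summable_kummer (a + 1) (b + 1) z
  have h0 := (summable_kummer a b z).tsum_eq_zero_add
  have hA0 := hA.tsum_eq_zero_add
  have e1 : z * ((a + 1) * kummerR (a + 1 + 1) (b + 1 + 1) z - kummerR (a + 1) (b + 1) z)
      = ∑' n : ℕ, z * ((a + 1) * (kummerCoeff (a + 1 + 1) (b + 1 + 1) n * z ^ n) -
        kummerCoeff (a + 1) (b + 1) n * z ^ n) := by
    rw [tsum_mul_left, (hB.tsum_sub hC), tsum_mul_left]; rfl
  have e2 : b * kummerR (a + 1) (b + 1) z =
      ∑' n : ℕ, b * (kummerCoeff (a + 1) (b + 1) n * z ^ n) := by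
    rw [tsum_mul_left]; rfl
  rw [e1, e2, hA0, add_assoc, ← Summable.tsum_add ((summable_nat_add_iff 1).2 hA)
    ((hB.sub hC).mul_left z)]
  rw [kummerR, h0]
  congr 1
  · simp only [kummerCoeff, ascPochhammer_zero, Polynomial.eval_one]
    simp only [CharP.cast_eq_zero, add_zero, pow_zero, inv_Gamma_eq b]
    ring
  · refine tsum_congr fun n => ?_
    have h1 := kummerCoeff_succ (a + 1) (b + 1) n
    rw [show (a + 1) * (kummerCoeff (a + 1 + 1) (b + 1 + 1) n * z ^ n) =
      ((n + 1) * kummerCoeff (a + 1) (b + 1) (n + 1)) * z ^ n by rw [h1]; ring]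
    simp only [kummerCoeff]
    rw [ascPochhammer_eval_succ_left a, ascPochhammer_succ_eval n (a + 1),
      show b + 1 + ((n + 1 : ℕ) : ℂ) = (b + (n + 1 : ℕ)) + 1 by push_cast; ring,
      inv_Gamma_eq (b + (n + 1 : ℕ)), show b + 1 + (n : ℂ) = b + (n + 1 : ℕ) by push_cast; ring,
      inv_Gamma_eq (b + (n + 1 : ℕ)), Nat.factorial_succ]
    have hf : (n ! : ℂ) ≠ 0 := by exact_mod_cast Nat.factorial_ne_zero n
    have hn : (n : ℂ) + 1 ≠ 0 := by exact_mod_cast Nat.succ_ne_zero n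
    push_cast
    field_simp
    ring

theorem kummerR_contiguous (a b z : ℂ) :
    (b - a) * kummerR a (b + 1) z = kummerR a b z - a * kummerR (a + 1) (b + 1) z := by
  unfold kummerR
  rw [← tsum_mul_left, ← tsum_mul_left,
    ← (summable_kummer a b z).tsum_sub ((summable_kummer (a + 1) (b + 1) z).mul_left a)]
  refine tsum_congr fun n => ?_
  unfold kummerCoeff
  have h : a * (ascPochhammer ℂ n).eval (a + 1) = (ascPochhammer ℂ n).eval a * (a + n) := by
    rw [← ascPochhammer_eval_succ_left, ascPochhammer_succ_eval]
  rw [inv_Gamma_eq (b + n), show b + n + 1 = b + 1 + n by ring]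
  linear_combination (Gamma (b + 1 + n))⁻¹ / (n ! : ℂ) * z ^ n * h

/-- The first `k` coefficients vanish because `1 / Γ` does at `1 - k, …, 0`. At half-integers the
two regularized solutions therefore become proportional, which is what makes `W` a limit there. -/
theorem kummerR_one_sub_nat (a z : ℂ) (k : ℕ) :
    kummerR a (1 - k) z =
      (ascPochhammer ℂ k).eval a * z ^ k * kummerR (a + k) (1 + k) z := by
  have hs := summable_kummer a (1 - k) z
  rw [kummerR, ← hs.sum_add_tsum_nat_add k, kummerR, ← tsum_mul_left,
    Finset.sum_eq_zero, zero_add]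
  · refine tsum_congr fun n => ?_
    unfold kummerCoeff
    have h1 : Gamma (1 - (k : ℂ) + ((n + k : ℕ) : ℂ)) = n ! := by
      rw [← Complex.Gamma_nat_eq_factorial]; push_cast; ring_nf
    have h2 : Gamma (1 + (k : ℂ) + (n : ℂ)) = (n + k)! := by
      rw [← Complex.Gamma_nat_eq_factorial]; push_cast; ring_nf
    have h3 : (ascPochhammer ℂ (n + k)).eval a =
        (ascPochhammer ℂ k).eval a * (ascPochhammer ℂ n).eval (a + k) := by
      rw [add_comm n k, ← ascPochhammer_mul]; simp [Polynomial.eval_comp]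
    rw [h1, h2, h3, pow_add]
    ring
  · intro n hn
    have : Gamma (1 - (k : ℂ) + (n : ℂ)) = 0 := by
      rw [Gamma_eq_zero_iff]
      refine ⟨k - 1 - n, ?_⟩
      have : n < k := Finset.mem_range.1 hn
      rw [Nat.cast_sub (by omega), Nat.cast_sub (by omega)]; push_cast; ring
    simp [kummerCoeff, this]

/-- Weierstrass M-test on a unit ball: the coefficient bound is uniform for parameters in a compact
set, and each term is entire since `1 / Γ` is. -/
theorem differentiable_kummerR_param {a b : ℂ → ℂ} (ha : Differentiable ℂ a)
    (hb : Differentiable ℂ b) (z : ℂ) : Differentiable ℂ fun μ => kummerR (a μ) (b μ) z := by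
  intro μ₀
  set S := Metric.ball μ₀ 1
  obtain ⟨Ra, hRa⟩ := (isCompact_closedBall μ₀ 1).exists_bound_of_continuousOn
    ha.continuous.continuousOn
  obtain ⟨Rb, hRb⟩ := (isCompact_closedBall μ₀ 1).exists_bound_of_continuousOn
    hb.continuous.continuousOn
  obtain ⟨C, hC0, hC⟩ := exists_norm_kummerCoeff_le Rb
  have hsum := (Real.summable_pow_div_factorial (3 * (max 1 Ra) * ‖z‖)).mul_left C
  have key := differentiableOn_tsum_of_summable_norm (U := S)
    (F := fun n μ => kummerCoeff (a μ) (b μ) n * z ^ n) hsum (fun n => ?_) Metric.isOpen_ball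
    (fun n μ hμ => ?_)
  · exact (key.differentiableAt (Metric.isOpen_ball.mem_nhds (Metric.mem_ball_self one_pos)))
  · refine Differentiable.differentiableOn ?_
    unfold kummerCoeff
    have h1 : Differentiable ℂ fun μ => (ascPochhammer ℂ n).eval (a μ) :=
      (ascPochhammer ℂ n).differentiable.comp ha
    have h2 : Differentiable ℂ fun μ => (Gamma (b μ + n))⁻¹ :=
      differentiable_one_div_Gamma.comp (hb.add_const _)
    exact ((h1.mul h2).div_const _).mul_const _
  · have hμ' := Metric.ball_subset_closedBall hμ
    rw [norm_mul, norm_pow, mul_pow]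
    calc _ ≤ C * ((3 * (max 1 Ra)) ^ n / n !) * ‖z‖ ^ n := by
          gcongr
          exact hC _ (hRb μ hμ') _ _ (le_max_left _ _) ((hRa μ hμ').trans (le_max_right _ _)) n
      _ = _ := by ring

end Whittaker

/-! ### Regularized Whittaker functions, Whittaker's equation and Wronskians -/

namespace Whittaker

open Complex Filter Topology Nat
open scoped Real

/-- The Whittaker function `M_{p,μ}` divided by `Γ(1 + 2 μ)`; it is entire in `μ`. -/
noncomputable def whittakerN (p μ : ℂ) (y : ℝ) : ℂ :=
  (y : ℂ) ^ (μ + 1 / 2) * Complex.exp (-(y : ℂ) / 2) * kummerR (1 / 2 + μ - p) (1 + 2 * μ) (y : ℂ)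

/-- The entire function of `μ` whose product with `π / sin (2 π μ)` is `W_{p,μ}(y)`. -/
noncomputable def whittakerH (p μ : ℂ) (y : ℝ) : ℂ :=
  (Gamma (1 / 2 + μ - p))⁻¹ * whittakerN p (-μ) y - (Gamma (1 / 2 - μ - p))⁻¹ * whittakerN p μ y

theorem whittakerM_eq (p ν : ℂ) (y : ℝ) :
    whittakerM p ν y = Gamma (1 + 2 * ν) * whittakerN p ν y := by
  unfold whittakerM whittakerN kummerPhi
  rw [regularizedHGFun_eq_kummerR]
  ring

/-- Reflection for `Γ(±2μ) Γ(1 ∓ 2μ)`; the two signs of the sine produce the minus sign in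
`whittakerH`. -/
theorem whittakerWGeneric_eq (p μ : ℂ) (y : ℝ) :
    whittakerWGeneric p μ y = π / Complex.sin (2 * π * μ) * whittakerH p μ y := by
  unfold whittakerWGeneric whittakerH
  rw [whittakerM_eq, whittakerM_eq]
  have h1 := Gamma_mul_Gamma_one_sub (2 * μ)
  have h2 := Gamma_mul_Gamma_one_sub (-2 * μ)
  rw [show (π : ℂ) * (2 * μ) = 2 * π * μ by ring] at h1
  rw [show (π : ℂ) * (-2 * μ) = -(2 * π * μ) by ring, Complex.sin_neg, div_neg,
    show 1 - -2 * μ = 1 + 2 * μ by ring] at h2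
  rw [show 1 + 2 * -μ = 1 - 2 * μ by ring, div_eq_mul_inv (Gamma (-2 * μ)), div_eq_mul_inv (Gamma (2 * μ))]
  linear_combination (Gamma (1 / 2 - μ - p))⁻¹ * whittakerN p μ y * h2 +
    (Gamma (1 / 2 + μ - p))⁻¹ * whittakerN p (-μ) y * h1

theorem differentiable_whittakerN (p : ℂ) {y : ℝ} (hy : 0 < y) :
    Differentiable ℂ fun μ => whittakerN p μ y := by
  have hy' : (y : ℂ) ≠ 0 := by exact_mod_cast hy.ne'
  have h1 : Differentiable ℂ fun μ : ℂ => (y : ℂ) ^ (μ + 1 / 2) := fun μ =>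
    ((differentiableAt_id.add_const _).const_cpow (Or.inl hy'))
  have h2 := differentiable_kummerR_param (a := fun μ => 1 / 2 + μ - p) (b := fun μ => 1 + 2 * μ)
    (by fun_prop) (by fun_prop) (y : ℂ)
  exact (h1.mul_const _).mul h2

theorem differentiable_inv_Gamma_comp {g : ℂ → ℂ} (hg : Differentiable ℂ g) :
    Differentiable ℂ fun μ => (Gamma (g μ))⁻¹ := differentiable_one_div_Gamma.comp hg

theorem differentiable_whittakerH (p : ℂ) {y : ℝ} (hy : 0 < y) :
    Differentiable ℂ fun μ => whittakerH p μ y := by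
  have h1 := differentiable_whittakerN p hy
  have h2 : Differentiable ℂ fun μ => whittakerN p (-μ) y := h1.comp differentiable_neg
  exact ((differentiable_inv_Gamma_comp (g := fun μ => 1 / 2 + μ - p) (by fun_prop)).mul h2).sub
    ((differentiable_inv_Gamma_comp (g := fun μ => 1 / 2 - μ - p) (by fun_prop)).mul h1)

theorem whittakerH_zero (p : ℂ) (y : ℝ) : whittakerH p 0 y = 0 := by simp [whittakerH]

theorem whittakerN_neg_half_nat (p : ℂ) (k : ℕ) {y : ℝ} (hy : 0 < y) :
    whittakerN p (-(k / 2)) y =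
      (ascPochhammer ℂ k).eval (1 / 2 - k / 2 - p) * whittakerN p (k / 2) y := by
  have hy' : (y : ℂ) ≠ 0 := by exact_mod_cast hy.ne'
  unfold whittakerN
  rw [show (1 : ℂ) + 2 * -(k / 2) = 1 - k by ring, kummerR_one_sub_nat,
    show (1 : ℂ) / 2 + -(k / 2) - p = 1 / 2 - k / 2 - p by ring,
    show (1 : ℂ) / 2 - k / 2 - p + k = 1 / 2 + k / 2 - p by ring,
    show (1 : ℂ) + 2 * (k / 2) = 1 + k by ring,
    show (k : ℂ) / 2 + 1 / 2 = -(k / 2) + 1 / 2 + k by ring, cpow_add _ (k : ℂ) hy', cpow_natCast]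
  generalize (y : ℂ) ^ (-(k / 2 : ℂ) + 1 / 2) = X
  ring

/-- The factor relating `N_{-1/2}` to `N_{1/2}` is `-p`, and `-p / Γ(1 - p) = 1 / Γ(-p)`, so the two
terms cancel. -/
theorem whittakerH_half (p : ℂ) {y : ℝ} (hy : 0 < y) : whittakerH p (1 / 2) y = 0 := by
  have h := whittakerN_neg_half_nat p 1 hy
  simp only [Nat.cast_one, ascPochhammer_one, Polynomial.eval_X] at h
  unfold whittakerH
  rw [h, inv_Gamma_eq (1 / 2 - 1 / 2 - p),
    show (1 : ℂ) / 2 - 1 / 2 - p + 1 = 1 / 2 + 1 / 2 - p by ring]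
  ring

/-- `f` solves Whittaker's equation with parameters `p`, `ν` on `(0, ∞)`, with derivative `f'`. -/
structure IsWhittaker (p ν : ℂ) (f f' : ℝ → ℂ) : Prop where
  hasDerivAt : ∀ y : ℝ, 0 < y → HasDerivAt f (f' y) y
  hasDerivAt' : ∀ y : ℝ, 0 < y →
    HasDerivAt f' ((1 / 4 - p / y + (ν ^ 2 - 1 / 4) / y ^ 2) * f y) y

namespace IsWhittaker

variable {p ν : ℂ} {f f' g g' : ℝ → ℂ}

theorem neg_param (h : IsWhittaker p (-ν) f f') : IsWhittaker p ν f f' :=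
  ⟨h.1, by simpa using h.2⟩

theorem const_mul (h : IsWhittaker p ν f f') (c : ℂ) :
    IsWhittaker p ν (fun y => c * f y) (fun y => c * f' y) :=
  ⟨fun y hy => (h.1 y hy).const_mul c, fun y hy => by
    exact ((h.2 y hy).const_mul c).congr_deriv (by ring)⟩

theorem sub (hf : IsWhittaker p ν f f') (hg : IsWhittaker p ν g g') :
    IsWhittaker p ν (fun y => f y - g y) (fun y => f' y - g' y) :=
  ⟨fun y hy => (hf.1 y hy).sub (hg.1 y hy), fun y hy => by
    exact ((hf.2 y hy).sub (hg.2 y hy)).congr_deriv (by ring)⟩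

theorem wronskian_eq (hf : IsWhittaker p ν f f') (hg : IsWhittaker p ν g g') {y z : ℝ}
    (hy : 0 < y) (hz : 0 < z) : f y * g' y - f' y * g y = f z * g' z - f' z * g z := by
  have hd : ∀ x ∈ Set.Ioi (0 : ℝ), HasDerivAt (fun x => f x * g' x - f' x * g x) 0 x := by
    intro x hx
    exact (((hf.1 x hx).mul (hg.2 x hx)).sub ((hf.2 x hx).mul (hg.1 x hx))).congr_deriv (by ring)
  exact isOpen_Ioi.is_const_of_deriv_eq_zero isPreconnected_Ioi
    (fun x hx => (hd x hx).differentiableAt.differentiableWithinAt)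
    (fun x hx => (hd x hx).deriv) hy hz

/-- The equation has no first-order term, so Wronskians are constant and can be read off from the
behaviour at `0+`. -/
theorem wronskian_eq_of_tendsto (hf : IsWhittaker p ν f f') (hg : IsWhittaker p ν g g') {L : ℂ}
    (hL : Tendsto (fun y => f y * g' y - f' y * g y) (𝓝[>] 0) (𝓝 L)) {y : ℝ} (hy : 0 < y) :
    f y * g' y - f' y * g y = L := by
  refine tendsto_nhds_unique (tendsto_const_nhds.congr' ?_) hL
  filter_upwards [self_mem_nhdsWithin] with z hz
  exact hf.wronskian_eq hg hy hz

/-- A solution of Kummer's equation yields one of Whittaker's equation. -/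
theorem of_kummer {u u₁ u₂ : ℝ → ℂ} (h₁ : ∀ y : ℝ, 0 < y → HasDerivAt u (u₁ y) y)
    (h₂ : ∀ y : ℝ, 0 < y → HasDerivAt u₁ (u₂ y) y)
    (h : ∀ y : ℝ, 0 < y → y * u₂ y + (1 + 2 * ν - y) * u₁ y - (1 / 2 + ν - p) * u y = 0) :
    IsWhittaker p ν (fun y => (y : ℂ) ^ (ν + 1 / 2) * Complex.exp (-(y : ℂ) / 2) * u y)
      (fun y => (y : ℂ) ^ (ν + 1 / 2) * Complex.exp (-(y : ℂ) / 2) *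
        (((ν + 1 / 2) / y - 1 / 2) * u y + u₁ y)) := by
  have hE : ∀ y : ℝ, 0 < y → HasDerivAt
      (fun y : ℝ => (y : ℂ) ^ (ν + 1 / 2) * Complex.exp (-(y : ℂ) / 2))
      ((y : ℂ) ^ (ν + 1 / 2) * Complex.exp (-(y : ℂ) / 2) * ((ν + 1 / 2) / y - 1 / 2)) y := by
    intro y hy
    have hy' : (y : ℂ) ≠ 0 := by exact_mod_cast hy.ne'
    have e1 : HasDerivAt (fun z : ℂ => z ^ (ν + 1 / 2)) _ (y : ℂ) :=
      (hasDerivAt_id (y : ℂ)).cpow_const (Or.inl (by simpa using hy))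
    have e2 : HasDerivAt (fun z : ℂ => Complex.exp (-z / 2)) _ (y : ℂ) :=
      ((hasDerivAt_id (y : ℂ)).neg.div_const 2).cexp
    refine ((e1.mul e2).comp_ofReal).congr_deriv ?_
    simp only [Pi.neg_apply, id, cpow_sub _ 1 hy', cpow_one]
    generalize (y : ℂ) ^ (ν + 1 / 2) = X
    field_simp
    ring
  refine ⟨fun y hy => ?_, fun y hy => ?_⟩
  · exact ((hE y hy).mul (h₁ y hy)).congr_deriv (by ring)
  · have hy' : (y : ℂ) ≠ 0 := by exact_mod_cast hy.ne'
    have e3 : HasDerivAt (fun y : ℝ => (ν + 1 / 2) / (y : ℂ) - 1 / 2)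
        (-(ν + 1 / 2) / (y : ℂ) ^ 2) y := by
      have : HasDerivAt (fun z : ℂ => (ν + 1 / 2) / z - 1 / 2) _ (y : ℂ) :=
        (((hasDerivAt_id (y : ℂ)).fun_inv hy').const_mul (ν + 1 / 2)).sub_const (1 / 2)
      refine this.comp_ofReal.congr_deriv ?_
      simp only [id]
      ring
    refine ((hE y hy).mul ((e3.mul (h₁ y hy)).add (h₂ y hy))).congr_deriv ?_
    have hk := h y hy
    have hu₂ : u₂ y = ((1 / 2 + ν - p) * u y - (1 + 2 * ν - y) * u₁ y) / y := by
      rw [eq_div_iff hy']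
      linear_combination hk
    simp only [Pi.add_apply, Pi.mul_apply]
    rw [hu₂]
    generalize (y : ℂ) ^ (ν + 1 / 2) = X
    field_simp
    ring

end IsWhittaker

/-- The derivative of `whittakerN p μ`. -/
noncomputable def whittakerN' (p μ : ℂ) (y : ℝ) : ℂ :=
  (y : ℂ) ^ (μ + 1 / 2) * Complex.exp (-(y : ℂ) / 2) *
    (((μ + 1 / 2) / y - 1 / 2) * kummerR (1 / 2 + μ - p) (1 + 2 * μ) (y : ℂ) +
      (1 / 2 + μ - p) * kummerR (1 / 2 + μ - p + 1) (1 + 2 * μ + 1) (y : ℂ))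

theorem isWhittaker_whittakerN (p μ : ℂ) : IsWhittaker p μ (whittakerN p μ) (whittakerN' p μ) := by
  refine IsWhittaker.of_kummer (u := fun y => kummerR (1 / 2 + μ - p) (1 + 2 * μ) (y : ℂ))
    (u₁ := fun y => (1 / 2 + μ - p) * kummerR (1 / 2 + μ - p + 1) (1 + 2 * μ + 1) (y : ℂ))
    (u₂ := fun y => (1 / 2 + μ - p) * ((1 / 2 + μ - p + 1) *
      kummerR (1 / 2 + μ - p + 1 + 1) (1 + 2 * μ + 1 + 1) (y : ℂ)))
    (fun y _ => (hasDerivAt_kummerR _ _ _).comp_ofReal)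
    (fun y _ => ((hasDerivAt_kummerR _ _ _).comp_ofReal).const_mul _) fun y _ => ?_
  linear_combination (-(1 / 2 + μ - p)) * kummerR_lower (1 / 2 + μ - p) (1 + 2 * μ) (y : ℂ)

theorem kummerR_zero (a b : ℂ) : kummerR a b 0 = (Gamma b)⁻¹ := by
  rw [kummerR, tsum_eq_single 0 (fun n hn => by simp [hn])]
  simp [kummerCoeff]

theorem tendsto_kummerR_zero (a b : ℂ) :
    Tendsto (fun y : ℝ => kummerR a b (y : ℂ)) (𝓝[>] 0) (𝓝 (Gamma b)⁻¹) := by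
  have h : Continuous fun y : ℝ => kummerR a b (y : ℂ) :=
    (continuous_iff_continuousAt.2 fun z => (hasDerivAt_kummerR a b z).continuousAt).comp
      continuous_ofReal
  have := (h.tendsto 0).mono_left (nhdsWithin_le_nhds (s := Set.Ioi 0))
  rwa [ofReal_zero, kummerR_zero] at this

theorem tendsto_ofReal_zero : Tendsto (fun y : ℝ => (y : ℂ)) (𝓝[>] 0) (𝓝 0) := by
  have := (continuous_ofReal.tendsto 0).mono_left (nhdsWithin_le_nhds (s := Set.Ioi 0))
  simpa using this

/-- As `y → 0` only the leading powers contribute, giving `2μ / (Γ(1 + 2μ) Γ(1 - 2μ))`, which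
reflection evaluates. -/
theorem wronskian_whittakerN (p μ : ℂ) {y : ℝ} (hy : 0 < y) :
    whittakerN p (-μ) y * whittakerN' p μ y - whittakerN' p (-μ) y * whittakerN p μ y =
      Complex.sin (2 * π * μ) / π := by
  refine (isWhittaker_whittakerN p (-μ)).neg_param.wronskian_eq_of_tendsto
    (isWhittaker_whittakerN p μ) ?_ hy
  set A := fun y : ℝ => kummerR (1 / 2 + μ - p) (1 + 2 * μ) (y : ℂ)
  set A' := fun y : ℝ => (1 / 2 + μ - p) * kummerR (1 / 2 + μ - p + 1) (1 + 2 * μ + 1) (y : ℂ)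
  set B := fun y : ℝ => kummerR (1 / 2 + -μ - p) (1 + 2 * -μ) (y : ℂ)
  set B' := fun y : ℝ => (1 / 2 + -μ - p) * kummerR (1 / 2 + -μ - p + 1) (1 + 2 * -μ + 1) (y : ℂ)
  have hA : Tendsto A (𝓝[>] 0) (𝓝 _) := tendsto_kummerR_zero _ _
  have hA' : Tendsto A' (𝓝[>] 0) (𝓝 _) := (tendsto_kummerR_zero _ _).const_mul _
  have hB : Tendsto B (𝓝[>] 0) (𝓝 _) := tendsto_kummerR_zero _ _
  have hB' : Tendsto B' (𝓝[>] 0) (𝓝 _) := (tendsto_kummerR_zero _ _).const_mul _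
  have hE : Tendsto (fun y : ℝ => Complex.exp (-(y : ℂ))) (𝓝[>] 0) (𝓝 (Complex.exp (-0))) :=
    (Complex.continuous_exp.tendsto _).comp tendsto_ofReal_zero.neg
  have key := hE.mul (((hA.mul hB).const_mul (2 * μ)).add
    (tendsto_ofReal_zero.mul ((hB.mul hA').sub (hB'.mul hA))))
  have hval : Complex.exp (-0) * (2 * μ * ((Gamma (1 + 2 * μ))⁻¹ * (Gamma (1 + 2 * -μ))⁻¹) +
      0 * ((Gamma (1 + 2 * -μ))⁻¹ * ((1 / 2 + μ - p) * (Gamma (1 + 2 * μ + 1))⁻¹) -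
        (1 / 2 + -μ - p) * (Gamma (1 + 2 * -μ + 1))⁻¹ * (Gamma (1 + 2 * μ))⁻¹)) =
      Complex.sin (2 * π * μ) / π := by
    have h1 := Gamma_mul_Gamma_one_sub (2 * μ)
    rw [show (π : ℂ) * (2 * μ) = 2 * π * μ by ring] at h1
    rw [← inv_div (π : ℂ), ← h1, mul_inv, inv_Gamma_eq (2 * μ), neg_zero, Complex.exp_zero]
    ring_nf
  rw [hval] at key
  refine key.congr' ?_
  filter_upwards [self_mem_nhdsWithin] with z hz
  have hz' : (z : ℂ) ≠ 0 := by exact_mod_cast (ne_of_gt hz)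
  have e1 : (z : ℂ) ^ (μ + 1 / 2) * (z : ℂ) ^ (-μ + 1 / 2) = z := by
    rw [← cpow_add _ _ hz']; ring_nf; simp
  have e2 : Complex.exp (-(z : ℂ) / 2) * Complex.exp (-(z : ℂ) / 2) = Complex.exp (-(z : ℂ)) := by
    rw [← Complex.exp_add]; ring_nf
  have e : (whittakerN p (-μ) z * whittakerN' p μ z - whittakerN' p (-μ) z * whittakerN p μ z) =
      ((z : ℂ) ^ (μ + 1 / 2) * (z : ℂ) ^ (-μ + 1 / 2)) *
      (Complex.exp (-(z : ℂ) / 2) * Complex.exp (-(z : ℂ) / 2)) *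
      (2 * μ / z * (A z * B z) + (B z * A' z - B' z * A z)) := by
    simp only [whittakerN, whittakerN', A, A', B, B']
    ring
  rw [e, e1, e2]
  field_simp

/-- The derivative of `whittakerH p μ`. -/
noncomputable def whittakerH' (p μ : ℂ) (y : ℝ) : ℂ :=
  (Gamma (1 / 2 + μ - p))⁻¹ * whittakerN' p (-μ) y - (Gamma (1 / 2 - μ - p))⁻¹ * whittakerN' p μ y

theorem isWhittaker_whittakerH (p μ : ℂ) : IsWhittaker p μ (whittakerH p μ) (whittakerH' p μ) :=
  ((isWhittaker_whittakerN p (-μ)).neg_param.const_mul _).sub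
    ((isWhittaker_whittakerN p μ).const_mul _)

end Whittaker

/-! ### Tricomi's integral: differential equation, symmetry and behaviour at the origin -/

namespace Whittaker

open Complex Filter Topology Nat MeasureTheory Set
open scoped Real

/-- Tricomi's integral `∫₀^∞ e^{-yt} t^{c-1} (1+t)^{-d} dt`. -/
noncomputable def tricomi (c d : ℂ) (y : ℝ) : ℂ :=
  ∫ t : ℝ in Ioi 0, Complex.exp (-(y * t)) * ((t : ℂ) ^ (c - 1) * (1 + t : ℂ) ^ (-d))

theorem integrableOn_rpow_mul_exp {s y : ℝ} (hs : -1 < s) (hy : 0 < y) :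
    IntegrableOn (fun t : ℝ => t ^ s * Real.exp (-(y * t))) (Ioi 0) := by
  simpa using integrableOn_rpow_mul_exp_neg_mul_rpow hs (p := 1) one_pos hy

theorem continuousOn_tricomi_integrand (c d : ℂ) (y : ℝ) : ContinuousOn
    (fun t : ℝ => Complex.exp (-(y * t)) * ((t : ℂ) ^ c * (1 + t : ℂ) ^ d)) (Ioi 0) := by
  intro t ht
  have ht : 0 < t := ht
  have h1 : ContinuousAt (fun t : ℝ => (t : ℂ) ^ c) t :=
    continuousAt_ofReal_cpow_const _ _ (Or.inr ht.ne')
  have h2 : ContinuousAt (fun t : ℝ => (1 + t : ℂ) ^ d) t := by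
    refine ContinuousAt.cpow (by fun_prop) continuousAt_const ?_
    left; simp; linarith
  have h3 : ContinuousAt (fun t : ℝ => Complex.exp (-(y * t))) t := by fun_prop
  exact (h3.mul (h1.mul h2)).continuousWithinAt

theorem norm_tricomi_integrand (c d : ℂ) (y : ℝ) {t : ℝ} (ht : 0 < t) :
    ‖Complex.exp (-(y * t)) * ((t : ℂ) ^ c * (1 + t : ℂ) ^ d)‖ =
      t ^ c.re * (1 + t) ^ d.re * Real.exp (-(y * t)) := by
  rw [norm_mul, norm_mul, norm_cpow_eq_rpow_re_of_pos ht, Complex.norm_exp,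
    show (1 + t : ℂ) = ((1 + t : ℝ) : ℂ) by push_cast; rfl,
    norm_cpow_eq_rpow_re_of_pos (by linarith), mul_comm]
  congr 2
  simp

theorem norm_tricomi_integrand_le {c d : ℂ} (hd : 0 ≤ d.re) (y : ℝ) {t : ℝ} (ht : 0 < t) :
    ‖Complex.exp (-(y * t)) * ((t : ℂ) ^ (c - 1) * (1 + t : ℂ) ^ (-d))‖ ≤
      t ^ (c.re - 1) * Real.exp (-(y * t)) := by
  rw [norm_tricomi_integrand _ _ _ ht]
  have : (1 + t) ^ (-d).re ≤ 1 := Real.rpow_le_one_of_one_le_of_nonpos (by linarith) (by simpa)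
  have h0 : 0 ≤ t ^ (c.re - 1) := by positivity
  have : t ^ (c.re - 1) * (1 + t) ^ (-d).re ≤ t ^ (c.re - 1) := by nlinarith
  simp only [sub_re, one_re]
  gcongr

theorem integrableOn_tricomi {c d : ℂ} {y : ℝ} (hc : 0 < c.re) (hd : 0 ≤ d.re) (hy : 0 < y) :
    IntegrableOn (fun t : ℝ => Complex.exp (-(y * t)) * ((t : ℂ) ^ (c - 1) * (1 + t : ℂ) ^ (-d)))
      (Ioi 0) := by
  refine Integrable.mono' (integrableOn_rpow_mul_exp (s := c.re - 1) (by linarith) hy)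
    ((continuousOn_tricomi_integrand _ _ y).aestronglyMeasurable measurableSet_Ioi) ?_
  filter_upwards [ae_restrict_mem measurableSet_Ioi] with t ht
  exact norm_tricomi_integrand_le hd y ht

theorem hasDerivAt_tricomi {c d : ℂ} {y : ℝ} (hc : 0 < c.re) (hd : 0 ≤ d.re) (hy : 0 < y) :
    HasDerivAt (tricomi c d) (-tricomi (c + 1) d y) y := by
  have key := hasDerivAt_integral_of_dominated_loc_of_deriv_le (μ := volume.restrict (Ioi (0 : ℝ)))
    (F := fun (y t : ℝ) => Complex.exp (-(y * t)) * ((t : ℂ) ^ (c - 1) * (1 + t : ℂ) ^ (-d)))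
    (F' := fun (y t : ℝ) => -(Complex.exp (-(y * t)) * ((t : ℂ) ^ (c + 1 - 1) * (1 + t : ℂ) ^ (-d))))
    (bound := fun t => t ^ c.re * Real.exp (-(y / 2 * t))) (x₀ := y) (s := Ioi (y / 2))
    (Ioi_mem_nhds (by linarith)) (.of_forall fun x =>
      (continuousOn_tricomi_integrand _ _ x).aestronglyMeasurable measurableSet_Ioi)
    (integrableOn_tricomi hc hd hy)
    ((continuousOn_tricomi_integrand _ _ y).aestronglyMeasurable measurableSet_Ioi).neg
    ?_ (integrableOn_rpow_mul_exp (by linarith) (by linarith)) ?_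
  · have h2 := key.2
    rw [integral_neg] at h2
    exact h2
  · filter_upwards [ae_restrict_mem measurableSet_Ioi] with t ht x hx
    have ht : 0 < t := ht
    have hx : y / 2 < x := hx
    rw [norm_neg]
    refine (norm_tricomi_integrand_le hd x ht).trans ?_
    rw [add_re, one_re, add_sub_cancel_right]
    gcongr
  · filter_upwards [ae_restrict_mem measurableSet_Ioi] with t ht x _
    have ht' : (t : ℂ) ≠ 0 := by exact_mod_cast (ne_of_gt ht)
    have e : HasDerivAt (fun x : ℝ => Complex.exp (-(x * t))) (Complex.exp (-(x * t)) * -t) x := by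
      have : HasDerivAt (fun x : ℂ => Complex.exp (-(x * t))) (Complex.exp (-(x * t)) * -(1 * t)) x :=
        ((hasDerivAt_id (x : ℂ)).mul_const (t : ℂ)).neg.cexp
      simpa using this.comp_ofReal
    refine (e.mul_const _).congr_deriv ?_
    rw [show c + 1 - 1 = c - 1 + 1 by ring, cpow_add _ _ ht', cpow_one]
    ring

/-- The integrand of the combination is the `t`-derivative of `e^{-yt} t^c (1 + t)^{1-d}`, which
vanishes at both ends. Since each `y`-derivative raises `c` by one and changes sign, this is
Kummer's equation for the integral. -/
theorem tricomi_recurrence {c d : ℂ} {y : ℝ} (hc : 0 < c.re) (hd : 0 ≤ d.re) (hy : 0 < y) :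
    c * tricomi c d y + (c + 1 - d - y) * tricomi (c + 1) d y - y * tricomi (c + 1 + 1) d y = 0 := by
  have i0 := integrableOn_tricomi hc hd hy
  have i1 := integrableOn_tricomi (c := c + 1) (d := d) (by simp; linarith) hd hy
  have i2 := integrableOn_tricomi (c := c + 1 + 1) (d := d) (by simp; linarith) hd hy
  set G : ℝ → ℂ := fun t =>
      (c * (Complex.exp (-(y * t)) * ((t : ℂ) ^ (c - 1) * (1 + t : ℂ) ^ (-d))) +
        (c + 1 - d - y) * (Complex.exp (-(y * t)) * ((t : ℂ) ^ (c + 1 - 1) * (1 + t : ℂ) ^ (-d))) -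
        y * (Complex.exp (-(y * t)) * ((t : ℂ) ^ (c + 1 + 1 - 1) * (1 + t : ℂ) ^ (-d)))) with hG
  have hI : IntegrableOn G (Ioi 0) :=
    ((i0.const_mul c).add (i1.const_mul (c + 1 - d - y))).sub (i2.const_mul (y : ℂ))
  have h0 : c * tricomi c d y + (c + 1 - d - y) * tricomi (c + 1) d y -
      y * tricomi (c + 1 + 1) d y = ∫ t : ℝ in Ioi 0, G t := by
    have e1 := integral_add (i0.const_mul c) (i1.const_mul (c + 1 - d - y))
    have e2 := integral_sub ((i0.const_mul c).add (i1.const_mul (c + 1 - d - y)))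
      (i2.const_mul (y : ℂ))
    simp only [Pi.add_apply] at e2
    rw [hG, e2, e1, integral_const_mul, integral_const_mul, integral_const_mul]
    rfl
  have hc0 : c ≠ 0 := fun h => by simp [h] at hc
  set f : ℝ → ℂ := fun t => Complex.exp (-(y * t)) * ((t : ℂ) ^ c * (1 + t : ℂ) ^ (1 - d)) with hf
  have hcont : ContinuousWithinAt f (Ici 0) 0 := by
    have h1 : ContinuousAt (fun t : ℝ => (t : ℂ) ^ c) 0 :=
      continuousAt_ofReal_cpow_const _ _ (Or.inl hc)
    have h2 : ContinuousAt (fun t : ℝ => (1 + t : ℂ) ^ (1 - d)) 0 := by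
      refine ContinuousAt.cpow (by fun_prop) continuousAt_const ?_
      left; simp
    have h3 : ContinuousAt (fun t : ℝ => Complex.exp (-(y * t))) 0 := by fun_prop
    exact (h3.mul (h1.mul h2)).continuousWithinAt
  have hlim : Tendsto f atTop (𝓝 0) := by
    rw [tendsto_zero_iff_norm_tendsto_zero]
    have hb := (tendsto_rpow_mul_exp_neg_mul_atTop_nhds_zero c.re y hy).add
      (tendsto_rpow_mul_exp_neg_mul_atTop_nhds_zero (c.re + 1) y hy)
    rw [add_zero] at hb
    refine squeeze_zero' (.of_forall fun t => norm_nonneg _) ?_ hb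
    filter_upwards [eventually_gt_atTop 0] with t ht
    rw [hf, norm_tricomi_integrand _ _ _ ht, Real.rpow_add ht, Real.rpow_one, neg_mul]
    have : (1 + t) ^ (1 - d).re ≤ (1 + t) ^ (1 : ℝ) :=
      Real.rpow_le_rpow_of_exponent_le (by linarith) (by simpa)
    rw [Real.rpow_one] at this
    calc _ ≤ t ^ c.re * (1 + t) * Real.exp (-(y * t)) := by gcongr
      _ = _ := by ring
  have key := integral_Ioi_of_hasDerivAt_of_tendsto (f := f) hcont (fun t ht => ?_) hI hlim
  · rw [h0]
    refine key.trans ?_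
    simp [hf, hc0]
  · have ht : 0 < t := ht
    have ht' : (t : ℂ) ≠ 0 := by exact_mod_cast ht.ne'
    have ht1 : (1 + t : ℂ) ≠ 0 := by exact_mod_cast (by linarith : (1 + t : ℝ) ≠ 0)
    have e1 : HasDerivAt (fun z : ℂ => Complex.exp (-(y * z))) _ (t : ℂ) :=
      ((hasDerivAt_id (t : ℂ)).const_mul (y : ℂ)).neg.cexp
    have e2 : HasDerivAt (fun z : ℂ => z ^ c) _ (t : ℂ) :=
      (hasDerivAt_id (t : ℂ)).cpow_const (Or.inl (by simpa using ht))
    have e3 : HasDerivAt (fun z : ℂ => (1 + z) ^ (1 - d)) _ (t : ℂ) :=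
      ((hasDerivAt_id (t : ℂ)).const_add 1).cpow_const (Or.inl (by simp; linarith))
    refine (e1.mul (e2.mul e3)).comp_ofReal.congr_deriv ?_
    simp only [id, Pi.mul_apply, Pi.neg_apply, hG]
    rw [show c + 1 + 1 - 1 = c - 1 + 1 + 1 by ring, show c + 1 - 1 = c - 1 + 1 by ring,
      show (1 : ℂ) - d = -d + 1 by ring, show -d + 1 - 1 = -d by ring,
      show (t : ℂ) ^ c = (t : ℂ) ^ (c - 1 + 1) by ring_nf,
      cpow_add _ _ ht', cpow_add _ _ ht1, cpow_add _ _ ht', cpow_add _ _ ht', cpow_one, cpow_one]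
    generalize (t : ℂ) ^ (c - 1) = X
    generalize (1 + t : ℂ) ^ (-d) = Y
    ring

/-- The substitution `s = y t` in Tricomi's integral. -/
theorem tricomi_eq_integral (c d : ℂ) {y : ℝ} (hy : 0 < y) :
    tricomi c d y = (y : ℂ) ^ (d - c) *
      ∫ s : ℝ in Ioi 0, Complex.exp (-s) * ((s : ℂ) ^ (c - 1) * (y + s : ℂ) ^ (-d)) := by
  have hy' : (y : ℂ) ≠ 0 := by exact_mod_cast hy.ne'
  have h := integral_comp_mul_left_Ioi
    (fun s : ℝ => Complex.exp (-s) * ((s : ℂ) ^ (c - 1) * (y + s : ℂ) ^ (-d))) 0 hy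
  rw [mul_zero] at h
  have h2 : ∫ s : ℝ in Ioi 0, Complex.exp (-s) * ((s : ℂ) ^ (c - 1) * (y + s : ℂ) ^ (-d)) =
      (y : ℂ) * ∫ t : ℝ in Ioi 0, Complex.exp (-(y * t : ℝ)) *
        (((y * t : ℝ) : ℂ) ^ (c - 1) * (y + (y * t : ℝ) : ℂ) ^ (-d)) := by
    rw [h, Complex.real_smul, ofReal_inv, mul_inv_cancel_left₀ hy']
  rw [h2, tricomi, ← integral_const_mul, ← integral_const_mul]
  refine setIntegral_congr_fun measurableSet_Ioi fun t ht => ?_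
  have ht : 0 < t := ht
  rw [show ((y : ℂ) + (y * t : ℝ)) = (y : ℂ) * ((1 + t : ℝ) : ℂ) by push_cast; ring, ofReal_mul,
    mul_cpow_ofReal_nonneg hy.le ht.le, mul_cpow_ofReal_nonneg hy.le (by linarith),
    cpow_sub _ _ hy', cpow_sub _ _ hy', cpow_neg (y : ℂ) d, cpow_one]
  have h3 : (y : ℂ) ^ c ≠ 0 := by simp [cpow_eq_zero_iff, hy']
  have h4 : (y : ℂ) ^ d ≠ 0 := by simp [cpow_eq_zero_iff, hy']
  push_cast
  field_simp

/-- Fubini for `∫∫ e^{-yt - s - st} t^{c-1} s^{d-1}`: the inner integral over `s` or over `t` is a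
Gamma integral. This symmetry will identify the solutions attached to `ν` and `-ν`. -/
theorem Gamma_mul_tricomi {c d : ℂ} (hc : 0 < c.re) (hd : 0 < d.re) {y : ℝ} (hy : 0 < y) :
    Gamma d * tricomi c d y = Gamma c * ((y : ℂ) ^ (d - c) * tricomi d c y) := by
  have hy' : (y : ℂ) ≠ 0 := by exact_mod_cast hy.ne'
  set F : ℝ → ℝ → ℂ := fun t s => Complex.exp (-(y * t)) * (t : ℂ) ^ (c - 1) *
    (Complex.exp (-s) * (s : ℂ) ^ (d - 1)) * Complex.exp (-(s * t)) with hF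
  have hint : Integrable (Function.uncurry F)
      ((volume.restrict (Ioi (0 : ℝ))).prod (volume.restrict (Ioi (0 : ℝ)))) := by
    have i1 := integrableOn_tricomi (c := c) (d := 0) hc (by simp) hy
    have i2 := integrableOn_tricomi (c := d) (d := 0) hd (by simp) one_pos
    simp only [neg_zero, cpow_zero, mul_one, ofReal_one, one_mul] at i1 i2
    refine Integrable.mono (Integrable.mul_prod i1 i2) ?_ ?_
    · refine (Integrable.mul_prod i1 i2).aestronglyMeasurable.mul ?_
      exact (Continuous.aestronglyMeasurable (by fun_prop))
    · rw [Measure.prod_restrict]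
      filter_upwards [ae_restrict_mem (measurableSet_Ioi.prod measurableSet_Ioi)] with z hz
      have h1 : 0 < z.1 := hz.1
      have h2 : 0 < z.2 := hz.2
      simp only [Function.uncurry, hF]
      rw [norm_mul _ (Complex.exp (-(z.2 * z.1)))]
      refine mul_le_of_le_one_right (norm_nonneg _) ?_
      rw [Complex.norm_exp, Real.exp_le_one_iff]
      simp
      positivity
  have hswap := integral_integral_swap hint
  have hL : ∀ t ∈ Ioi (0 : ℝ), ∫ s : ℝ in Ioi 0, F t s = Gamma d *
      (Complex.exp (-(y * t)) * ((t : ℂ) ^ (c - 1) * (1 + t : ℂ) ^ (-d))) := by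
    intro t ht
    have ht : 0 < t := ht
    have ht1 : (1 + t : ℂ) = ((1 + t : ℝ) : ℂ) := by push_cast; rfl
    have := Complex.integral_cpow_mul_exp_neg_mul_Ioi (a := d) (r := 1 + t) hd (by linarith)
    rw [one_div, inv_cpow _ _ (by
      rw [arg_ofReal_of_nonneg (by linarith)]; exact Real.pi_pos.ne), ← cpow_neg, ← ht1] at this
    calc _ = ∫ s : ℝ in Ioi 0, (Complex.exp (-(y * t)) * (t : ℂ) ^ (c - 1)) *
          ((s : ℂ) ^ (d - 1) * Complex.exp (-((1 + t) * s))) := by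
          refine integral_congr_ae (.of_forall fun s => ?_)
          simp only [hF]
          rw [show -((1 + (t : ℂ)) * s) = -s + -(s * t) by ring, Complex.exp_add]
          ring
      _ = _ := by rw [integral_const_mul, this]; ring
  have hR : ∀ s ∈ Ioi (0 : ℝ), ∫ t : ℝ in Ioi 0, F t s = Gamma c *
      (Complex.exp (-s) * ((s : ℂ) ^ (d - 1) * (y + s : ℂ) ^ (-c))) := by
    intro s hs
    have hs : 0 < s := hs
    have hs1 : (y + s : ℂ) = ((y + s : ℝ) : ℂ) := by push_cast; rfl
    have := Complex.integral_cpow_mul_exp_neg_mul_Ioi (a := c) (r := y + s) hc (by linarith)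
    rw [one_div, inv_cpow _ _ (by
      rw [arg_ofReal_of_nonneg (by linarith)]; exact Real.pi_pos.ne), ← cpow_neg, ← hs1] at this
    calc _ = ∫ t : ℝ in Ioi 0, (Complex.exp (-s) * (s : ℂ) ^ (d - 1)) *
          ((t : ℂ) ^ (c - 1) * Complex.exp (-((y + s) * t))) := by
          refine integral_congr_ae (.of_forall fun t => ?_)
          simp only [hF]
          rw [show -(((y : ℂ) + s) * t) = -(y * t) + -(s * t) by ring, Complex.exp_add]
          ring
      _ = _ := by rw [integral_const_mul, this]; ring
  rw [setIntegral_congr_fun measurableSet_Ioi hL, setIntegral_congr_fun measurableSet_Ioi hR,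
    integral_const_mul, integral_const_mul] at hswap
  rw [tricomi, hswap, tricomi_eq_integral d c hy, ← mul_assoc ((y : ℂ) ^ (d - c)), ← cpow_add _ _ hy']
  simp

/-- After `s = yt` the only dependence on `y` is in `(y + s)^{-d}`, dominated by `s^{-Re d}` because
`Re d ≥ 0`. -/
theorem tendsto_cpow_mul_tricomi {c d : ℂ} (hd : 0 ≤ d.re) (hb : d.re < c.re) :
    Tendsto (fun y : ℝ => (y : ℂ) ^ (c - d) * tricomi c d y) (𝓝[>] 0) (𝓝 (Gamma (c - d))) := by
  have hlim : Tendsto (fun y : ℝ => ∫ s : ℝ in Ioi 0,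
      Complex.exp (-s) * ((s : ℂ) ^ (c - 1) * (y + s : ℂ) ^ (-d))) (𝓝[>] 0)
      (𝓝 (∫ s : ℝ in Ioi 0, Complex.exp (-s) * ((s : ℂ) ^ (c - 1) * (s : ℂ) ^ (-d)))) := by
    refine tendsto_integral_filter_of_dominated_convergence
      (fun s => s ^ ((c - d).re - 1) * Real.exp (-(1 * s))) ?_ ?_
      (integrableOn_rpow_mul_exp (by simp; linarith) one_pos) ?_
    · filter_upwards [self_mem_nhdsWithin] with y hy
      have hy : 0 < y := hy
      refine ContinuousOn.aestronglyMeasurable (fun s hs => ?_) measurableSet_Ioi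
      have hs : 0 < s := hs
      have h1 : ContinuousAt (fun t : ℝ => (t : ℂ) ^ (c - 1)) s :=
        continuousAt_ofReal_cpow_const _ _ (Or.inr hs.ne')
      have h2 : ContinuousAt (fun t : ℝ => (y + t : ℂ) ^ (-d)) s := by
        refine ContinuousAt.cpow (by fun_prop) continuousAt_const ?_
        left; simp; linarith
      have h3 : ContinuousAt (fun t : ℝ => Complex.exp (-t)) s := by fun_prop
      exact (h3.mul (h1.mul h2)).continuousWithinAt
    · filter_upwards [self_mem_nhdsWithin] with y hy
      have hy : 0 < y := hy
      filter_upwards [ae_restrict_mem measurableSet_Ioi] with s hs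
      have hs : 0 < s := hs
      rw [norm_mul, norm_mul, norm_cpow_eq_rpow_re_of_pos hs, Complex.norm_exp,
        show (y + s : ℂ) = ((y + s : ℝ) : ℂ) by push_cast; rfl,
        norm_cpow_eq_rpow_re_of_pos (by linarith), mul_comm, one_mul,
        show (c - d).re - 1 = (c - 1).re + (-d).re by simp; ring, Real.rpow_add hs]
      have : (y + s) ^ (-d).re ≤ s ^ (-d).re :=
        Real.rpow_le_rpow_of_nonpos hs (by linarith) (by simpa)
      simp only [neg_re, ofReal_re] at *
      gcongr
    · filter_upwards [ae_restrict_mem measurableSet_Ioi] with s hs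
      have hs : 0 < s := hs
      have h1 : ContinuousAt (fun y : ℝ => (y + s : ℂ) ^ (-d)) 0 := by
        refine ContinuousAt.cpow (by fun_prop) continuousAt_const ?_
        left; simpa using hs
      have h2 := (h1.tendsto.mono_left (nhdsWithin_le_nhds (s := Ioi 0)))
      simp only [ofReal_zero, zero_add] at h2
      exact (h2.const_mul _).const_mul _
  have hG : ∫ s : ℝ in Ioi 0, Complex.exp (-s) * ((s : ℂ) ^ (c - 1) * (s : ℂ) ^ (-d)) =
      Gamma (c - d) := by
    rw [Gamma_eq_integral (by simp; linarith), GammaIntegral]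
    refine setIntegral_congr_fun measurableSet_Ioi fun s hs => ?_
    have hs' : (s : ℂ) ≠ 0 := by exact_mod_cast (ne_of_gt hs)
    rw [← cpow_add _ _ hs', ← ofReal_neg, ← ofReal_exp]
    ring_nf
  rw [hG] at hlim
  refine hlim.congr' ?_
  filter_upwards [self_mem_nhdsWithin] with y hy
  have hy' : (y : ℂ) ≠ 0 := by exact_mod_cast (ne_of_gt hy)
  rw [tricomi_eq_integral c d hy, ← mul_assoc, ← cpow_add _ _ hy']
  simp

end Whittaker

/-! ### Decay at infinity for nonpositive `p` -/

namespace Whittaker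

open Complex Filter Topology Nat MeasureTheory Set
open scoped Real

/-- For `p ≤ 0` the `p`-dependence of the integrand is `(t / (1 + t))^{-p} ≤ 1`; what remains is at
most a Gamma integrand. -/
theorem norm_tricomi_le {p : ℝ} {ν : ℂ} (hp : p ≤ 0) (h1 : -(1 / 2) < ν.re) (h2 : ν.re < 1 / 2)
    {y : ℝ} (hy : 0 < y) : ‖tricomi (1 / 2 + ν - p) (1 / 2 - ν - p) y‖ ≤
      Real.Gamma (1 / 2 + ν.re) * y ^ (-(1 / 2 + ν.re)) := by
  have hI := Real.integral_rpow_mul_exp_neg_mul_Ioi (a := 1 / 2 + ν.re) (r := y) (by linarith) hy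
  rw [one_div y, Real.inv_rpow hy.le, ← Real.rpow_neg hy.le] at hI
  rw [mul_comm, ← hI]
  refine norm_integral_le_of_norm_le (integrableOn_rpow_mul_exp (by linarith) hy) ?_
  filter_upwards [ae_restrict_mem measurableSet_Ioi] with t ht
  have ht : 0 < t := ht
  rw [norm_tricomi_integrand _ _ _ ht]
  have e1 : (1 / 2 + ν - p - 1 : ℂ).re = (1 / 2 + ν.re - 1) + -p := by simp; ring
  have e2 : (-(1 / 2 - ν - p) : ℂ).re = (ν.re - 1 / 2) - -p := by simp; ring
  rw [e1, e2, Real.rpow_add ht, Real.rpow_sub (by linarith : (0 : ℝ) < 1 + t)]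
  have h3 : t ^ (-p) ≤ (1 + t) ^ (-p) := Real.rpow_le_rpow ht.le (by linarith) (by linarith)
  have h4 : (1 + t) ^ (ν.re - 1 / 2) ≤ 1 :=
    Real.rpow_le_one_of_one_le_of_nonpos (by linarith) (by linarith)
  have h5 : 0 < (1 + t) ^ (-p) := Real.rpow_pos_of_pos (by linarith) _
  have h6 : t ^ (-p) / (1 + t) ^ (-p) ≤ 1 := (div_le_one h5).2 h3
  calc _ = t ^ (1 / 2 + ν.re - 1) * Real.exp (-(y * t)) *
        ((t ^ (-p) / (1 + t) ^ (-p)) * (1 + t) ^ (ν.re - 1 / 2)) := by ring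
    _ ≤ t ^ (1 / 2 + ν.re - 1) * Real.exp (-(y * t)) * (1 * 1) := by gcongr
    _ = _ := by ring

/-- The solution of Whittaker's equation given by Tricomi's integral. -/
noncomputable def whittakerV (p ν : ℂ) (y : ℝ) : ℂ :=
  (y : ℂ) ^ (ν + 1 / 2) * Complex.exp (-(y : ℂ) / 2) * tricomi (1 / 2 + ν - p) (1 / 2 - ν - p) y

/-- The derivative of `whittakerV p ν`. -/
noncomputable def whittakerV' (p ν : ℂ) (y : ℝ) : ℂ :=
  (y : ℂ) ^ (ν + 1 / 2) * Complex.exp (-(y : ℂ) / 2) *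
    (((ν + 1 / 2) / y - 1 / 2) * tricomi (1 / 2 + ν - p) (1 / 2 - ν - p) y +
      -tricomi (1 / 2 + ν - p + 1) (1 / 2 - ν - p) y)

section

variable {p : ℝ} {ν : ℂ}

theorem isWhittaker_whittakerV (hp : p ≤ 0) (h1 : -(1 / 2) < ν.re) (h2 : ν.re < 1 / 2) :
    IsWhittaker p ν (whittakerV p ν) (whittakerV' p ν) := by
  have hc : 0 < (1 / 2 + ν - p : ℂ).re := by simp; linarith
  have hd : 0 ≤ (1 / 2 - ν - p : ℂ).re := by simp; linarith
  refine IsWhittaker.of_kummer (u := tricomi (1 / 2 + ν - p) (1 / 2 - ν - p))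
    (u₁ := fun y => -tricomi (1 / 2 + ν - p + 1) (1 / 2 - ν - p) y)
    (u₂ := tricomi (1 / 2 + ν - p + 1 + 1) (1 / 2 - ν - p))
    (fun y hy => hasDerivAt_tricomi hc hd hy)
    (fun y hy => (hasDerivAt_tricomi (by simp at hc ⊢; linarith) hd hy).neg.congr_deriv
      (neg_neg _)) fun y hy => ?_
  linear_combination -tricomi_recurrence hc hd hy

theorem inv_Gamma_mul_whittakerV_neg (hp : p ≤ 0) (h1 : -(1 / 2) < ν.re) (h2 : ν.re < 1 / 2)
    {y : ℝ} (hy : 0 < y) : (Gamma (1 / 2 - ν - p))⁻¹ * whittakerV p (-ν) y =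
      (Gamma (1 / 2 + ν - p))⁻¹ * whittakerV p ν y := by
  have hc : 0 < (1 / 2 + ν - p : ℂ).re := by simp; linarith
  have hd : 0 < (1 / 2 - ν - p : ℂ).re := by simp; linarith
  have h := Gamma_mul_tricomi hc hd hy
  have hy' : (y : ℂ) ≠ 0 := by exact_mod_cast hy.ne'
  have g1 := Gamma_ne_zero_of_re_pos hc
  have g2 := Gamma_ne_zero_of_re_pos hd
  unfold whittakerV
  rw [show (1 : ℂ) / 2 + -ν - p = 1 / 2 - ν - p by ring,
    show (1 : ℂ) / 2 - -ν - p = 1 / 2 + ν - p by ring,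
    show -ν + 1 / 2 = (1 / 2 - ν - p - (1 / 2 + ν - p)) + (ν + 1 / 2) by ring, cpow_add _ _ hy']
  rw [inv_mul_eq_div, inv_mul_eq_div, div_eq_div_iff g2 g1]
  linear_combination -((y : ℂ) ^ (ν + 1 / 2) * Complex.exp (-(y : ℂ) / 2)) * h

/-- Near `0` the surviving term is `y^{1+2ν}` times the derivative integral, tending to `Γ(1 + 2ν)`,
against `N`'s normalization `1 / Γ(1 + 2ν)`. The undifferentiated integral drops out because `Re ν >
-1/2`. -/
theorem wronskian_whittakerV (hp : p ≤ 0) (h1 : -(1 / 2) < ν.re) (h2 : ν.re < 1 / 2)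
    {y : ℝ} (hy : 0 < y) :
    whittakerV p ν y * whittakerN' p ν y - whittakerV' p ν y * whittakerN p ν y = 1 := by
  have hd : 0 ≤ (1 / 2 - ν - p : ℂ).re := by simp; linarith
  refine (isWhittaker_whittakerV hp h1 h2).wronskian_eq_of_tendsto (isWhittaker_whittakerN p ν)
    ?_ hy
  set U := tricomi (1 / 2 + ν - p) (1 / 2 - ν - p)
  set U' := tricomi (1 / 2 + ν - p + 1) (1 / 2 - ν - p)
  set A := fun y : ℝ => kummerR (1 / 2 + ν - p) (1 + 2 * ν) (y : ℂ)
  set A' := fun y : ℝ => (1 / 2 + ν - p) * kummerR (1 / 2 + ν - p + 1) (1 + 2 * ν + 1) (y : ℂ)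
  have hA : Tendsto A (𝓝[>] 0) (𝓝 _) := tendsto_kummerR_zero _ _
  have hA' : Tendsto A' (𝓝[>] 0) (𝓝 _) := (tendsto_kummerR_zero _ _).const_mul _
  have hE : Tendsto (fun y : ℝ => Complex.exp (-(y : ℂ))) (𝓝[>] 0) (𝓝 (Complex.exp (-0))) :=
    (Complex.continuous_exp.tendsto _).comp tendsto_ofReal_zero.neg
  have hU' := tendsto_cpow_mul_tricomi (c := 1 / 2 + ν - p + 1) hd (by simp; linarith)
  rw [show (1 : ℂ) / 2 + ν - p + 1 - (1 / 2 - ν - p) = 1 + 2 * ν by ring] at hU'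
  have hU : Tendsto (fun y : ℝ => (y : ℂ) ^ (1 + 2 * ν) * U y) (𝓝[>] 0) (𝓝 0) := by
    rw [tendsto_zero_iff_norm_tendsto_zero]
    have hlim : Tendsto (fun y : ℝ => Real.Gamma (1 / 2 + ν.re) * y ^ (1 / 2 + ν.re)) (𝓝[>] 0)
        (𝓝 (Real.Gamma (1 / 2 + ν.re) * 0 ^ (1 / 2 + ν.re))) :=
      (((Real.continuousAt_rpow_const 0 (1 / 2 + ν.re) (Or.inr (by linarith))).tendsto).mono_left
        nhdsWithin_le_nhds).const_mul _
    rw [Real.zero_rpow (by linarith), mul_zero] at hlim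
    refine squeeze_zero' (.of_forall fun t => norm_nonneg _) ?_ hlim
    filter_upwards [self_mem_nhdsWithin] with t ht
    have ht : 0 < t := ht
    rw [norm_mul, norm_cpow_eq_rpow_re_of_pos ht]
    have := norm_tricomi_le hp h1 h2 ht
    calc _ ≤ t ^ (1 + 2 * ν).re * (Real.Gamma (1 / 2 + ν.re) * t ^ (-(1 / 2 + ν.re))) := by gcongr
      _ = Real.Gamma (1 / 2 + ν.re) * (t ^ (1 + 2 * ν).re * t ^ (-(1 / 2 + ν.re))) := by ring
      _ = _ := by rw [← Real.rpow_add ht]; congr 2; simp; ring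
  have key := hE.mul ((hU.mul hA').add (hU'.mul hA))
  have hG : Gamma (1 + 2 * ν) ≠ 0 := Gamma_ne_zero_of_re_pos (by simp; linarith)
  rw [zero_mul, zero_add, mul_inv_cancel₀ hG, neg_zero, Complex.exp_zero, mul_one] at key
  refine key.congr' ?_
  filter_upwards [self_mem_nhdsWithin] with z hz
  have hz' : (z : ℂ) ≠ 0 := by exact_mod_cast (ne_of_gt hz)
  have e1 : (z : ℂ) ^ (ν + 1 / 2) * (z : ℂ) ^ (ν + 1 / 2) = (z : ℂ) ^ (1 + 2 * ν) := by
    rw [← cpow_add _ _ hz']; ring_nf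
  have e2 : Complex.exp (-(z : ℂ) / 2) * Complex.exp (-(z : ℂ) / 2) = Complex.exp (-(z : ℂ)) := by
    rw [← Complex.exp_add]; ring_nf
  rw [← e1, ← e2]
  simp only [whittakerN, whittakerN', whittakerV, whittakerV', U, A, A']
  ring

/-- Any three pairs `(f, f')` satisfy `W(N₋, N₊) V = W(V, N₊) N₋ - W(V, N₋) N₊`. The first Wronskian
is the sine; the other two are known after the `ν ↔ -ν` symmetry of `V`. Nothing is divided by the
sine, so `ν = 0` is included. -/
theorem whittakerH_eq_whittakerV (hp : p ≤ 0) (h1 : -(1 / 2) < ν.re) (h2 : ν.re < 1 / 2)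
    {y : ℝ} (hy : 0 < y) : whittakerH p ν y =
      Complex.sin (2 * π * ν) / π * ((Gamma (1 / 2 + ν - p))⁻¹ * whittakerV p ν y) := by
  have w1 := wronskian_whittakerV hp h1 h2 hy
  have w2 := wronskian_whittakerV (ν := -ν) hp (by simp; linarith) (by simp; linarith) hy
  have w3 := wronskian_whittakerN p ν hy
  have hV := inv_Gamma_mul_whittakerV_neg hp h1 h2 hy
  have hV' : (Gamma (1 / 2 - ν - p))⁻¹ * whittakerV' p (-ν) y =
      (Gamma (1 / 2 + ν - p))⁻¹ * whittakerV' p ν y := by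
    have d1 := ((isWhittaker_whittakerV (ν := -ν) hp (by simp; linarith)
      (by simp; linarith)).1 y hy).const_mul (Gamma (1 / 2 - ν - p))⁻¹
    have d2 := ((isWhittaker_whittakerV hp h1 h2).1 y hy).const_mul (Gamma (1 / 2 + ν - p))⁻¹
    refine d1.unique (d2.congr_of_eventuallyEq ?_)
    filter_upwards [Ioi_mem_nhds hy] with z hz
    exact inv_Gamma_mul_whittakerV_neg hp h1 h2 hz
  rw [← w3]
  unfold whittakerH
  linear_combination (-(Gamma (1 / 2 + ν - p))⁻¹ * whittakerN p (-ν) y) * w1 +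
    ((Gamma (1 / 2 - ν - p))⁻¹ * whittakerN p ν y) * w2 -
    whittakerN p ν y * whittakerN' p (-ν) y * hV + whittakerN p ν y * whittakerN p (-ν) y * hV'

theorem norm_whittakerH_le_exp (hp : p ≤ 0) (h1 : -(1 / 2) < ν.re) (h2 : ν.re < 1 / 2)
    {y : ℝ} (hy : 0 < y) : ‖whittakerH p ν y‖ ≤ ‖Complex.sin (2 * π * ν)‖ / π *
      (‖(Gamma (1 / 2 + ν - p))⁻¹‖ * (Real.Gamma (1 / 2 + ν.re) * Real.exp (-y / 2))) := by
  rw [whittakerH_eq_whittakerV hp h1 h2 hy, norm_mul, norm_mul, norm_div, norm_real,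
    Real.norm_of_nonneg Real.pi_pos.le]
  gcongr
  unfold whittakerV
  rw [norm_mul, norm_mul, norm_cpow_eq_rpow_re_of_pos hy, Complex.norm_exp]
  have := norm_tricomi_le hp h1 h2 hy
  calc _ ≤ y ^ (ν + 1 / 2).re * Real.exp (-(y : ℂ) / 2).re *
        (Real.Gamma (1 / 2 + ν.re) * y ^ (-(1 / 2 + ν.re))) := by gcongr
    _ = Real.Gamma (1 / 2 + ν.re) * Real.exp (-(y : ℂ) / 2).re *
        (y ^ (ν + 1 / 2).re * y ^ (-(1 / 2 + ν.re))) := by ring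
    _ = _ := by
      rw [← Real.rpow_add hy, show (ν + 1 / 2).re + -(1 / 2 + ν.re) = 0 by simp; ring,
        Real.rpow_zero, mul_one]
      congr 2
      rw [show -(y : ℂ) / 2 = ((-y / 2 : ℝ) : ℂ) by push_cast; ring, ofReal_re]

end

end Whittaker

/-! ### Propagating bounds along Whittaker's equation from `1/T` to `1` -/

namespace Whittaker

open Complex Filter Topology Set
open scoped Real

section ODE

variable {p c T B : ℝ} {f f' : ℝ → ℂ}

/-- On `[1/(2T), 1/T]` the equation bounds `f''` by `O(T⁴)B`, so `f'` is nearly constant there at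
scale `BT³` and is recovered from the difference of two values of `f`. -/
theorem norm_deriv_le_of_ode (hT : 1 ≤ T) (hp : |p| ≤ T) (hc : 0 ≤ c) (hcT : c ≤ T ^ 2)
    (h₁ : ∀ y : ℝ, 0 < y → HasDerivAt f (f' y) y)
    (h₂ : ∀ y : ℝ, 0 < y → HasDerivAt f' (((1 / 4 - p / y - c / y ^ 2 : ℝ) : ℂ) * f y) y)
    (hB : ∀ y : ℝ, 1 / T / 2 ≤ y → y ≤ 1 / T → ‖f y‖ ≤ B) : ‖f' (1 / T)‖ ≤ 8 * B * T ^ 3 := by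
  have hT0 : 0 < T := by linarith
  set y₀ := 1 / T with hy₀
  have hy0 : 0 < y₀ := by positivity
  have hB0 : 0 ≤ B := (norm_nonneg _).trans (hB y₀ (by linarith) le_rfl)
  have hTy : T * y₀ = 1 := by rw [hy₀]; field_simp
  -- Bound for the potential on the window, where `1/y ≤ 2T`, `|p| ≤ T` and `c ≤ T²`.
  set q : ℝ := 1 / 4 + 2 * T ^ 2 + 4 * T ^ 4 with hq
  have hpos : ∀ y ∈ Icc (y₀ / 2) y₀, 0 < y := fun y hy => by linarith [hy.1]
  have hbound : ∀ y ∈ Icc (y₀ / 2) y₀,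
      ‖((1 / 4 - p / y - c / y ^ 2 : ℝ) : ℂ) * f y‖ ≤ q * B := by
    intro y hy
    have hy' := hpos y hy
    have hinv : 1 / y ≤ 2 * T := by
      rw [div_le_iff₀ hy']; nlinarith [hy.1]
    rw [norm_mul, norm_real, Real.norm_eq_abs]
    have e1 : |p / y| ≤ 2 * T ^ 2 := by
      rw [abs_div, abs_of_pos hy', div_eq_mul_one_div]
      calc |p| * (1 / y) ≤ T * (2 * T) := by gcongr
        _ = _ := by ring
    have e2 : |c / y ^ 2| ≤ 4 * T ^ 4 := by
      rw [abs_div, abs_of_nonneg hc, abs_of_pos (by positivity : 0 < y ^ 2)]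
      calc c / y ^ 2 = c * (1 / y) ^ 2 := by field_simp
        _ ≤ T ^ 2 * (2 * T) ^ 2 := by gcongr
        _ = _ := by ring
    have e3 : |1 / 4 - p / y - c / y ^ 2| ≤ q := by
      calc _ ≤ |1 / 4 - p / y| + |c / y ^ 2| := abs_sub _ _
        _ ≤ |(1 / 4 : ℝ)| + |p / y| + |c / y ^ 2| := by gcongr; exact abs_sub _ _
        _ ≤ _ := by rw [abs_of_pos (by norm_num : (0 : ℝ) < 1 / 4), hq]; gcongr
    gcongr
    exact hB y hy.1 hy.2
  have hmem : y₀ ∈ Icc (y₀ / 2) y₀ := ⟨by linarith, le_rfl⟩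
  have hmem' : y₀ / 2 ∈ Icc (y₀ / 2) y₀ := ⟨le_rfl, by linarith⟩
  have s1 : ∀ y ∈ Icc (y₀ / 2) y₀, ‖f' y - f' y₀‖ ≤ q * B * (y₀ / 2) := by
    intro y hy
    have := (convex_Icc (y₀ / 2) y₀).norm_image_sub_le_of_norm_hasDerivWithin_le
      (fun x hx => (h₂ x (hpos x hx)).hasDerivWithinAt) hbound hmem hy
    refine this.trans ?_
    gcongr
    rw [Real.norm_eq_abs, abs_le]
    constructor <;> linarith [hy.1, hy.2]
  -- Mean value inequality for `f` minus its linear part at `y₀`: a first-order Taylor estimate with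
  -- the error controlled by `s1`.
  have s2 := (convex_Icc (y₀ / 2) y₀).norm_image_sub_le_of_norm_hasDerivWithin_le
    (f := fun y : ℝ => f y - y * f' y₀) (f' := fun y => f' y - 1 * f' y₀)
    (fun x hx => ((h₁ x (hpos x hx)).sub
      ((hasDerivAt_id x).ofReal_comp.mul_const _)).hasDerivWithinAt)
    (fun x hx => by simpa using s1 x hx) hmem' hmem
  rw [Real.norm_eq_abs, show y₀ - y₀ / 2 = y₀ / 2 by ring, abs_of_pos (by positivity)] at s2
  have e : ((y₀ / 2 : ℝ) : ℂ) * f' y₀ = (f y₀ - f (y₀ / 2)) -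
      ((f y₀ - y₀ * f' y₀) - (f (y₀ / 2) - (y₀ / 2 : ℝ) * f' y₀)) := by push_cast; ring
  have h3 : y₀ / 2 * ‖f' y₀‖ ≤ B + B + q * B * (y₀ / 2) * (y₀ / 2) := by
    calc y₀ / 2 * ‖f' y₀‖ = ‖((y₀ / 2 : ℝ) : ℂ) * f' y₀‖ := by
          rw [norm_mul, norm_real, Real.norm_of_nonneg (by positivity)]
      _ ≤ _ := by
        rw [e]
        refine (norm_sub_le _ _).trans (add_le_add ((norm_sub_le _ _).trans ?_) s2)
        exact add_le_add (hB _ (by linarith) le_rfl) (hB _ le_rfl (by linarith))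
  have h4 : ‖f' y₀‖ = 2 * T * (y₀ / 2 * ‖f' y₀‖) := by
    linear_combination (-‖f' y₀‖) * hTy
  rw [h4]
  have hT3 : T ≤ T ^ 3 := by nlinarith [sq_nonneg T]
  have hy1 : y₀ ≤ 1 := by rw [hy₀, div_le_one hT0]; exact hT
  have hq2 : q * y₀ * y₀ = y₀ * y₀ / 4 + 2 + 4 * T ^ 2 := by
    rw [hq]
    linear_combination (2 * (T * y₀ + 1) + 4 * T ^ 2 * (T * y₀ + 1)) * hTy
  calc _ ≤ 2 * T * (B + B + q * B * (y₀ / 2) * (y₀ / 2)) := by gcongr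
    _ = B * T * (4 + q * y₀ * y₀ / 2) := by ring
    _ ≤ B * T * (8 * T ^ 2) := by gcongr; rw [hq2]; nlinarith
    _ = _ := by ring

/-- The weight is `1` minus the potential, so the cross terms of the energy's derivative collapse to
`2⟨f, f'⟩`. The remaining term is nonpositive when `py + c ≥ 0` and `c ≥ 0`, and the weight is then
at least `3/4`. Hence `E' ≤ (4/3) E`. -/
theorem norm_le_of_energy (hT : 1 ≤ T) (hp : |p| ≤ T) (hc : 0 ≤ c) (hcT : c ≤ T ^ 2)
    (h₁ : ∀ y : ℝ, 0 < y → HasDerivAt f (f' y) y)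
    (h₂ : ∀ y : ℝ, 0 < y → HasDerivAt f' (((1 / 4 - p / y - c / y ^ 2 : ℝ) : ℂ) * f y) y)
    (hB : ∀ y : ℝ, 1 / T / 2 ≤ y → y ≤ 1 / T → ‖f y‖ ≤ B) {y₁ : ℝ} (hy₁ : 1 / T ≤ y₁) (hy₁' : y₁ ≤ 1)
    (hw : ∀ y : ℝ, 1 / T ≤ y → y ≤ y₁ → 0 ≤ p * y + c) : ‖f y₁‖ ≤ 20 * B * T ^ 3 := by
  have hT0 : 0 < T := by linarith
  have hf' := norm_deriv_le_of_ode hT hp hc hcT h₁ h₂ hB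
  set y₀ := 1 / T with hy₀
  have hy0 : 0 < y₀ := by positivity
  have hB0 : 0 ≤ B := (norm_nonneg _).trans (hB y₀ (by linarith) le_rfl)
  set w : ℝ → ℝ := fun y => 3 / 4 + p / y + c / y ^ 2 with hwdef
  set E : ℝ → ℝ := fun y => ‖f' y‖ ^ 2 + w y * ‖f y‖ ^ 2 with hE
  have hwpos : ∀ y ∈ Icc y₀ y₁, 3 / 4 ≤ w y := by
    intro y hy
    have hy' : 0 < y := by linarith [hy.1]
    have : p / y + c / y ^ 2 = (p * y + c) / y ^ 2 := by field_simp
    have h0 : 0 ≤ (p * y + c) / y ^ 2 := div_nonneg (hw y hy.1 hy.2) (by positivity)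
    simp only [hwdef]; linarith
  set E' : ℝ → ℝ := fun y => 2 * (inner ℝ (f y) (f' y) : ℝ) - (p * y + 2 * c) / y ^ 3 * ‖f y‖ ^ 2 with hE'
  have hEd : ∀ y ∈ Icc y₀ y₁, HasDerivAt E (E' y) y := by
    intro y hy
    have hy' : 0 < y := by linarith [hy.1]
    have d1 := (h₂ y hy').norm_sq
    have d2 := (h₁ y hy').norm_sq
    have d3 : HasDerivAt w (-(p * y + 2 * c) / y ^ 3) y := by
      have a1 := ((hasDerivAt_id y).fun_inv hy'.ne').const_mul p
      have a2 := ((hasDerivAt_pow 2 y).fun_inv (by positivity)).const_mul c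
      have a3 := (a1.const_add (3 / 4)).add a2
      refine (a3.congr_of_eventuallyEq (.of_forall fun z => ?_)).congr_deriv ?_
      · simp only [hwdef, Pi.add_apply, id, div_eq_mul_inv]
      · simp only [id, Nat.cast_ofNat]; field_simp; ring
    refine (d1.add (d3.mul d2)).congr_deriv ?_
    have e1 : (inner ℝ (f' y) (((1 / 4 - p / y - c / y ^ 2 : ℝ) : ℂ) * f y) : ℝ) =
        (1 / 4 - p / y - c / y ^ 2) * (inner ℝ (f y) (f' y) : ℝ) := by
      rw [← Complex.real_smul, inner_smul_right, real_inner_comm]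
    rw [e1]
    simp only [hE', hwdef]
    ring
  set G : ℝ → ℝ := fun y => Real.exp (-(4 / 3 * y)) * E y with hG
  have hGd : ∀ y ∈ Icc y₀ y₁,
      HasDerivAt G (Real.exp (-(4 / 3 * y)) * (E' y - 4 / 3 * E y)) y := by
    intro y hy
    have a1 := (((hasDerivAt_id y).const_mul (4 / 3 : ℝ)).neg.exp).mul (hEd y hy)
    refine a1.congr_deriv ?_
    simp only [id, Pi.neg_apply]
    ring
  have hanti : AntitoneOn G (Icc y₀ y₁) := by
    refine antitoneOn_of_hasDerivWithinAt_nonpos (convex_Icc _ _)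
      (fun y hy => (hGd y hy).continuousAt.continuousWithinAt)
      (fun y hy => (hGd y (interior_subset hy)).hasDerivWithinAt) fun y hy => ?_
    have hy := interior_subset hy
    have hy' : 0 < y := by linarith [hy.1]
    refine mul_nonpos_of_nonneg_of_nonpos (Real.exp_pos _).le ?_
    have hin : 2 * (inner ℝ (f y) (f' y) : ℝ) ≤ ‖f y‖ ^ 2 + ‖f' y‖ ^ 2 := by
      have := real_inner_le_norm (f y) (f' y)
      nlinarith [sq_nonneg (‖f y‖ - ‖f' y‖)]
    have h0 : 0 ≤ (p * y + 2 * c) / y ^ 3 * ‖f y‖ ^ 2 := by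
      have := hw y hy.1 hy.2
      have : 0 ≤ p * y + 2 * c := by linarith
      positivity
    have h3 := mul_le_mul_of_nonneg_right (hwpos y hy) (sq_nonneg ‖f y‖)
    simp only [hE', hE]
    nlinarith [sq_nonneg ‖f' y‖]
  have hG' := hanti (left_mem_Icc.2 hy₁) (right_mem_Icc.2 hy₁) hy₁
  -- Since `y₁ ≤ 1`, the growth is at most `e^{4/3}`, bounded here through `e^{1/3} ≤ 1.4`.
  have hEle : E y₁ ≤ 4 * E y₀ := by
    have hE0 : 0 ≤ E y₀ := by
      have := hwpos y₀ (left_mem_Icc.2 hy₁)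
      simp only [hE]; nlinarith [sq_nonneg ‖f' y₀‖, sq_nonneg ‖f y₀‖]
    have h43 : Real.exp (4 / 3) ≤ 4 := by
      have h1 := Real.exp_one_lt_d9
      have h2 : Real.exp (1 / 3) ^ 3 = Real.exp 1 := by
        rw [← Real.exp_nat_mul]; norm_num
      have h3 : Real.exp (4 / 3) = Real.exp (1 / 3) ^ 4 := by
        rw [← Real.exp_nat_mul]; norm_num
      have h4 : Real.exp (1 / 3) ≤ 1.4 := by
        by_contra! h
        have : (1.4 : ℝ) ^ 3 < Real.exp (1 / 3) ^ 3 := by gcongr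
        norm_num at this h1; linarith
      rw [h3]
      calc _ ≤ (1.4 : ℝ) ^ 4 := by gcongr
        _ ≤ 4 := by norm_num
    simp only [hG] at hG'
    have h5 : E y₁ = Real.exp (4 / 3 * y₁) * (Real.exp (-(4 / 3 * y₁)) * E y₁) := by
      rw [← mul_assoc, ← Real.exp_add]; simp
    rw [h5]
    calc _ ≤ Real.exp (4 / 3 * y₁) * (Real.exp (-(4 / 3 * y₀)) * E y₀) := by gcongr
      _ ≤ Real.exp (4 / 3) * (1 * E y₀) := by
        gcongr
        · linarith
        · rw [Real.exp_le_one_iff]; linarith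
      _ ≤ _ := by rw [one_mul]; gcongr
  -- `67 = 8² + 3`: the derivative bound squared plus the weight, at most `3T⁴`. The final constant
  -- `20` comes from `4 · 67 / (3/4) ≤ 20²`.
  have hE0 : E y₀ ≤ 67 * (B * T ^ 3) ^ 2 := by
    have hw0 : w y₀ ≤ 3 * T ^ 4 := by
      have : w y₀ = 3 / 4 + p * T + c * T ^ 2 := by
        simp only [hwdef, hy₀]; field_simp
      rw [this]
      have a1 : p * T ≤ T ^ 2 := by nlinarith [le_abs_self p]
      have a2 : c * T ^ 2 ≤ T ^ 2 * T ^ 2 := by gcongr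
      nlinarith [one_le_pow₀ hT (n := 2)]
    have hf0 := hB y₀ (by linarith) le_rfl
    have hT46 : T ^ 4 ≤ T ^ 6 := pow_le_pow_right₀ hT (by norm_num)
    calc E y₀ ≤ (8 * B * T ^ 3) ^ 2 + 3 * T ^ 4 * B ^ 2 := by
          simp only [hE]; gcongr
      _ ≤ (8 * B * T ^ 3) ^ 2 + 3 * T ^ 6 * B ^ 2 := by gcongr
      _ = _ := by ring
  have hfin : ‖f y₁‖ ^ 2 ≤ (20 * B * T ^ 3) ^ 2 := by
    have h1 := hwpos y₁ (right_mem_Icc.2 hy₁)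
    have h2 : 3 / 4 * ‖f y₁‖ ^ 2 ≤ E y₁ := by
      simp only [hE]; nlinarith [sq_nonneg ‖f' y₁‖, sq_nonneg ‖f y₁‖]
    nlinarith [sq_nonneg (B * T ^ 3)]
  exact le_of_sq_le_sq hfin (by positivity)

/-- With nonnegative potential `‖f‖²` is convex. A positive slope anywhere would force linear
growth, contradicting the limit `0`, so it decreases. -/
theorem norm_le_of_convex {y₁ : ℝ} (hy₁ : 0 < y₁)
    (h₁ : ∀ y : ℝ, 0 < y → HasDerivAt f (f' y) y)
    (h₂ : ∀ y : ℝ, 0 < y → HasDerivAt f' (((1 / 4 - p / y - c / y ^ 2 : ℝ) : ℂ) * f y) y)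
    (hw : ∀ y : ℝ, y₁ ≤ y → 0 ≤ 1 / 4 - p / y - c / y ^ 2) (hlim : Tendsto f atTop (𝓝 0))
    {y : ℝ} (hy : y₁ ≤ y) : ‖f y‖ ≤ ‖f y₁‖ := by
  set φ : ℝ → ℝ := fun y => ‖f y‖ ^ 2
  set φ' : ℝ → ℝ := fun y => 2 * (inner ℝ (f y) (f' y) : ℝ)
  have d1 : ∀ y ∈ Ici y₁, HasDerivAt φ (φ' y) y := fun y hy =>
    (h₁ y (hy₁.trans_le hy)).norm_sq
  have d2 : ∀ y ∈ Ici y₁, HasDerivAt φ'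
      (2 * ((1 / 4 - p / y - c / y ^ 2) * ‖f y‖ ^ 2 + ‖f' y‖ ^ 2)) y := by
    intro y hy
    have hy' := hy₁.trans_le hy
    refine (((h₁ y hy').inner ℝ (h₂ y hy')).const_mul 2).congr_deriv ?_
    rw [← Complex.real_smul, inner_smul_right, real_inner_self_eq_norm_sq,
      real_inner_self_eq_norm_sq]
  have hmono : MonotoneOn φ' (Ici y₁) := by
    refine monotoneOn_of_hasDerivWithinAt_nonneg (convex_Ici _)
      (fun y hy => (d2 y hy).continuousAt.continuousWithinAt)
      (fun y hy => (d2 y (interior_subset hy)).hasDerivWithinAt) fun y hy => ?_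
    have := hw y (interior_subset hy)
    positivity
  have hφlim : Tendsto φ atTop (𝓝 0) := by simpa using (hlim.norm).pow 2
  have hnonpos : ∀ z ∈ Ici y₁, φ' z ≤ 0 := by
    intro z hz
    by_contra! hpos
    have hz' : Ici z ⊆ Ici y₁ := Ici_subset_Ici.2 hz
    have hm : MonotoneOn (fun y => φ y - φ' z * y) (Ici z) := by
      refine monotoneOn_of_hasDerivWithinAt_nonneg (f' := fun y => φ' y - φ' z) (convex_Ici _)
        (fun y hy => ?_) (fun y hy => ?_) fun y hy => ?_
      · exact (((d1 y (hz' hy)).sub ((hasDerivAt_id y).const_mul (φ' z)))).continuousAt.continuousWithinAt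
      · have hy := interior_subset hy
        exact ((((d1 y (hz' hy)).sub ((hasDerivAt_id y).const_mul (φ' z)))).congr_deriv
          (by ring)).hasDerivWithinAt
      · have hy := interior_subset hy
        exact sub_nonneg.2 (hmono hz (hz' hy) hy)
    have hev : ∀ᶠ y in atTop, φ y < φ z + 1 :=
      hφlim.eventually (gt_mem_nhds (by positivity))
    obtain ⟨y, hy1, hy2⟩ := (hev.and (eventually_ge_atTop (z + 1 / φ' z))).exists
    have hzy : z ≤ y := by have : 0 < 1 / φ' z := by positivity
                           linarith
    have h1 := hm (mem_Ici.2 le_rfl) (mem_Ici.2 hzy) hzy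
    have h2 : 1 ≤ φ' z * (y - z) := by
      have : φ' z * (1 / φ' z) = 1 := by field_simp
      nlinarith
    simp only at h1
    linarith
  have hanti : AntitoneOn φ (Ici y₁) :=
    antitoneOn_of_hasDerivWithinAt_nonpos (convex_Ici _)
      (fun y hy => (d1 y hy).continuousAt.continuousWithinAt)
      (fun y hy => (d1 y (interior_subset hy)).hasDerivWithinAt)
      fun y hy => hnonpos y (interior_subset hy)
  exact le_of_sq_le_sq (hanti (mem_Ici.2 le_rfl) (mem_Ici.2 hy) hy) (norm_nonneg _)

/-- A bound near `0` for a solution of Whittaker's equation, recessive if `p < 0`, propagates to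
`(0, 1]` with polynomial loss. -/
theorem norm_le_of_initial (hT : 1 ≤ T) (hp : |p| ≤ T) (hc : 0 ≤ c) (hcT : c ≤ T ^ 2)
    (h₁ : ∀ y : ℝ, 0 < y → HasDerivAt f (f' y) y)
    (h₂ : ∀ y : ℝ, 0 < y → HasDerivAt f' (((1 / 4 - p / y - c / y ^ 2 : ℝ) : ℂ) * f y) y)
    (hB : ∀ y : ℝ, 1 / T / 2 ≤ y → y ≤ 1 / T → ‖f y‖ ≤ B)
    (hlim : p < 0 → Tendsto f atTop (𝓝 0)) {y : ℝ} (hy : 1 / T ≤ y) (hy' : y ≤ 1) :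
    ‖f y‖ ≤ 20 * B * T ^ 3 := by
  have hT0 : 0 < T := by linarith
  have hy0 : 0 < 1 / T := by positivity
  have hB0 : 0 ≤ B := (norm_nonneg _).trans (hB _ (by linarith) le_rfl)
  rcases le_or_gt 0 p with hp0 | hp0
  · refine norm_le_of_energy hT hp hc hcT h₁ h₂ hB hy hy' fun z hz _ => ?_
    have : 0 < z := by linarith
    positivity
  -- For `p < 0`, `y₁` is the turning point, the positive root of `y²/4 - py - c`. Before it `py + c
  -- ≥ py₁ + c = y₁²/4 ≥ 0`, so the energy argument applies; after it the potential is nonnegative.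
  set s := Real.sqrt (p ^ 2 + c)
  have hs : s ^ 2 = p ^ 2 + c := Real.sq_sqrt (by positivity)
  have hs0 : 0 ≤ s := Real.sqrt_nonneg _
  set y₁ := 2 * (p + s) with hy₁
  have hroot : y₁ ^ 2 / 4 - p * y₁ = c := by rw [hy₁]; linear_combination hs
  have hw : ∀ z : ℝ, 0 < z → z ≤ y₁ → 0 ≤ p * z + c := by
    intro z hz hz1
    nlinarith [sq_nonneg y₁]
  have hr : ∀ z : ℝ, 0 < z → y₁ ≤ z → 0 ≤ 1 / 4 - p / z - c / z ^ 2 := by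
    intro z hz hz1
    have : 1 / 4 - p / z - c / z ^ 2 = (z ^ 2 / 4 - p * z - c) / z ^ 2 := by
      field_simp
    rw [this]
    refine div_nonneg ?_ (by positivity)
    have hp1 : 0 ≤ y₁ := by
      have : -p ≤ s := Real.le_sqrt_of_sq_le (by nlinarith)
      rw [hy₁]; linarith
    nlinarith
  have h20 : B ≤ 20 * B * T ^ 3 := by
    have : 1 ≤ T ^ 3 := one_le_pow₀ hT
    nlinarith
  rcases le_or_gt y₁ (1 / T) with hcase | hcase
  · exact (norm_le_of_convex hy0 h₁ h₂ (fun z hz => hr z (by linarith) (by linarith))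
      (hlim hp0) hy).trans ((hB _ (by linarith) le_rfl).trans h20)
  rcases le_or_gt y y₁ with hcase2 | hcase2
  · exact norm_le_of_energy hT hp hc hcT h₁ h₂ hB hy hy'
      fun z hz hz' => hw z (by linarith) (by linarith)
  · exact (norm_le_of_convex (hy0.trans hcase) h₁ h₂ (fun z hz => hr z (by linarith) hz)
      (hlim hp0) hcase2.le).trans (norm_le_of_energy hT hp hc hcT h₁ h₂ hB hcase.le
        (by linarith) fun z hz hz' => hw z (by linarith) hz')

/-- A power bound near `0` for a solution of Whittaker's equation, recessive if `p < 0`, holds on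
`(0, 1]` with polynomial loss. -/
theorem norm_le_rpow_of_initial {M e : ℝ} (hT : 1 ≤ T) (hp : |p| ≤ T) (hc : 0 ≤ c)
    (hcT : c ≤ T ^ 2) (hM : 0 ≤ M) (he : -1 ≤ e) (he' : e ≤ 1)
    (h₁ : ∀ y : ℝ, 0 < y → HasDerivAt f (f' y) y)
    (h₂ : ∀ y : ℝ, 0 < y → HasDerivAt f' (((1 / 4 - p / y - c / y ^ 2 : ℝ) : ℂ) * f y) y)
    (hB : ∀ y : ℝ, 0 < y → y ≤ 1 / T → ‖f y‖ ≤ M * y ^ e)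
    (hlim : p < 0 → Tendsto f atTop (𝓝 0)) {y : ℝ} (hy : 0 < y) (hy' : y ≤ 1) :
    ‖f y‖ ≤ 40 * M * T ^ 5 * y ^ e := by
  have hT0 : 0 < T := by linarith
  have hy0 : 0 < 1 / T := by positivity
  have hT1 : 1 / T ≤ 1 := by rw [div_le_one hT0]; exact hT
  have hT5 : 1 ≤ T ^ 5 := one_le_pow₀ hT
  rcases le_or_gt y (1 / T) with h | h
  · refine (hB y hy h).trans ?_
    gcongr
    nlinarith
  -- The power is replaced by a constant on the window using `e ≥ -1`; `h2` restores it using `e ≤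
  -- 1`. Each exchange costs one factor `T`.
  have hB' : ∀ z : ℝ, 1 / T / 2 ≤ z → z ≤ 1 / T → ‖f z‖ ≤ M * (2 * T) := by
    intro z hz hz'
    have hz0 : 0 < z := by linarith
    refine (hB z hz0 hz').trans ?_
    gcongr
    calc z ^ e ≤ z ^ (-1 : ℝ) := Real.rpow_le_rpow_of_exponent_ge hz0 (by linarith) he
      _ = z⁻¹ := Real.rpow_neg_one z
      _ ≤ (1 / T / 2)⁻¹ := by gcongr
      _ = 2 * T := by field_simp
  have h1 := norm_le_of_initial hT hp hc hcT h₁ h₂ hB' hlim h.le hy'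
  have h2 : 1 ≤ T * y ^ e := by
    have : y ^ (1 : ℝ) ≤ y ^ e := Real.rpow_le_rpow_of_exponent_ge hy hy' he'
    rw [Real.rpow_one] at this
    calc 1 = T * (1 / T) := by field_simp
      _ ≤ T * y ^ e := by gcongr; linarith
  calc _ ≤ _ := h1
    _ = 40 * M * T ^ 4 * 1 := by ring
    _ ≤ 40 * M * T ^ 4 * (T * y ^ e) := by gcongr
    _ = _ := by ring

end ODE

end Whittaker

/-! ### Uniform bounds for quotients of Gamma functions -/

namespace Whittaker

open Complex Filter Topology Nat MeasureTheory Set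
open scoped Real

theorem norm_sin_le (z : ℂ) : ‖Complex.sin z‖ ≤ Real.cosh z.im := by
  rw [Complex.sin, norm_div, norm_mul, norm_I, mul_one, Real.cosh_eq]
  have h := norm_sub_le (Complex.exp (-z * I)) (Complex.exp (z * I))
  rw [Complex.norm_exp, Complex.norm_exp] at h
  rw [show ‖(2 : ℂ)‖ = 2 by simp]
  gcongr
  simpa using h

theorem inv_Gamma_mul_inv_Gamma_one_sub (z : ℂ) :
    (Gamma z)⁻¹ * (Gamma (1 - z))⁻¹ = Complex.sin (π * z) / π := by
  rw [← mul_inv, Gamma_mul_Gamma_one_sub, inv_div]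

theorem inv_Gamma_one_sub {s : ℂ} (hs : 0 < s.re) :
    (Gamma (1 - s))⁻¹ = Gamma s * (Complex.sin (π * s) / π) := by
  rw [← inv_Gamma_mul_inv_Gamma_one_sub, mul_inv_cancel_left₀ (Gamma_ne_zero_of_re_pos hs)]

theorem norm_inv_Gamma_one_sub_le {s : ℂ} (hs : 0 < s.re) (him : |s.im| ≤ 1) :
    ‖(Gamma (1 - s))⁻¹‖ ≤ Real.cosh π * ‖Gamma s‖ := by
  rw [inv_Gamma_one_sub hs, norm_mul, norm_div, norm_real, Real.norm_of_nonneg Real.pi_pos.le,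
    mul_comm]
  gcongr
  refine (div_le_self (norm_nonneg _) (by linarith [Real.pi_gt_three])).trans
    ((norm_sin_le _).trans ?_)
  rw [Real.cosh_le_cosh, im_ofReal_mul, abs_mul, abs_of_pos Real.pi_pos]
  nlinarith [Real.pi_pos]

/-- The quotient is `B(z, v) / Γ(v)`, and the beta integrand is dominated by that of `B(3/8, 3/8)`.
The value `3/8 = 1 - 5/8` is the least real part of `1 - μ` for `‖μ‖ ≤ 5/8`. -/
theorem exists_norm_Gamma_mul_inv_Gamma_le : ∃ C : ℝ, 0 < C ∧ ∀ z v : ℂ, 3 / 8 ≤ z.re →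
    3 / 8 ≤ v.re → ‖v‖ ≤ 2 → ‖Gamma z‖ * ‖(Gamma (z + v))⁻¹‖ ≤ C := by
  obtain ⟨C, hC0, hC⟩ := exists_norm_inv_Gamma_le 2
  set g : ℝ → ℝ := fun x =>
    ‖(x : ℂ) ^ ((3 / 8 : ℝ) - 1 : ℂ) * (1 - (x : ℂ)) ^ ((3 / 8 : ℝ) - 1 : ℂ)‖ with hg
  have hgi : IntervalIntegrable g volume 0 1 :=
    (betaIntegral_convergent (u := (3 / 8 : ℝ)) (v := (3 / 8 : ℝ))
      (by rw [ofReal_re]; norm_num) (by rw [ofReal_re]; norm_num)).norm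
  have hg0 : 0 ≤ ∫ x in (0 : ℝ)..1, g x :=
    intervalIntegral.integral_nonneg zero_le_one fun x _ => norm_nonneg _
  refine ⟨(∫ x in (0 : ℝ)..1, g x) * C + 1, by positivity, fun z v hz hv hv2 => ?_⟩
  have hz0 : 0 < z.re := by linarith
  have hv0 : 0 < v.re := by linarith
  have hbeta : ‖betaIntegral z v‖ ≤ ∫ x in (0 : ℝ)..1, g x := by
    refine intervalIntegral.norm_integral_le_of_norm_le zero_le_one ?_ hgi
    filter_upwards [compl_mem_ae_iff.2 (measure_singleton (1 : ℝ))] with x hx1 hx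
    have h0 : 0 < x := hx.1
    have h1 : 0 < 1 - x := sub_pos.2 (lt_of_le_of_ne hx.2 hx1)
    simp only [hg]
    rw [show (1 - (x : ℂ)) = ((1 - x : ℝ) : ℂ) by push_cast; rfl, norm_mul, norm_mul,
      norm_cpow_eq_rpow_re_of_pos h0, norm_cpow_eq_rpow_re_of_pos h1,
      norm_cpow_eq_rpow_re_of_pos h0, norm_cpow_eq_rpow_re_of_pos h1]
    simp only [sub_re, one_re, ofReal_re]
    exact mul_le_mul (Real.rpow_le_rpow_of_exponent_ge h0 hx.2 (by linarith))
      (Real.rpow_le_rpow_of_exponent_ge h1 (by linarith) (by linarith)) (by positivity)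
      (by positivity)
  have hne := Gamma_ne_zero_of_re_pos (s := z + v) (by simp; linarith)
  have hnv := Gamma_ne_zero_of_re_pos hv0
  have e : Gamma z * (Gamma (z + v))⁻¹ = betaIntegral z v * (Gamma v)⁻¹ := by
    rw [betaIntegral_eq_Gamma_mul_div _ _ hz0 hv0]
    field_simp
  rw [← norm_mul, e, norm_mul]
  calc _ ≤ (∫ x in (0 : ℝ)..1, g x) * C := by gcongr; exact hC v hv2
    _ ≤ _ := by linarith

/-- Reflection would give `Γ(s)`, which has a pole at `0` inside the range; `Γ(s + 1)` avoids it.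
For `‖s‖ ≤ 1` compactness suffices. For `‖s‖ > 1` the constraints force `Re s > 0` and `|Γ(s)| ≤
|Γ(s + 1)|`. -/
theorem exists_norm_inv_Gamma_one_sub_le : ∃ C : ℝ, 0 < C ∧ ∀ s : ℂ, -(1 / 8) ≤ s.re →
    |s.im| ≤ 5 / 8 → ‖(Gamma (1 - s))⁻¹‖ ≤ C * ‖Gamma (s + 1)‖ := by
  obtain ⟨C, hC0, hC⟩ := exists_norm_inv_Gamma_le 2
  refine ⟨C * C + Real.cosh π, by positivity, fun s hre him => ?_⟩
  rcases le_or_gt ‖s‖ 1 with h | h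
  · have h1 := hC (1 - s) ((norm_sub_le _ _).trans (by simp; linarith))
    have h2 := hC (s + 1) ((norm_add_le _ _).trans (by simp; linarith))
    have h3 : Gamma (s + 1) ≠ 0 := Gamma_ne_zero_of_re_pos (by simp; linarith)
    have h4 : 0 < ‖Gamma (s + 1)‖ := norm_pos_iff.2 h3
    rw [norm_inv, inv_le_iff_one_le_mul₀ h4] at h2
    calc _ ≤ C * (C * ‖Gamma (s + 1)‖) := h1.trans (le_mul_of_one_le_right hC0.le h2)
      _ ≤ C * (C * ‖Gamma (s + 1)‖) + Real.cosh π * ‖Gamma (s + 1)‖ := by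
        linarith [mul_nonneg (Real.cosh_pos π).le h4.le]
      _ = _ := by ring
  · have hsq : 1 < s.re ^ 2 + s.im ^ 2 := by
      have : ‖s‖ ^ 2 = s.re ^ 2 + s.im ^ 2 := by rw [Complex.sq_norm, normSq_apply]; ring
      nlinarith
    have him2 : s.im ^ 2 ≤ (5 / 8) ^ 2 := sq_le_sq' (by linarith [abs_le.1 him]) (abs_le.1 him).2
    have hpos : 0 < s.re := by
      by_contra! hneg
      nlinarith
    have h1 := norm_inv_Gamma_one_sub_le hpos (by linarith)
    have h0 : s ≠ 0 := by rw [← norm_pos_iff]; linarith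
    have h2 : ‖Gamma s‖ ≤ ‖Gamma (s + 1)‖ := by
      rw [Gamma_add_one _ h0, norm_mul]
      exact le_mul_of_one_le_left (norm_nonneg _) h.le
    have := Real.cosh_pos π
    calc _ ≤ Real.cosh π * ‖Gamma (s + 1)‖ := h1.trans (by gcongr)
      _ ≤ _ := by gcongr; nlinarith

/-- According to the sign of `p`, reflection inverts whichever factor has its argument going to the
left. The product becomes a quotient of Gammas with boundedly different arguments, up to shifts
costing powers of `|p| + 1`. -/
theorem exists_norm_inv_Gamma_half_le : ∃ C : ℝ, 0 < C ∧ ∀ (p : ℝ) (μ : ℂ), ‖μ‖ ≤ 5 / 8 →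
    ‖(Gamma (1 / 2 - μ - p))⁻¹‖ * ‖(Gamma (1 / 2 + p))⁻¹‖ ≤ C * (|p| + 1) ^ 2 := by
  obtain ⟨C, hC0, hC⟩ := exists_norm_Gamma_mul_inv_Gamma_le
  obtain ⟨C', hC'0, hC'⟩ := exists_norm_inv_Gamma_one_sub_le
  have hch := Real.cosh_pos π
  refine ⟨2 * C' * C + 2 * Real.cosh π * C, by positivity, fun p μ hμ => ?_⟩
  have hre := abs_le.1 ((Complex.abs_re_le_norm μ).trans hμ)
  have him := (Complex.abs_im_le_norm μ).trans hμ
  have hv : ‖1 - μ‖ ≤ 2 := (norm_sub_le _ _).trans (by simp; linarith)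
  have hvre : 3 / 8 ≤ (1 - μ).re := by simp; linarith
  rcases le_or_gt 0 p with hp | hp
  · rw [abs_of_nonneg hp]
    have h1 := hC' (1 / 2 + p + μ) (by simp; linarith) (by simpa using him)
    have h2 := hC (1 / 2 + p + μ + 1) (1 - μ) (by simp; linarith) hvre hv
    rw [show 1 / 2 + p + μ + 1 + (1 - μ) = 1 / 2 + p + 1 + 1 by ring] at h2
    rw [show (1 : ℂ) / 2 - μ - p = 1 - (1 / 2 + p + μ) by ring, inv_Gamma_eq (1 / 2 + p),
      inv_Gamma_eq (1 / 2 + p + 1), norm_mul, norm_mul]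
    have e1 : ‖(1 / 2 + p : ℂ)‖ = 1 / 2 + p := by
      rw [show (1 / 2 + p : ℂ) = ((1 / 2 + p : ℝ) : ℂ) by push_cast; rfl, norm_real,
        Real.norm_of_nonneg (by linarith)]
    have e2 : ‖(1 / 2 + p + 1 : ℂ)‖ = 1 / 2 + p + 1 := by
      rw [show (1 / 2 + p + 1 : ℂ) = ((1 / 2 + p + 1 : ℝ) : ℂ) by push_cast; rfl, norm_real,
        Real.norm_of_nonneg (by linarith)]
    rw [e1, e2]
    calc _ ≤ C' * ‖Gamma (1 / 2 + p + μ + 1)‖ *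
          ((1 / 2 + p) * ((1 / 2 + p + 1) * ‖(Gamma (1 / 2 + p + 1 + 1))⁻¹‖)) := by gcongr
      _ = C' * ((1 / 2 + p) * (1 / 2 + p + 1)) *
          (‖Gamma (1 / 2 + p + μ + 1)‖ * ‖(Gamma (1 / 2 + p + 1 + 1))⁻¹‖) := by ring
      _ ≤ C' * (2 * (p + 1) ^ 2) * C :=
        mul_le_mul (mul_le_mul_of_nonneg_left (by nlinarith) hC'0.le) h2 (by positivity)
          (by positivity)
      _ ≤ C' * (2 * (p + 1) ^ 2) * C + 2 * Real.cosh π * C * (p + 1) ^ 2 := by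
        have : 0 ≤ 2 * Real.cosh π * C * (p + 1) ^ 2 := by positivity
        linarith
      _ = _ := by ring
  · rw [abs_of_neg hp]
    have h1 := norm_inv_Gamma_one_sub_le (s := 1 / 2 - p) (by simp; linarith) (by simp)
    have h2 := hC (1 / 2 - p) (1 - μ) (by simp; linarith) hvre hv
    rw [show (1 : ℂ) / 2 - p + (1 - μ) = 1 / 2 - μ - p + 1 by ring] at h2
    rw [show (1 : ℂ) / 2 + p = 1 - (1 / 2 - p) by ring, inv_Gamma_eq (1 / 2 - μ - p), norm_mul]
    have e1 : ‖(1 / 2 - μ - p : ℂ)‖ ≤ 2 * (-p + 1) := by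
      calc _ ≤ ‖(1 / 2 - μ : ℂ)‖ + ‖(p : ℂ)‖ := norm_sub_le _ _
        _ ≤ (‖(1 / 2 : ℂ)‖ + ‖μ‖) + ‖(p : ℂ)‖ := by gcongr; exact norm_sub_le _ _
        _ ≤ _ := by
          rw [norm_real, Real.norm_of_nonpos hp.le]; norm_num; linarith
    calc _ ≤ (2 * (-p + 1) * ‖(Gamma (1 / 2 - μ - p + 1))⁻¹‖) *
          (Real.cosh π * ‖Gamma (1 / 2 - p)‖) :=
          mul_le_mul (mul_le_mul_of_nonneg_right e1 (norm_nonneg _)) h1 (norm_nonneg _)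
            (mul_nonneg (by linarith) (norm_nonneg _))
      _ = 2 * Real.cosh π * (-p + 1) *
          (‖Gamma (1 / 2 - p)‖ * ‖(Gamma (1 / 2 - μ - p + 1))⁻¹‖) := by ring
      _ ≤ 2 * Real.cosh π * (-p + 1) ^ 2 * C :=
        mul_le_mul (mul_le_mul_of_nonneg_left (by nlinarith) (by positivity)) h2 (by positivity)
          (by positivity)
      _ ≤ 2 * Real.cosh π * (-p + 1) ^ 2 * C + 2 * C' * C * (-p + 1) ^ 2 := by
        have : 0 ≤ 2 * C' * C * (-p + 1) ^ 2 := by positivity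
        linarith
      _ = _ := by ring

theorem exists_norm_inv_Gamma_mul_inv_Gamma_le : ∃ C : ℝ, 0 < C ∧ ∀ (p : ℝ) (μ : ℂ),
    ‖μ‖ ≤ 1 / 8 →
    ‖(Gamma (1 / 2 + μ - p))⁻¹‖ * ‖(Gamma (1 / 2 + p + μ))⁻¹‖ ≤ C * (|p| + 1) := by
  obtain ⟨C, hC0, hC⟩ := exists_norm_Gamma_mul_inv_Gamma_le
  have hch := Real.cosh_pos π
  have key : ∀ (p : ℝ) (μ : ℂ), 0 ≤ p → ‖μ‖ ≤ 1 / 8 →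
      ‖(Gamma (1 / 2 + μ - p))⁻¹‖ * ‖(Gamma (1 / 2 + p + μ))⁻¹‖ ≤
        2 * Real.cosh π * C * (p + 1) := by
    intro p μ hp hμ
    have hre := abs_le.1 ((Complex.abs_re_le_norm μ).trans hμ)
    have him := (Complex.abs_im_le_norm μ).trans hμ
    have h1 := norm_inv_Gamma_one_sub_le (s := 1 / 2 + p - μ) (by simp; linarith)
      (by simp; linarith)
    have h2 := hC (1 / 2 + p - μ) (1 + 2 * μ) (by simp; linarith) (by simp; linarith)
      ((norm_add_le _ _).trans (by simp; linarith))
    rw [show 1 / 2 + p - μ + (1 + 2 * μ) = 1 / 2 + p + μ + 1 by ring] at h2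
    rw [show 1 / 2 + μ - p = 1 - (1 / 2 + p - μ) by ring, inv_Gamma_eq (1 / 2 + p + μ), norm_mul]
    have e1 : ‖(1 / 2 + p + μ : ℂ)‖ ≤ 2 * (p + 1) := by
      calc _ ≤ ‖(1 / 2 + p : ℂ)‖ + ‖μ‖ := norm_add_le _ _
        _ ≤ (‖(1 / 2 : ℂ)‖ + ‖(p : ℂ)‖) + ‖μ‖ := by gcongr; exact norm_add_le _ _
        _ ≤ _ := by
          rw [norm_real, Real.norm_of_nonneg hp]; norm_num; linarith
    calc _ ≤ (Real.cosh π * ‖Gamma (1 / 2 + p - μ)‖) *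
          (2 * (p + 1) * ‖(Gamma (1 / 2 + p + μ + 1))⁻¹‖) := by gcongr
      _ = 2 * Real.cosh π * (p + 1) *
          (‖Gamma (1 / 2 + p - μ)‖ * ‖(Gamma (1 / 2 + p + μ + 1))⁻¹‖) := by ring
      _ ≤ 2 * Real.cosh π * (p + 1) * C := by gcongr
      _ = _ := by ring
  -- The product is invariant under `p ↦ -p`, so `p ≥ 0` is enough.
  refine ⟨2 * Real.cosh π * C, by positivity, fun p μ hμ => ?_⟩
  rcases le_total 0 p with hp | hp
  · rw [abs_of_nonneg hp]; exact key p μ hp hμ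
  · rw [abs_of_nonpos hp]
    have := key (-p) μ (by linarith) hμ
    rw [ofReal_neg, show 1 / 2 + μ - -(p : ℂ) = 1 / 2 + p + μ by ring,
      show 1 / 2 + -(p : ℂ) + μ = 1 / 2 + μ - p by ring, mul_comm] at this
    exact this

/-- For real `r` the reflected argument is the complex conjugate, so reflection gives the modulus
exactly. -/
theorem norm_inv_Gamma_one_add_sq (r : ℝ) (hr : r ≠ 0) :
    ‖(Gamma (1 + 2 * (I * r)))⁻¹‖ ^ 2 = Real.sinh (2 * π * r) / (2 * π * r) := by
  have h1 := inv_Gamma_mul_inv_Gamma_one_sub (2 * (I * r))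
  have hconj : (Gamma (1 - 2 * (I * r))) = (starRingEnd ℂ) (Gamma (1 + 2 * (I * r))) := by
    rw [← Gamma_conj, map_add, map_mul, map_mul, conj_I, conj_ofReal, map_one, map_ofNat]
    congr 1; ring
  rw [hconj, inv_Gamma_eq, add_comm _ (1 : ℂ),
    show (π : ℂ) * (2 * (I * r)) = ((2 * π * r : ℝ) : ℂ) * I by push_cast; ring,
    Complex.sin_mul_I] at h1
  have h2 := congrArg norm h1
  rw [← ofReal_sinh] at h2
  simp only [norm_mul, norm_inv, RCLike.norm_conj, norm_div, norm_I, norm_real, mul_one, one_mul,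
    norm_ofNat, Real.norm_of_nonneg Real.pi_pos.le, Real.norm_eq_abs] at h2
  have h3 : |Real.sinh (2 * π * r)| / |r| = Real.sinh (2 * π * r) / r := by
    rcases lt_or_gt_of_ne hr with h | h
    · rw [abs_of_neg h, abs_of_neg, neg_div_neg_eq]
      rw [Real.sinh_neg_iff]; nlinarith [Real.pi_pos]
    · rw [abs_of_pos h, abs_of_pos]
      rw [Real.sinh_pos_iff]; positivity
  have h4 : Real.sinh (2 * π * r) / (2 * π * r) =
      (|Real.sinh (2 * π * r)| / |r|) / (2 * π) := by rw [h3]; field_simp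
  have hr' : |r| ≠ 0 := abs_ne_zero.2 hr
  rw [h4, norm_inv]
  field_simp at h2 ⊢
  linear_combination h2

end Whittaker

/-! ### Principal and complementary series for `y ≤ 1/T` -/

namespace Whittaker

open Complex Filter Topology Nat Set
open scoped Real

theorem exists_norm_whittakerN_le : ∃ C : ℝ, 0 < C ∧ ∀ (p T y δ : ℝ) (μ : ℂ), ‖μ‖ ≤ 5 / 8 →
    |p| + 2 ≤ T → 0 < y → y ≤ 1 / T → -δ ≤ μ.re → ‖whittakerN p μ y‖ ≤ C * y ^ (1 / 2 - δ) := by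
  obtain ⟨C, hC0, hC⟩ := exists_norm_kummerR_le 3
  refine ⟨C * Real.exp 3, by positivity, fun p T y δ μ hμ hT hy hyT hδ => ?_⟩
  have hT0 : 0 < T := by linarith [abs_nonneg p]
  have hTy : T * y ≤ 1 := by rwa [le_div_iff₀ hT0, mul_comm] at hyT
  have hy1 : y ≤ 1 := by nlinarith [abs_nonneg p]
  have h1 := hC (1 + 2 * μ) ((norm_add_le _ _).trans (by simp; linarith)) (1 / 2 + μ - p) T
    (by linarith [abs_nonneg p]) (by
      calc _ ≤ ‖(1 / 2 + μ : ℂ)‖ + ‖(p : ℂ)‖ := norm_sub_le _ _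
        _ ≤ (‖(1 / 2 : ℂ)‖ + ‖μ‖) + ‖(p : ℂ)‖ := by gcongr; exact norm_add_le _ _
        _ ≤ _ := by rw [norm_real, Real.norm_eq_abs]; norm_num; linarith) y
  rw [norm_real, Real.norm_of_nonneg hy.le] at h1
  unfold whittakerN
  rw [norm_mul, norm_mul, norm_cpow_eq_rpow_re_of_pos hy]
  have h2 : ‖Complex.exp (-(y : ℂ) / 2)‖ ≤ 1 := by
    rw [show -(y : ℂ) / 2 = ((-y / 2 : ℝ) : ℂ) by push_cast; rfl, Complex.norm_exp, ofReal_re,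
      Real.exp_le_one_iff]
    linarith
  have h3 : y ^ (μ + 1 / 2).re ≤ y ^ (1 / 2 - δ) :=
    Real.rpow_le_rpow_of_exponent_ge hy hy1 (by simp; linarith)
  calc _ ≤ y ^ (1 / 2 - δ) * 1 * (C * Real.exp 3) := by
        gcongr
        refine h1.trans ?_
        gcongr
        linarith
    _ = _ := by ring

theorem norm_whittakerN_I_le {p r T y : ℝ} (hT : |p| + |r| + 2 ≤ T) (hy : 0 < y) (hyT : y ≤ 1 / T) :
    ‖whittakerN p (I * r) y‖ ≤ ‖(Gamma (1 + 2 * (I * r)))⁻¹‖ * Real.exp 1 * y ^ (1 / 2 : ℝ) := by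
  have hT0 : 0 < T := by linarith [abs_nonneg p, abs_nonneg r]
  have hTy : T * y ≤ 1 := by rwa [le_div_iff₀ hT0, mul_comm] at hyT
  have h1 := norm_kummerR_le_of_one_le_re (a := 1 / 2 + I * r - p) (b := 1 + 2 * (I * r))
    (z := y) (T := T) (by linarith [abs_nonneg p, abs_nonneg r]) (by
      calc _ ≤ ‖(1 / 2 + I * r : ℂ)‖ + ‖(p : ℂ)‖ := norm_sub_le _ _
        _ ≤ (‖(1 / 2 : ℂ)‖ + ‖I * (r : ℂ)‖) + ‖(p : ℂ)‖ := by gcongr; exact norm_add_le _ _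
        _ ≤ _ := by
          rw [norm_mul, norm_I, norm_real, norm_real, Real.norm_eq_abs, Real.norm_eq_abs]
          norm_num; linarith) (by simp)
  rw [norm_real, Real.norm_of_nonneg hy.le] at h1
  unfold whittakerN
  rw [norm_mul, norm_mul, norm_cpow_eq_rpow_re_of_pos hy]
  have h2 : ‖Complex.exp (-(y : ℂ) / 2)‖ ≤ 1 := by
    rw [show -(y : ℂ) / 2 = ((-y / 2 : ℝ) : ℂ) by push_cast; rfl, Complex.norm_exp, ofReal_re,
      Real.exp_le_one_iff]
    linarith
  have h3 : (I * r + 1 / 2 : ℂ).re = 1 / 2 := by simp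
  rw [h3]
  calc _ ≤ y ^ (1 / 2 : ℝ) * 1 * (‖(Gamma (1 + 2 * (I * r)))⁻¹‖ * Real.exp 1) := by
        gcongr
        refine h1.trans ?_
        gcongr
    _ = _ := by ring

/-- This trades a zero of `H` for the factor `‖z - c‖` that cancels the small sine. -/
theorem norm_le_of_schwarz {f : ℂ → ℂ} {c z : ℂ} {ρ B : ℝ} (hf : Differentiable ℂ f) (h0 : f c = 0)
    (hB : ∀ w, ‖w - c‖ < ρ → ‖f w‖ ≤ B) (hz : ‖z - c‖ < ρ) : ‖f z‖ ≤ B / ρ * ‖z - c‖ := by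
  have := dist_le_div_mul_dist_of_mapsTo_ball (f := f) (c := c) (R₁ := ρ) (R₂ := B) (z := z)
    hf.differentiableOn (fun w hw => by
      rw [h0, mem_closedBall_zero_iff]; exact hB w (by simpa [dist_eq_norm] using hw))
    (by simpa [dist_eq_norm] using hz)
  simpa [h0, dist_eq_norm] using this

/-- `‖π cosh(π r) / (sinh(2 π r) Γ(1 + 2 i r))‖` is bounded away from `r = 0`. -/
theorem cosh_mul_norm_inv_Gamma_le {ρ r : ℝ} (hρ : 0 < ρ) (hr : ρ ≤ |r|) :
    Real.cosh (π * r) * ‖(Gamma (1 + 2 * (I * r)))⁻¹‖ ≤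
      (1 + 1 / ρ) * |Real.sinh (2 * π * r)| := by
  have hr0 : r ≠ 0 := by rintro rfl; simp at hr; linarith
  have hsq := norm_inv_Gamma_one_add_sq r hr0
  have hpi := Real.pi_gt_three
  refine le_of_sq_le_sq ?_ (by positivity)
  rw [mul_pow, hsq, mul_pow, sq_abs]
  have habs : Real.sinh (2 * π * r) / (2 * π * r) =
      |Real.sinh (2 * π * r)| / (2 * π * |r|) := by
    rcases lt_or_gt_of_ne hr0 with h | h
    · rw [abs_of_neg h, abs_of_neg, mul_neg, neg_div_neg_eq]
      rw [Real.sinh_neg_iff]; nlinarith [Real.pi_pos]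
    · rw [abs_of_pos h, abs_of_pos]
      rw [Real.sinh_pos_iff]; positivity
  rw [habs, ← sq_abs (Real.sinh (2 * π * r))]
  set x := π * |r| with hx
  have hx0 : 0 < x := by positivity
  have e1 : |Real.sinh (2 * π * r)| = 2 * Real.sinh x * Real.cosh x := by
    rw [← Real.sinh_two_mul, hx, Real.abs_sinh]
    congr 1
    rw [abs_mul, abs_mul, abs_of_pos Real.pi_pos, abs_of_pos (by norm_num : (0 : ℝ) < 2)]; ring
  have e2 : Real.cosh (π * r) = Real.cosh x := by
    rw [← Real.cosh_abs, abs_mul, abs_of_pos Real.pi_pos]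
  rw [e1, e2, show 2 * π * |r| = 2 * x by rw [hx]; ring]
  have hs : x ≤ Real.sinh x := Real.self_le_sinh_iff.2 hx0.le
  have hc1 : 1 ≤ Real.cosh x := Real.one_le_cosh x
  have hcs : Real.cosh x ≤ Real.sinh x + 1 := by
    have := Real.cosh_sub_sinh x
    have : Real.exp (-x) ≤ 1 := Real.exp_le_one_iff.2 (by linarith)
    linarith
  have hρx : ρ ≤ x := by nlinarith
  set s := Real.sinh x
  set c := Real.cosh x
  have hs0 : 0 < s := by linarith
  have h1 : c ≤ (1 + 1 / ρ) * s := by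
    have : 1 ≤ 1 / ρ * s := by rw [one_div, inv_mul_eq_div, le_div_iff₀ hρ]; linarith
    linarith
  have h2 : 1 ≤ (1 + 1 / ρ) * x := by
    have : 1 ≤ 1 / ρ * x := by rw [one_div, inv_mul_eq_div, le_div_iff₀ hρ]; linarith
    linarith
  rw [mul_div_assoc', div_le_iff₀ (by positivity)]
  have h3 : c * 1 ≤ ((1 + 1 / ρ) * s) * ((1 + 1 / ρ) * x) := by gcongr
  calc c ^ 2 * (2 * s * c) = 2 * s * c ^ 2 * (c * 1) := by ring
    -- Both `c ≤ (1 + 1/ρ) s` and `1 ≤ (1 + 1/ρ) x` use `x ≥ ρ`; together they account for the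
    -- squared constant.
    _ ≤ 2 * s * c ^ 2 * (((1 + 1 / ρ) * s) * ((1 + 1 / ρ) * x)) := by gcongr
    _ ≤ 4 * (2 * s * c ^ 2 * (((1 + 1 / ρ) * s) * ((1 + 1 / ρ) * x))) := by
      have : 0 ≤ 2 * s * c ^ 2 * (((1 + 1 / ρ) * s) * ((1 + 1 / ρ) * x)) := by positivity
      linarith
    _ = _ := by ring

theorem norm_sin_two_pi_I (r : ℝ) :
    ‖Complex.sin (2 * π * (I * r))‖ = |Real.sinh (2 * π * r)| := by
  rw [show (2 : ℂ) * π * (I * r) = ((2 * π * r : ℝ) : ℂ) * I by push_cast; ring,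
    Complex.sin_mul_I, norm_mul, norm_I, mul_one, ← ofReal_sinh, norm_real, Real.norm_eq_abs]

/-- The bound for the principal series when `y` is small in terms of the parameters. -/
theorem exists_principal_small {ε : ℝ} (hε : 0 < ε) : ∃ C : ℝ, 0 < C ∧ ∀ p r y T : ℝ, r ≠ 0 →
    |p| + |r| + 2 ≤ T → 0 < y → y ≤ 1 / T →
    ‖π / Complex.sin (2 * π * (I * r)) * whittakerH p (I * r) y *
      (Gamma (1 / 2 + p + I * r))⁻¹‖ ≤ C * T * y ^ (1 / 2 - min ε (1 / 8)) := by
  obtain ⟨C₁, hC₁0, hC₁⟩ := exists_norm_whittakerN_le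
  obtain ⟨C₂, hC₂0, hC₂⟩ := exists_norm_inv_Gamma_mul_inv_Gamma_le
  set ρ := min ε (1 / 8) with hρ
  have hρ0 : 0 < ρ := lt_min hε (by norm_num)
  have hρ8 : ρ ≤ 1 / 8 := min_le_right _ _
  have hch := Real.cosh_pos π
  refine ⟨C₁ * (C₂ + Real.cosh π) / ρ + 2 * (1 + 1 / ρ) * Real.exp 1, by positivity,
    fun p r y T hr hT hy hyT => ?_⟩
  have hT1 : 1 ≤ T := by linarith [abs_nonneg p, abs_nonneg r]
  have hTy : T * y ≤ 1 := by rwa [le_div_iff₀ (by linarith), mul_comm] at hyT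
  have hy1 : y ≤ 1 := by nlinarith
  have hpi := Real.pi_gt_three
  have hp1 : |p| + 1 ≤ T := by linarith [abs_nonneg r]
  set K : ℂ → ℂ := fun μ => whittakerH p μ y * (Gamma (1 / 2 + p + μ))⁻¹ with hK
  have hKeq : ∀ μ, K μ = whittakerN p (-μ) y *
      ((Gamma (1 / 2 + μ - p))⁻¹ * (Gamma (1 / 2 + p + μ))⁻¹) -
      whittakerN p μ y * (Complex.sin (π * (1 / 2 + p + μ)) / π) := by
    intro μ
    rw [← inv_Gamma_mul_inv_Gamma_one_sub,
      show (1 : ℂ) - (1 / 2 + p + μ) = 1 / 2 - μ - p by ring]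
    simp only [hK, whittakerH]
    ring
  have hyρ : 0 < y ^ (1 / 2 - ρ) := by positivity
  rw [mul_assoc, norm_mul]
  change _ * ‖K (I * r)‖ ≤ _
  rw [norm_div, norm_sin_two_pi_I, norm_real, Real.norm_of_nonneg Real.pi_pos.le]
  have hnI : ‖I * (r : ℂ)‖ = |r| := by rw [norm_mul, norm_I, one_mul, norm_real, Real.norm_eq_abs]
  have hsinh : 2 * π * |r| ≤ |Real.sinh (2 * π * r)| := by
    rw [Real.abs_sinh, abs_mul, abs_of_pos (by positivity : 0 < 2 * π)]
    exact Real.self_le_sinh_iff.2 (by positivity)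
  have hr0 : 0 < |r| := abs_pos.2 hr
  have hS0 : 0 < |Real.sinh (2 * π * r)| := lt_of_lt_of_le (by positivity) hsinh
  -- For `|r| < ρ` the zero of `K` at `0` is used on the disc of radius `ρ`, where `|Re μ| ≤ ρ`
  -- costs `y^{-ρ}`. For `|r| ≥ ρ` the sine is bounded below and the terms are estimated directly on
  -- the imaginary axis, with no loss in `y`.
  rcases lt_or_ge |r| ρ with hcase | hcase
  · have hKd : Differentiable ℂ K := (differentiable_whittakerH p hy).mul
      (differentiable_inv_Gamma_comp (by fun_prop))
    have hK0 : K 0 = 0 := by simp [hK, whittakerH_zero]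
    have hB : ∀ μ : ℂ, ‖μ - 0‖ < ρ → ‖K μ‖ ≤
        C₁ * (C₂ + Real.cosh π) * T * y ^ (1 / 2 - ρ) := by
      intro μ hμ
      rw [sub_zero] at hμ
      have hre := abs_le.1 ((Complex.abs_re_le_norm μ).trans hμ.le)
      have him := (Complex.abs_im_le_norm μ).trans hμ.le
      have n1 := hC₁ p T y ρ (-μ) (by rw [norm_neg]; linarith) (by linarith) hy hyT
        (by simp; linarith)
      have n2 := hC₁ p T y ρ μ (by linarith) (by linarith) hy hyT (by linarith)
      have n3 := hC₂ p μ (by linarith)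
      have n4 : ‖Complex.sin (π * (1 / 2 + p + μ)) / π‖ ≤ Real.cosh π := by
        rw [norm_div, norm_real, Real.norm_of_nonneg Real.pi_pos.le]
        refine (div_le_self (norm_nonneg _) (by linarith)).trans ((norm_sin_le _).trans ?_)
        rw [Real.cosh_le_cosh, im_ofReal_mul, abs_mul, abs_of_pos Real.pi_pos]
        simp
        nlinarith
      rw [hKeq]
      calc _ ≤ ‖whittakerN p (-μ) y‖ * (‖(Gamma (1 / 2 + μ - p))⁻¹‖ *
              ‖(Gamma (1 / 2 + p + μ))⁻¹‖) +
              ‖whittakerN p μ y‖ * ‖Complex.sin (π * (1 / 2 + p + μ)) / π‖ := by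
            refine (norm_sub_le _ _).trans ?_
            rw [norm_mul, norm_mul, norm_mul]
        _ ≤ C₁ * y ^ (1 / 2 - ρ) * (C₂ * T) + C₁ * y ^ (1 / 2 - ρ) * (Real.cosh π * T) :=
          add_le_add (mul_le_mul n1 (n3.trans (by gcongr)) (by positivity) (by positivity))
            (mul_le_mul n2 (n4.trans (le_mul_of_one_le_right hch.le hT1)) (by positivity)
              (by positivity))
        _ = _ := by ring
    have h := norm_le_of_schwarz hKd hK0 hB (z := I * r) (by rw [sub_zero, hnI]; exact hcase)
    rw [sub_zero, hnI] at h
    have h5 : π / |Real.sinh (2 * π * r)| * |r| ≤ 1 := by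
      rw [div_mul_eq_mul_div, div_le_one hS0]; nlinarith
    calc _ ≤ π / |Real.sinh (2 * π * r)| *
          (C₁ * (C₂ + Real.cosh π) * T * y ^ (1 / 2 - ρ) / ρ * |r|) := by gcongr
      _ = C₁ * (C₂ + Real.cosh π) / ρ * T * y ^ (1 / 2 - ρ) *
          (π / |Real.sinh (2 * π * r)| * |r|) := by ring
      _ ≤ C₁ * (C₂ + Real.cosh π) / ρ * T * y ^ (1 / 2 - ρ) * 1 := by gcongr
      _ ≤ _ := by
        rw [mul_one]
        gcongr
        have : 0 ≤ 2 * (1 + 1 / ρ) * Real.exp 1 := by positivity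
        linarith
  · have n1 := norm_whittakerN_I_le (r := -r) (p := p) (by rwa [abs_neg]) hy hyT
    have n2 := norm_whittakerN_I_le hT hy hyT
    have hsin : ‖Complex.sin (π * (1 / 2 + p + I * r)) / π‖ ≤ Real.cosh (π * r) / π := by
      rw [norm_div, norm_real, Real.norm_of_nonneg Real.pi_pos.le]
      gcongr
      refine (norm_sin_le _).trans_eq ?_
      rw [im_ofReal_mul]; simp
    -- Since `p` and `r` are real, conjugation exchanges the two Gamma coefficients, so both
    -- products reduce to the reflection formula at `1/2 + p + ir`.
    have hconj : ‖(Gamma (1 / 2 + I * r - p))⁻¹‖ = ‖(Gamma (1 / 2 - I * r - p))⁻¹‖ := by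
      rw [norm_inv, norm_inv, ← RCLike.norm_conj (Gamma (1 / 2 + I * r - p)), ← Gamma_conj]
      congr 3
      rw [map_sub, map_add, map_mul, conj_I, conj_ofReal, conj_ofReal, map_div₀, map_one,
        map_ofNat]
      ring
    have hconj2 : ‖(Gamma (1 + 2 * (I * (-r : ℝ))))⁻¹‖ = ‖(Gamma (1 + 2 * (I * r)))⁻¹‖ := by
      rw [norm_inv, norm_inv, ← RCLike.norm_conj (Gamma (1 + 2 * (I * r))), ← Gamma_conj]
      congr 3
      rw [map_add, map_mul, map_mul, conj_I, conj_ofReal, map_one, map_ofNat]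
      push_cast; ring
    rw [hconj2, ofReal_neg, mul_neg] at n1
    have hprod : ‖(Gamma (1 / 2 + I * r - p))⁻¹ * (Gamma (1 / 2 + p + I * r))⁻¹‖ ≤
        Real.cosh (π * r) / π := by
      rw [norm_mul, hconj, ← norm_mul, mul_comm,
        show (1 : ℂ) / 2 - I * r - p = 1 - (1 / 2 + p + I * r) by ring,
        inv_Gamma_mul_inv_Gamma_one_sub]
      exact hsin
    have h3 := cosh_mul_norm_inv_Gamma_le hρ0 hcase
    set G := ‖(Gamma (1 + 2 * (I * r)))⁻¹‖
    set Y := y ^ (1 / 2 : ℝ)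
    set ch := Real.cosh (π * r)
    have hch0 : 0 < ch := Real.cosh_pos _
    have hKb : ‖K (I * r)‖ ≤ 2 * (G * Real.exp 1 * Y) * (ch / π) := by
      rw [hKeq]
      calc _ ≤ ‖whittakerN p (-(I * r)) y‖ * ‖(Gamma (1 / 2 + I * r - p))⁻¹ *
              (Gamma (1 / 2 + p + I * r))⁻¹‖ +
              ‖whittakerN p (I * r) y‖ * ‖Complex.sin (π * (1 / 2 + p + I * r)) / π‖ := by
            refine (norm_sub_le _ _).trans ?_
            rw [norm_mul (whittakerN p (-(I * r)) y), norm_mul (whittakerN p (I * r) y)]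
        _ ≤ (G * Real.exp 1 * Y) * (ch / π) + (G * Real.exp 1 * Y) * (ch / π) := by gcongr
        _ = _ := by ring
    have hY : Y ≤ y ^ (1 / 2 - ρ) := Real.rpow_le_rpow_of_exponent_ge hy hy1 (by linarith)
    calc _ ≤ π / |Real.sinh (2 * π * r)| * (2 * (G * Real.exp 1 * Y) * (ch / π)) := by gcongr
      _ = 2 * Real.exp 1 * Y / |Real.sinh (2 * π * r)| * (ch * G) := by field_simp
      _ ≤ 2 * Real.exp 1 * Y / |Real.sinh (2 * π * r)| *
          ((1 + 1 / ρ) * |Real.sinh (2 * π * r)|) := by gcongr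
      _ = 2 * (1 + 1 / ρ) * Real.exp 1 * 1 * Y := by field_simp
      _ ≤ 2 * (1 + 1 / ρ) * Real.exp 1 * T * y ^ (1 / 2 - ρ) := by gcongr
      _ ≤ _ := by
        gcongr
        have : 0 ≤ C₁ * (C₂ + Real.cosh π) / ρ := by positivity
        linarith

/-- The bound for the complementary series when `y` is small in terms of the parameters. -/
theorem exists_complementary_small {ε : ℝ} (hε : 0 < ε) : ∃ C : ℝ, 0 < C ∧ ∀ p ν y T : ℝ,
    0 < ν → ν < 1 / 2 → |p| + 2 ≤ T → 0 < y → y ≤ 1 / T →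
    ‖π / Complex.sin (2 * π * ν) * whittakerH p ν y * (Gamma (1 / 2 + p))⁻¹‖ ≤
      C * T ^ 2 * y ^ (1 / 2 - ν - min ε (1 / 4)) := by
  obtain ⟨C₁, hC₁0, hC₁⟩ := exists_norm_whittakerN_le
  obtain ⟨C₂, hC₂0, hC₂⟩ := exists_norm_inv_Gamma_half_le
  set ε' := min ε (1 / 4) with hε'
  -- If `|ν - c| < ρ`, a point within `ρ` of `c` has real part at most `ν + 2ρ = ν + ε'` in modulus.
  -- Also `ρ ≤ 1/8`, so a disc about `1/2` stays in `‖μ‖ ≤ 5/8`.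
  set ρ := ε' / 2 with hρ
  have hε0 : 0 < ε' := lt_min hε (by norm_num)
  have hε4 : ε' ≤ 1 / 4 := min_le_right _ _
  have hρ0 : 0 < ρ := by positivity
  refine ⟨2 * C₁ * C₂ / ρ, by positivity, fun p ν y T hν0 hν1 hT hy hyT => ?_⟩
  have hT0 : 0 < T := by linarith [abs_nonneg p]
  have hTy : T * y ≤ 1 := by rwa [le_div_iff₀ hT0, mul_comm] at hyT
  set K : ℂ → ℂ := fun μ => whittakerH p μ y * (Gamma (1 / 2 + p))⁻¹ with hK
  have hKd : Differentiable ℂ K := (differentiable_whittakerH p hy).mul_const _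
  set B := 2 * C₁ * C₂ * T ^ 2 * y ^ (1 / 2 - ν - ε') with hB
  have hB0 : 0 < B := by positivity
  have hKb : ∀ μ : ℂ, ‖μ‖ ≤ 5 / 8 → |μ.re| ≤ ν + ε' → ‖K μ‖ ≤ B := by
    intro μ hμ hμre
    have hre := abs_le.1 hμre
    have n1 := hC₁ p T y (ν + ε') (-μ) (by rwa [norm_neg]) hT hy hyT (by simp; linarith)
    have n2 := hC₁ p T y (ν + ε') μ hμ hT hy hyT (by linarith)
    have n3 := hC₂ p μ hμ
    have n4 := hC₂ p (-μ) (by rwa [norm_neg])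
    rw [sub_neg_eq_add] at n4
    rw [← sub_sub] at n1 n2
    have hpT : C₂ * (|p| + 1) ^ 2 ≤ C₂ * T ^ 2 := by gcongr; linarith
    have e : K μ = whittakerN p (-μ) y * ((Gamma (1 / 2 + μ - p))⁻¹ * (Gamma (1 / 2 + p))⁻¹) -
        whittakerN p μ y * ((Gamma (1 / 2 - μ - p))⁻¹ * (Gamma (1 / 2 + p))⁻¹) := by
      simp only [hK, whittakerH]; ring
    rw [e]
    calc _ ≤ ‖whittakerN p (-μ) y‖ * (‖(Gamma (1 / 2 + μ - p))⁻¹‖ * ‖(Gamma (1 / 2 + p))⁻¹‖) +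
          ‖whittakerN p μ y‖ * (‖(Gamma (1 / 2 - μ - p))⁻¹‖ * ‖(Gamma (1 / 2 + p))⁻¹‖) := by
          refine (norm_sub_le _ _).trans ?_
          rw [norm_mul, norm_mul, norm_mul, norm_mul]
      _ ≤ C₁ * y ^ (1 / 2 - ν - ε') * (C₂ * T ^ 2) + C₁ * y ^ (1 / 2 - ν - ε') * (C₂ * T ^ 2) :=
        add_le_add (mul_le_mul n1 (n4.trans hpT) (by positivity) (by positivity))
          (mul_le_mul n2 (n3.trans hpT) (by positivity) (by positivity))
      _ = B := by rw [hB]; ring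
  have key : ∀ c : ℝ, (c = 0 ∨ c = 1 / 2) → 4 * |ν - c| ≤ Real.sin (2 * π * ν) → ν ≠ c →
      ‖π / Complex.sin (2 * π * ν) * whittakerH p ν y * (Gamma (1 / 2 + p))⁻¹‖ ≤ B / ρ := by
    intro c hc hsin hne
    have hKc : K c = 0 := by
      rcases hc with rfl | rfl
      · simp [hK, whittakerH_zero]
      · simp only [hK]
        push_cast
        rw [whittakerH_half _ hy, zero_mul]
    have habs : 0 < |ν - c| := abs_pos.2 (sub_ne_zero.2 hne)
    have hnorm : ‖(ν : ℂ) - c‖ = |ν - c| := by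
      rw [← ofReal_sub, norm_real, Real.norm_eq_abs]
    have hKν : ‖K ν‖ ≤ B / ρ * |ν - c| := by
      -- Close to the zero `c` the Schwarz lemma applies; otherwise `|ν - c| / ρ ≥ 1` and the plain
      -- bound is enough.
      rcases lt_or_ge |ν - c| ρ with hcase | hcase
      · rw [← hnorm]
        refine norm_le_of_schwarz hKd hKc (fun w hw => hKb w ?_ ?_) (by rwa [hnorm])
        · have h1 : ‖w‖ ≤ ‖w - c‖ + ‖(c : ℂ)‖ := by simpa using norm_add_le (w - c) (c : ℂ)
          have h2 : ‖(c : ℂ)‖ ≤ 1 / 2 := by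
            rw [norm_real, Real.norm_eq_abs]
            rcases hc with rfl | rfl <;> norm_num [abs_of_pos]
          linarith
        · have h1 := abs_le.1 ((Complex.abs_re_le_norm (w - c)).trans hw.le)
          have h2 := abs_lt.1 hcase
          have h3 : (w - c).re = w.re - c := by simp
          rw [h3] at h1
          rw [abs_le]
          rcases hc with rfl | rfl <;> constructor <;> linarith
      · refine (hKb ν (by rw [norm_real, Real.norm_of_nonneg hν0.le]; linarith)
          (by rw [ofReal_re, abs_of_pos hν0]; linarith)).trans ?_
        rw [div_mul_eq_mul_div, le_div_iff₀ hρ0]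
        gcongr
    have hs0 : 0 < Real.sin (2 * π * ν) := by linarith
    rw [mul_assoc, norm_mul, norm_div, norm_real, Real.norm_of_nonneg Real.pi_pos.le,
      show (2 * π * ν : ℂ) = ((2 * π * ν : ℝ) : ℂ) by push_cast; rfl, ← ofReal_sin, norm_real,
      Real.norm_of_nonneg hs0.le]
    have h6 : π / Real.sin (2 * π * ν) * |ν - c| ≤ 1 := by
      rw [div_mul_eq_mul_div, div_le_one hs0]
      nlinarith [Real.pi_lt_four]
    calc _ ≤ π / Real.sin (2 * π * ν) * (B / ρ * |ν - c|) := by gcongr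
      _ = B / ρ * (π / Real.sin (2 * π * ν) * |ν - c|) := by ring
      _ ≤ B / ρ * 1 := by gcongr
      _ = _ := mul_one _
  have hfin : B / ρ = 2 * C₁ * C₂ / ρ * T ^ 2 * y ^ (1 / 2 - ν - ε') := by rw [hB]; ring
  rw [← hfin]
  have hpi := Real.pi_pos
  -- The nearer of the zeros `0` and `1/2` is chosen; Jordan's inequality then gives `sin(2πν) ≥ 4|ν
  -- - c|`.
  rcases le_or_gt ν (1 / 4) with h4 | h4
  · refine key 0 (Or.inl rfl) ?_ hν0.ne'
    rw [sub_zero, abs_of_pos hν0]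
    have := Real.mul_le_sin (x := 2 * π * ν) (by positivity) (by nlinarith)
    refine le_trans (le_of_eq ?_) this
    field_simp; norm_num
  · refine key (1 / 2) (Or.inr rfl) ?_ hν1.ne
    rw [abs_of_neg (by linarith)]
    have := Real.mul_le_sin (x := π - 2 * π * ν) (by nlinarith) (by nlinarith)
    rw [Real.sin_pi_sub] at this
    refine le_trans (le_of_eq ?_) this
    field_simp; ring

end Whittaker

/-! ### Principal and complementary series on the whole interval `(0, 1)` -/

namespace Whittaker

open Complex Filter Topology Nat Set
open scoped Real

theorem whittakerW_of_ne {p ν : ℂ} {y : ℝ} (h : ∀ m : ℤ, 2 * ν ≠ m) :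
    whittakerW p ν y = π / Complex.sin (2 * π * ν) * whittakerH p ν y := by
  rw [whittakerW, if_neg (by push Not; exact h), whittakerWGeneric_eq]

/-- L'Hôpital's rule for `π H / sin(2πμ)`, written as a quotient of slopes; at a zero of the sine
the cosine is nonzero. -/
theorem tendsto_whittakerWGeneric {p ν h' : ℂ} {y : ℝ} {m : ℤ} (hm : 2 * ν = m)
    (h0 : whittakerH p ν y = 0) (hd : HasDerivAt (fun μ => whittakerH p μ y) h' ν) :
    Tendsto (fun μ => whittakerWGeneric p μ y) (𝓝[≠] ν)
      (𝓝 (h' / (2 * Complex.cos (2 * π * ν)))) := by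
  have hpi : (π : ℂ) ≠ 0 := ofReal_ne_zero.2 Real.pi_ne_zero
  have hs0 : Complex.sin (2 * π * ν) = 0 := by
    rw [show 2 * π * ν = (m : ℂ) * π by rw [← hm]; ring]; exact Complex.sin_int_mul_pi m
  have hc0 : Complex.cos (2 * π * ν) ≠ 0 := by
    intro h
    have := Complex.sin_sq_add_cos_sq (2 * π * ν)
    rw [h, hs0] at this
    norm_num at this
  have hsd : HasDerivAt (fun μ : ℂ => Complex.sin (2 * π * μ))
      (Complex.cos (2 * π * ν) * (2 * π * 1)) ν :=
    ((hasDerivAt_id ν).const_mul (2 * π : ℂ)).csin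
  have t1 := hasDerivAt_iff_tendsto_slope.1 hd
  have t2 := hasDerivAt_iff_tendsto_slope.1 hsd
  have t3 := (t1.div t2 (by simp [hc0, hpi])).const_mul (π : ℂ)
  have hval : (π : ℂ) * (h' / (Complex.cos (2 * π * ν) * (2 * π * 1))) =
      h' / (2 * Complex.cos (2 * π * ν)) := by field_simp
  rw [hval] at t3
  refine t3.congr' ?_
  filter_upwards [self_mem_nhdsWithin] with μ hμ
  have hμ' : μ - ν ≠ 0 := sub_ne_zero.2 hμ
  simp only [Pi.div_apply, slope_def_field]
  rw [whittakerWGeneric_eq, h0, hs0, sub_zero, sub_zero, div_div_div_cancel_right₀ hμ']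
  ring

theorem whittakerW_eq_of_hasDerivAt {p ν h' : ℂ} {y : ℝ} {m : ℤ} (hm : 2 * ν = m)
    (h0 : whittakerH p ν y = 0) (hd : HasDerivAt (fun μ => whittakerH p μ y) h' ν) :
    whittakerW p ν y = h' / (2 * Complex.cos (2 * π * ν)) := by
  rw [whittakerW, if_pos ⟨m, hm⟩]
  exact (tendsto_whittakerWGeneric hm h0 hd).limUnder_eq

theorem tendsto_whittakerW_zero (p : ℂ) {y : ℝ} (hy : 0 < y) :
    Tendsto (fun μ => whittakerWGeneric p μ y) (𝓝[≠] 0) (𝓝 (whittakerW p 0 y)) := by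
  have hd := (differentiable_whittakerH p hy 0).hasDerivAt
  rw [whittakerW_eq_of_hasDerivAt (m := 0) (by simp) (whittakerH_zero p y) hd]
  exact tendsto_whittakerWGeneric (m := 0) (by simp) (whittakerH_zero p y) hd

theorem tendsto_whittakerH_atTop {p : ℝ} {ν : ℂ} (hp : p ≤ 0) (h1 : -(1 / 2) < ν.re)
    (h2 : ν.re < 1 / 2) : Tendsto (whittakerH p ν) atTop (𝓝 0) := by
  have hexp : Tendsto (fun y : ℝ => Real.exp (-y / 2)) atTop (𝓝 0) := by
    have := (Real.tendsto_exp_neg_atTop_nhds_zero).comp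
      (tendsto_id.atTop_div_const (by norm_num : (0 : ℝ) < 2))
    refine this.congr fun y => ?_
    simp [neg_div]
  have hlim := (((hexp.const_mul (Real.Gamma (1 / 2 + ν.re))).const_mul
    ‖(Gamma (1 / 2 + ν - p))⁻¹‖).const_mul (‖Complex.sin (2 * π * ν)‖ / π))
  rw [mul_zero, mul_zero, mul_zero] at hlim
  rw [tendsto_zero_iff_norm_tendsto_zero]
  refine squeeze_zero' (.of_forall fun t => norm_nonneg _) ?_ hlim
  filter_upwards [eventually_gt_atTop 0] with y hy
  exact norm_whittakerH_le_exp hp h1 h2 hy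

/-- The constant `κ` carries the sine and Gamma factors of `W`: the equation is linear, so the
normalized function is propagated as it stands. Decay is required only for `p < 0`, where Tricomi's
integral supplies it. -/
theorem norm_const_mul_whittakerH_le {p c T M e y : ℝ} {ν κ : ℂ} (hν : ν ^ 2 = ((1 / 4 - c : ℝ) : ℂ))
    (h1 : -(1 / 2) < ν.re) (h2 : ν.re < 1 / 2)
    (hT : 1 ≤ T) (hp : |p| ≤ T) (hc : 0 ≤ c) (hcT : c ≤ T ^ 2) (hM : 0 ≤ M) (he : -1 ≤ e)
    (he' : e ≤ 1) (hB : ∀ y : ℝ, 0 < y → y ≤ 1 / T → ‖κ * whittakerH p ν y‖ ≤ M * y ^ e)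
    (hy : 0 < y) (hy' : y ≤ 1) : ‖κ * whittakerH p ν y‖ ≤ 40 * M * T ^ 5 * y ^ e := by
  have hW := (isWhittaker_whittakerH p ν).const_mul κ
  refine norm_le_rpow_of_initial hT hp hc hcT hM he he' hW.1 (fun y hy => ?_) hB (fun hp0 => ?_)
    hy hy'
  · refine (hW.2 y hy).congr_deriv ?_
    rw [hν]
    push_cast
    ring
  · simpa using (tendsto_whittakerH_atTop hp0.le h1 h2).const_mul κ

theorem exists_principal_bound {ε : ℝ} (hε : 0 < ε) : ∃ C : ℝ, 0 < C ∧ ∀ p r y : ℝ, 0 < y → y < 1 →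
    ‖whittakerW p (I * r) y / Gamma (1 / 2 + p + I * r)‖ ≤
      C * (|p| + |r| + 1) ^ 6 * y ^ (1 / 2 - ε) := by
  obtain ⟨C, hC0, hC⟩ := exists_principal_small hε
  have hρ : min ε (1 / 8) ≤ 1 / 8 := min_le_right _ _
  have hρ0 : 0 < min ε (1 / 8) := lt_min hε (by norm_num)
  -- The sixth power is one factor `T` from small `y` and `T⁵` from propagation; `2 ^ 6` converts
  -- `T` to `|p| + |r| + 1`.
  refine ⟨40 * C * 2 ^ 6, by positivity, ?_⟩
  have main : ∀ p r y : ℝ, r ≠ 0 → 0 < y → y < 1 →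
      ‖whittakerW p (I * r) y / Gamma (1 / 2 + p + I * r)‖ ≤
        40 * C * 2 ^ 6 * (|p| + |r| + 1) ^ 6 * y ^ (1 / 2 - ε) := by
    intro p r y hr hy hy1
    have hne : ∀ m : ℤ, 2 * (I * r) ≠ (m : ℂ) := by
      intro m hm
      have := congrArg Complex.im hm
      simp at this
      exact hr this
    have hap := abs_nonneg p
    have har := abs_nonneg r
    set T := |p| + |r| + 2 with hT
    have hb := norm_const_mul_whittakerH_le (p := p) (c := 1 / 4 + r ^ 2) (T := T) (M := C * T)
      (e := 1 / 2 - min ε (1 / 8)) (ν := I * r)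
      (κ := π / Complex.sin (2 * π * (I * r)) * (Gamma (1 / 2 + p + I * r))⁻¹) (y := y)
      (by rw [mul_pow, I_sq]; push_cast; ring) (by simp) (by simp) (by linarith) (by linarith)
      (by positivity) (by rw [← sq_abs r]; nlinarith) (by positivity) (by linarith) (by linarith)
      (fun z hz hz' => by
        have := hC p r z T hr le_rfl hz hz'
        rwa [mul_right_comm]) hy hy1.le
    rw [whittakerW_of_ne hne, div_eq_mul_inv, mul_right_comm]
    refine hb.trans ?_
    have hT2 : T ≤ 2 * (|p| + |r| + 1) := by linarith
    have hye : y ^ (1 / 2 - min ε (1 / 8)) ≤ y ^ (1 / 2 - ε) :=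
      Real.rpow_le_rpow_of_exponent_ge hy hy1.le (by linarith [min_le_left ε (1 / 8)])
    calc _ = 40 * C * T ^ 6 * y ^ (1 / 2 - min ε (1 / 8)) := by ring
      _ ≤ 40 * C * (2 * (|p| + |r| + 1)) ^ 6 * y ^ (1 / 2 - ε) := by gcongr
      _ = _ := by ring
  intro p r y hy hy1
  rcases eq_or_ne r 0 with rfl | hr
  -- At `r = 0`, `W` is a limit over a punctured complex neighbourhood. It is approached along the
  -- imaginary axis, and the bound passes to the limit because its right side is continuous in `r`.
  · have t0 : Tendsto (fun r : ℝ => I * (r : ℂ)) (𝓝[≠] 0) (𝓝[≠] 0) := by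
      refine tendsto_nhdsWithin_iff.2 ⟨?_, ?_⟩
      · have : Tendsto (fun r : ℝ => I * (r : ℂ)) (𝓝 0) (𝓝 (I * ((0 : ℝ) : ℂ))) :=
          (by fun_prop : Continuous fun r : ℝ => I * (r : ℂ)).tendsto 0
        simp only [ofReal_zero, mul_zero] at this
        exact this.mono_left nhdsWithin_le_nhds
      · filter_upwards [self_mem_nhdsWithin] with r hr
        simpa using hr
    have t1 := (tendsto_whittakerW_zero p hy).comp t0
    have t2 : Tendsto (fun r : ℝ => (Gamma (1 / 2 + p + I * r))⁻¹) (𝓝[≠] 0)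
        (𝓝 (Gamma (1 / 2 + p + I * (0 : ℝ)))⁻¹) :=
      ((differentiable_one_div_Gamma.continuous.comp
        (by fun_prop : Continuous fun r : ℝ => 1 / 2 + (p : ℂ) + I * r)).tendsto 0).mono_left
        nhdsWithin_le_nhds
    have t3 := (t1.mul t2).norm
    have t4 : Tendsto (fun r : ℝ => 40 * C * 2 ^ 6 * (|p| + |r| + 1) ^ 6 * y ^ (1 / 2 - ε)) (𝓝[≠] 0)
        (𝓝 (40 * C * 2 ^ 6 * (|p| + |(0 : ℝ)| + 1) ^ 6 * y ^ (1 / 2 - ε))) :=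
      ((by fun_prop : Continuous fun r : ℝ =>
        40 * C * 2 ^ 6 * (|p| + |r| + 1) ^ 6 * y ^ (1 / 2 - ε)).tendsto 0).mono_left
        nhdsWithin_le_nhds
    have e0 : I * ((0 : ℝ) : ℂ) = 0 := by simp
    rw [e0] at t3 ⊢
    rw [div_eq_mul_inv]
    refine le_of_tendsto_of_tendsto t3 t4 ?_
    filter_upwards [self_mem_nhdsWithin] with r hr
    have hne : ¬ ∃ m : ℤ, 2 * (I * r) = (m : ℂ) := by
      rintro ⟨m, hm⟩
      have := congrArg Complex.im hm
      simp at this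
      exact hr this
    have := main p r y hr hy hy1
    rw [whittakerW, if_neg hne, div_eq_mul_inv] at this
    exact this
  · exact main p r y hr hy hy1

theorem exists_complementary_bound {ε : ℝ} (hε : 0 < ε) : ∃ C : ℝ, 0 < C ∧ ∀ p ν y : ℝ,
    0 < ν → ν < 1 / 2 → 0 < y → y < 1 →
    ‖whittakerW p ν y / Gamma (1 / 2 + p)‖ ≤ C * (|p| + 1) ^ 7 * y ^ (1 / 2 - ν - ε) := by
  obtain ⟨C, hC0, hC⟩ := exists_complementary_small hε
  have hρ : min ε (1 / 4) ≤ 1 / 4 := min_le_right _ _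
  have hρ0 : 0 < min ε (1 / 4) := lt_min hε (by norm_num)
  refine ⟨40 * C * 2 ^ 7, by positivity, fun p ν y hν0 hν1 hy hy1 => ?_⟩
  have hne : ∀ m : ℤ, 2 * (ν : ℂ) ≠ (m : ℂ) := by
    intro m hm
    have h1 : 2 * ν = (m : ℝ) := by exact_mod_cast hm
    have h2 : (0 : ℝ) < m := by linarith
    have h3 : (m : ℝ) < 1 := by linarith
    have h4 : 0 < m := by exact_mod_cast h2
    have h5 : m < 1 := by exact_mod_cast h3
    omega
  have hap := abs_nonneg p
  set T := |p| + 2 with hT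
  have hb := norm_const_mul_whittakerH_le (p := p) (c := 1 / 4 - ν ^ 2) (T := T) (M := C * T ^ 2)
    (e := 1 / 2 - ν - min ε (1 / 4)) (ν := ν)
    (κ := π / Complex.sin (2 * π * ν) * (Gamma (1 / 2 + p))⁻¹) (y := y)
    (by push_cast; ring) (by rw [ofReal_re]; linarith) (by rw [ofReal_re]; linarith) (by linarith)
    (by linarith) (by nlinarith) (by nlinarith) (by positivity) (by linarith) (by linarith)
    (fun z hz hz' => by
      have := hC p ν z T hν0 hν1 le_rfl hz hz'
      rwa [mul_right_comm]) hy hy1.le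
  rw [whittakerW_of_ne hne, div_eq_mul_inv, mul_right_comm]
  refine hb.trans ?_
  have hT2 : T ≤ 2 * (|p| + 1) := by linarith
  have hye : y ^ (1 / 2 - ν - min ε (1 / 4)) ≤ y ^ (1 / 2 - ν - ε) :=
    Real.rpow_le_rpow_of_exponent_ge hy hy1.le (by linarith [min_le_left ε (1 / 4)])
  calc _ = 40 * C * T ^ 7 * y ^ (1 / 2 - ν - min ε (1 / 4)) := by ring
    _ ≤ 40 * C * (2 * (|p| + 1)) ^ 7 * y ^ (1 / 2 - ν - ε) := by gcongr
    _ = _ := by ring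

end Whittaker

/-! ### Discrete series: reduction to the first Whittaker function -/

namespace Whittaker

open Complex Filter Topology Nat Set
open scoped Real

/-- Differentiating `1/Γ(s) = s · 1/Γ(s + 1)` at `-(n + 1)` leaves only `s` times the derivative at
`-n`, as `1/Γ(-n) = 0`. -/
theorem hasDerivAt_inv_Gamma_neg_nat (n : ℕ) :
    HasDerivAt (fun s : ℂ => (Gamma s)⁻¹) ((-1) ^ n * n !) (-n) := by
  have key : ∀ s₀ : ℂ, ∀ d : ℂ, HasDerivAt (fun s : ℂ => (Gamma s)⁻¹) d (s₀ + 1) →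
      HasDerivAt (fun s : ℂ => (Gamma s)⁻¹) ((Gamma (s₀ + 1))⁻¹ + s₀ * d) s₀ := by
    intro s₀ d hd
    have h := (hasDerivAt_id s₀).mul (hd.comp_add_const s₀ 1)
    refine (h.congr_deriv (by simp)).congr_of_eventuallyEq (.of_forall fun s => ?_)
    simpa using inv_Gamma_eq s
  induction n with
  | zero =>
    have hd := (differentiable_one_div_Gamma ((0 : ℂ) + 1)).hasDerivAt
    simpa using key 0 _ hd
  | succ n ih =>
    have h1 : (-((n + 1 : ℕ) : ℂ)) + 1 = -n := by push_cast; ring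
    have h := key (-((n + 1 : ℕ) : ℂ)) ((-1) ^ n * n !) (by rw [h1]; exact ih)
    refine h.congr_deriv ?_
    rw [h1, Gamma_neg_nat_eq_zero, Nat.factorial_succ]
    push_cast
    ring

theorem ascPochhammer_eval_neg_sub (n k : ℕ) :
    (ascPochhammer ℂ k).eval (-(n : ℂ) - k) * n ! = (-1) ^ k * (n + k)! := by
  induction k with
  | zero => simp
  | succ k ih =>
    rw [ascPochhammer_eval_succ_left,
      show -(n : ℂ) - ((k + 1 : ℕ) : ℂ) + 1 = -n - k by push_cast; ring, mul_assoc, ih,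
      ← Nat.add_assoc, Nat.factorial_succ]
    push_cast
    ring

/-- In the discrete series `W_{p,ν}` is a multiple of `M_{p,ν}`. -/
theorem whittakerW_discrete {p ν y : ℝ} {n : ℕ} (h : p - ν - 1 / 2 = n) (hν : -(1 / 2) < ν)
    (hy : 0 < y) :
    whittakerW p ν y = (-1) ^ n * Gamma (2 * ν + 1 + n) * whittakerN p ν y := by
  have hp : (p : ℂ) = ν + 1 / 2 + n := by
    rw [show p = ν + 1 / 2 + n by linarith]; push_cast; ring
  have e1 : (1 / 2 + ν - p : ℂ) = -n := by rw [hp]; ring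
  by_cases hm : ∃ m : ℤ, 2 * (ν : ℂ) = m
  · obtain ⟨m, hm⟩ := hm
    have hmr : 2 * ν = m := by exact_mod_cast hm
    have hm0 : 0 ≤ m := by
      have : (-1 : ℝ) < m := by linarith
      have : (-1 : ℤ) < m := by exact_mod_cast this
      omega
    obtain ⟨k, rfl⟩ := Int.eq_ofNat_of_zero_le hm0
    have hνk : (ν : ℂ) = k / 2 := by
      rw [eq_div_iff two_ne_zero, mul_comm, hm]; simp
    have e2 : (1 / 2 - ν - p : ℂ) = -((n + k : ℕ) : ℂ) := by
      rw [hp, hνk]; push_cast; ring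
    have h0 : whittakerH p ν y = 0 := by
      rw [whittakerH, e1, e2, Gamma_neg_nat_eq_zero, Gamma_neg_nat_eq_zero]; simp
    have hN : whittakerN p (-(ν : ℂ)) y =
        (ascPochhammer ℂ k).eval (-(n : ℂ) - k) * whittakerN p ν y := by
      rw [hνk, whittakerN_neg_half_nat p k hy, hp, hνk]
      congr 2
      ring
    have hd1 : HasDerivAt (fun μ : ℂ => (Gamma (1 / 2 + μ - p))⁻¹) ((-1) ^ n * n !) ν := by
      have hg : HasDerivAt (fun μ : ℂ => 1 / 2 + μ - p) 1 ν :=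
        ((hasDerivAt_id (ν : ℂ)).const_add (1 / 2)).sub_const (p : ℂ)
      have := HasDerivAt.comp (ν : ℂ) (h₂ := fun s : ℂ => (Gamma s)⁻¹)
        (by rw [e1]; exact hasDerivAt_inv_Gamma_neg_nat n) hg
      exact this.congr_deriv (by ring)
    have hd2 : HasDerivAt (fun μ : ℂ => (Gamma (1 / 2 - μ - p))⁻¹)
        (-((-1) ^ (n + k) * (n + k)!)) ν := by
      have hg : HasDerivAt (fun μ : ℂ => 1 / 2 - μ - p) (-1) ν :=
        ((hasDerivAt_id (ν : ℂ)).const_sub (1 / 2)).sub_const (p : ℂ)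
      have := HasDerivAt.comp (ν : ℂ) (h₂ := fun s : ℂ => (Gamma s)⁻¹)
        (by rw [e2]; exact hasDerivAt_inv_Gamma_neg_nat (n + k)) hg
      exact this.congr_deriv (by ring)
    have hN1 := ((differentiable_whittakerN (p : ℂ) hy).comp differentiable_neg (ν : ℂ)).hasDerivAt
    have hN2 := (differentiable_whittakerN (p : ℂ) hy (ν : ℂ)).hasDerivAt
    have hd := (hd1.mul hN1).sub (hd2.mul hN2)
    -- Both coefficients vanish at `ν`, so only their derivatives count. With `N_{-ν}` rewritten
    -- through `N_ν` the two contributions are equal; the resulting `2` cancels the one in the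
    -- L'Hôpital formula.
    have hd' : HasDerivAt (fun μ => whittakerH p μ y)
        (2 * (-1) ^ (n + k) * (n + k)! * whittakerN p ν y) ν := by
      refine hd.congr_deriv ?_
      rw [e1, e2, Gamma_neg_nat_eq_zero, Gamma_neg_nat_eq_zero]
      simp only [Function.comp_apply, inv_zero, zero_mul, add_zero]
      rw [hN, mul_comm ((-1) ^ n * (n ! : ℂ)), mul_right_comm, mul_comm ((-1 : ℂ) ^ n), ← mul_assoc,
        ascPochhammer_eval_neg_sub]
      ring
    rw [whittakerW_eq_of_hasDerivAt (m := (k : ℤ)) (by exact_mod_cast hm) h0 hd']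
    have hcos : Complex.cos (2 * π * ν) = (-1) ^ k := by
      rw [hνk, show (2 * π * (k / 2) : ℂ) = k * π by ring]
      rw [← zero_add ((k : ℂ) * π), Complex.cos_antiperiodic.add_nat_mul_eq]
      simp
    have hG : Gamma (2 * ν + 1 + n) = (n + k)! := by
      rw [hνk, ← Complex.Gamma_nat_eq_factorial]
      congr 1
      push_cast
      ring
    rw [hcos, hG]
    have hk : ((-1 : ℂ) ^ k) ≠ 0 := pow_ne_zero _ (by norm_num)
    field_simp
    ring
  -- For `2ν ∉ ℤ` only the `N_ν` term survives, and reflection of its coefficient cancels the sine.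
  · push Not at hm
    rw [whittakerW_of_ne hm, whittakerH, e1, Gamma_neg_nat_eq_zero, inv_zero, zero_mul, zero_sub]
    have hpi : (π : ℂ) ≠ 0 := ofReal_ne_zero.2 Real.pi_ne_zero
    have hs : Complex.sin (2 * π * ν) ≠ 0 := by
      intro h0
      obtain ⟨m, hm'⟩ := Complex.sin_eq_zero_iff.1 h0
      refine hm m (mul_right_cancel₀ hpi ?_)
      rw [← hm']; ring
    have hre : 0 < (2 * ν + 1 + n : ℂ).re := by
      have : (0 : ℝ) ≤ n := n.cast_nonneg
      simp
      linarith
    have hsin : Complex.sin (π * (2 * ν + 1 + n)) = -(-1) ^ n * Complex.sin (2 * π * ν) := by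
      rw [show (π * (2 * ν + 1 + n) : ℂ) = 2 * π * ν + ((n + 1 : ℕ) : ℂ) * π by push_cast; ring,
        Complex.sin_antiperiodic.add_nat_mul_eq]
      ring
    have hinv : (Gamma (1 / 2 - ν - p : ℂ))⁻¹ =
        -(-1) ^ n * Complex.sin (2 * π * ν) / π * Gamma (2 * ν + 1 + n) := by
      rw [show (1 / 2 - ν - p : ℂ) = 1 - (2 * ν + 1 + n) by rw [hp]; ring, inv_Gamma_one_sub hre,
        hsin, mul_comm]
    have hs' : Complex.sin (π * 2 * ν) ≠ 0 := by rwa [mul_comm (π : ℂ)]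
    rw [hinv]
    field_simp

end Whittaker

/-! ### Laguerre polynomials: recurrences and weighted integrability -/

namespace Whittaker

open Complex Filter Topology Nat Set MeasureTheory
open scoped Real

/-- The generalized Laguerre polynomial `L_n^α`. -/
noncomputable def lag (n : ℕ) (α x : ℝ) : ℝ :=
  Real.Gamma (n + α + 1) / n ! * (kummerR (-n) (α + 1) x).re

/-- The derivative of `lag n α`. -/
noncomputable def lagDeriv (n : ℕ) (α x : ℝ) : ℝ :=
  Real.Gamma (n + α + 1) / n ! * (-n * kummerR (-n + 1) (α + 1 + 1) x).re

theorem ascPochhammer_eval_neg_nat_of_lt {n k : ℕ} (h : n < k) :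
    (ascPochhammer ℂ k).eval (-(n : ℂ)) = 0 := by
  induction k with
  | zero => omega
  | succ k ih =>
    rw [ascPochhammer_succ_eval]
    rcases Nat.lt_succ_iff_lt_or_eq.1 h with h | rfl
    · rw [ih h, zero_mul]
    · simp

theorem kummerR_neg_nat (n : ℕ) (b z : ℂ) :
    kummerR (-n) b z = ∑ k ∈ Finset.range (n + 1), kummerCoeff (-n) b k * z ^ k := by
  refine tsum_eq_sum fun k hk => ?_
  rw [kummerCoeff, ascPochhammer_eval_neg_nat_of_lt (by simpa using hk)]
  simp

theorem exists_lag_eq_eval (n : ℕ) (α : ℝ) : ∃ P : Polynomial ℝ, ∀ x, lag n α x = P.eval x := by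
  refine ⟨∑ k ∈ Finset.range (n + 1), Polynomial.monomial k
    (Real.Gamma (n + α + 1) / n ! * (kummerCoeff (-n) (α + 1) k).re), fun x => ?_⟩
  rw [lag, kummerR_neg_nat, Polynomial.eval_finsetSum, re_sum, Finset.mul_sum]
  refine Finset.sum_congr rfl fun k _ => ?_
  rw [Polynomial.eval_monomial, ← ofReal_pow, re_mul_ofReal]
  ring

theorem kummerCoeff_neg_nat_im (n : ℕ) (α : ℝ) (k : ℕ) :
    (kummerCoeff (-n) (α + 1) k).im = 0 := by
  have h1 : ∃ r : ℝ, (ascPochhammer ℂ k).eval (-(n : ℂ)) = r := by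
    induction k with
    | zero => exact ⟨1, by simp⟩
    | succ k ih =>
      obtain ⟨r, hr⟩ := ih
      exact ⟨r * (-n + k), by rw [ascPochhammer_succ_eval, hr]; push_cast; ring⟩
  obtain ⟨r, hr⟩ := h1
  have : kummerCoeff (-n) (α + 1) k = ((r * (Real.Gamma (α + 1 + k))⁻¹ / k ! : ℝ) : ℂ) := by
    rw [kummerCoeff, hr]
    push_cast [← Complex.Gamma_ofReal]
    ring
  rw [this, ofReal_im]

theorem norm_kummerR_neg_nat (n : ℕ) (α x : ℝ) :
    ‖kummerR (-n) (α + 1) x‖ = |(kummerR (-n) (α + 1) x).re| := by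
  have : (kummerR (-n) (α + 1) x).im = 0 := by
    rw [kummerR_neg_nat, im_sum]
    refine Finset.sum_eq_zero fun k _ => ?_
    rw [← ofReal_pow, im_mul_ofReal, kummerCoeff_neg_nat_im, zero_mul]
  conv_lhs => rw [← re_add_im (kummerR (-n) (α + 1) x), this]
  simp

theorem hasDerivAt_lag (n : ℕ) (α x : ℝ) : HasDerivAt (lag n α) (lagDeriv n α x) x :=
  (hasDerivAt_kummerR (-n) (α + 1) x).real_of_complex.const_mul _

theorem continuous_lag (n : ℕ) (α : ℝ) : Continuous (lag n α) :=
  continuous_iff_continuousAt.2 fun x => (hasDerivAt_lag n α x).continuousAt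

theorem lag_zero {α : ℝ} (hα : -1 < α) (x : ℝ) : lag 0 α x = 1 := by
  have h : 0 < Real.Gamma (α + 1) := Real.Gamma_pos_of_pos (by linarith)
  rw [lag, kummerR_neg_nat]
  rw [show (α : ℂ) + 1 = ((α + 1 : ℝ) : ℂ) by push_cast; rfl]
  simp only [kummerCoeff, zero_add, Finset.range_one, Finset.sum_singleton, ascPochhammer_zero,
    Polynomial.eval_one, Nat.cast_zero, add_zero, Nat.factorial_zero, Nat.cast_one, div_one,
    one_mul, pow_zero, mul_one, Complex.Gamma_ofReal]
  rw [← ofReal_inv, ofReal_re, mul_inv_cancel₀ h.ne']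

theorem lagDeriv_zero (α x : ℝ) : lagDeriv 0 α x = 0 := by simp [lagDeriv]

theorem lagDeriv_succ (n : ℕ) (α x : ℝ) : lagDeriv (n + 1) α x = -lag n (α + 1) x := by
  have e1 : -((n + 1 : ℕ) : ℂ) + 1 = -n := by push_cast; ring
  have e2 : -((n + 1 : ℕ) : ℂ) = ((-(n + 1) : ℝ) : ℂ) := by push_cast; ring
  rw [lagDeriv, lag, e1, e2, re_ofReal_mul, Nat.factorial_succ]
  push_cast
  rw [show (n : ℝ) + 1 + α + 1 = n + (α + 1) + 1 by ring]
  have : (n : ℝ) + 1 ≠ 0 := by positivity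
  have : (n ! : ℝ) ≠ 0 := by positivity
  field_simp

theorem succ_mul_lag_succ (n : ℕ) (α x : ℝ) :
    (n + 1) * lag (n + 1) α x = (α + 1 - x) * lag n (α + 1) x + x * lagDeriv n (α + 1) x := by
  have h := kummerR_lower (-((n + 1 : ℕ) : ℂ)) (α + 1) x
  have e1 : -((n + 1 : ℕ) : ℂ) + 1 = -n := by push_cast; ring
  rw [e1] at h
  have h' := congrArg Complex.re h
  rw [show (α : ℂ) + 1 = ((α + 1 : ℝ) : ℂ) by push_cast; rfl] at h'
  rw [add_re, re_ofReal_mul, re_ofReal_mul, sub_re] at h'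
  rw [lag, lag, lagDeriv, Nat.factorial_succ]
  push_cast at h' ⊢
  rw [show (n : ℝ) + 1 + α + 1 = n + (α + 1) + 1 by ring, h']
  have : (n : ℝ) + 1 ≠ 0 := by positivity
  have : (n ! : ℝ) ≠ 0 := by positivity
  field_simp
  ring

/-- This is the contiguous relation for Kummer's function; iterated, it expands `L_n^α` in the
polynomials `L_k^{α-1}`. -/
theorem lag_succ_eq (n : ℕ) {α : ℝ} (hα : 0 < α) (x : ℝ) :
    lag (n + 1) α x = lag n α x + lag (n + 1) (α - 1) x := by
  have h := kummerR_contiguous (-((n + 1 : ℕ) : ℂ)) α x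
  have e1 : -((n + 1 : ℕ) : ℂ) + 1 = -n := by push_cast; ring
  rw [e1] at h
  have h' := congrArg Complex.re h
  rw [show (α : ℂ) - -((n + 1 : ℕ) : ℂ) = ((α + n + 1 : ℝ) : ℂ) by push_cast; ring,
    show -((n + 1 : ℕ) : ℂ) = ((-(n + 1) : ℝ) : ℂ) by push_cast; ring, sub_re, re_ofReal_mul,
    re_ofReal_mul] at h'
  rw [lag, lag, lag, Nat.factorial_succ]
  have hn : (0 : ℝ) ≤ n := n.cast_nonneg
  have hG : Real.Gamma (n + 1 + α + 1) = (n + 1 + α) * Real.Gamma (n + 1 + α) :=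
    Real.Gamma_add_one (by positivity)
  push_cast at h' ⊢
  rw [show (n : ℝ) + 1 + (α - 1) + 1 = n + 1 + α by ring, show (n : ℝ) + α + 1 = n + 1 + α by ring,
    hG, show (α : ℂ) - 1 + 1 = α by ring]
  have : (n : ℝ) + 1 ≠ 0 := by positivity
  have : (n ! : ℝ) ≠ 0 := by positivity
  generalize (kummerR (-(n + 1)) (α + 1) x).re = A at *
  generalize (kummerR (-n) (α + 1) x).re = B at *
  generalize (kummerR (-(n + 1)) α x).re = D at *
  field_simp
  linear_combination h'

theorem lag_eq_sum (n : ℕ) {α : ℝ} (hα : 0 < α) (x : ℝ) :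
    lag n α x = ∑ k ∈ Finset.range (n + 1), lag k (α - 1) x := by
  induction n with
  | zero => simp [lag_zero (show -1 < α by linarith), lag_zero (show -1 < α - 1 by linarith)]
  | succ n ih => rw [lag_succ_eq n hα, Finset.sum_range_succ, ih]

theorem integrableOn_laguerre_weight {s : ℝ} (hs : -1 < s) (P : Polynomial ℝ) :
    IntegrableOn (fun x : ℝ => x ^ s * Real.exp (-x) * P.eval x) (Ioi 0) := by
  induction P using Polynomial.induction_on' with
  | add p q hp hq =>
    refine (hp.add hq).congr (.of_forall fun x => ?_)
    simp only [Polynomial.eval_add, Pi.add_apply]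
    ring
  | monomial k a =>
    have h := (Real.GammaIntegral_convergent (s := s + k + 1)
      (by have : (0 : ℝ) ≤ k := k.cast_nonneg
          linarith)).mul_const a
    refine IntegrableOn.congr_fun h (fun x hx => ?_) measurableSet_Ioi
    rw [Polynomial.eval_monomial, show s + k + 1 - 1 = s + k by ring, Real.rpow_add hx,
      Real.rpow_natCast]
    ring

theorem tendsto_laguerre_weight (s : ℝ) (P : Polynomial ℝ) :
    Tendsto (fun x : ℝ => x ^ s * Real.exp (-x) * P.eval x) atTop (𝓝 0) := by
  induction P using Polynomial.induction_on' with
  | add p q hp hq =>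
    have := hp.add hq
    rw [add_zero] at this
    refine this.congr fun x => ?_
    simp only [Polynomial.eval_add]
    ring
  | monomial k a =>
    have h := (tendsto_rpow_mul_exp_neg_mul_atTop_nhds_zero (s + k) 1 one_pos).mul_const a
    rw [zero_mul] at h
    refine h.congr' ?_
    filter_upwards [eventually_gt_atTop 0] with x hx
    rw [Polynomial.eval_monomial, Real.rpow_add hx, Real.rpow_natCast, neg_one_mul]
    ring

end Whittaker

/-! ### Laguerre norms and a pointwise bound -/

namespace Whittaker

open Complex Filter Topology Nat Set MeasureTheory
open scoped Real

theorem integrableOn_lag_sq {s : ℝ} (hs : -1 < s) (n : ℕ) (α : ℝ) :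
    IntegrableOn (fun x : ℝ => x ^ s * Real.exp (-x) * lag n α x ^ 2) (Ioi 0) := by
  obtain ⟨P, hP⟩ := exists_lag_eq_eval n α
  refine (integrableOn_laguerre_weight hs (P ^ 2)).congr (.of_forall fun x => ?_)
  simp only [Polynomial.eval_pow, hP]

theorem hasDerivAt_laguerre_weight (s : ℝ) {x : ℝ} (hx : 0 < x) :
    HasDerivAt (fun x : ℝ => x ^ (s + 1) * Real.exp (-x))
      (x ^ s * Real.exp (-x) * (s + 1 - x)) x := by
  have h1 := Real.hasDerivAt_rpow_const (p := s + 1) (Or.inl hx.ne')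
  have h2 : HasDerivAt (fun x : ℝ => Real.exp (-x)) (Real.exp (-x) * -1) x :=
    (hasDerivAt_neg x).exp
  refine (h1.mul h2).congr_deriv ?_
  rw [add_sub_cancel_right, Real.rpow_add_one hx.ne']
  ring

theorem continuous_laguerre_weight {s : ℝ} (hs : 0 ≤ s) :
    Continuous fun x : ℝ => x ^ s * Real.exp (-x) :=
  (Real.continuous_rpow_const hs).mul (Real.continuous_exp.comp continuous_neg)

/-- The difference of the integrands is the derivative of `x^{α+1} e^{-x} L_n^{α+1} L_{n+1}^α`,
which vanishes at both ends. This lowers `n` while raising `α`, so the norms follow by induction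
from `L_0 = 1`. -/
theorem integral_lag_sq_succ (n : ℕ) {α : ℝ} (hα : -1 < α) :
    (n + 1) * ∫ x in Ioi (0 : ℝ), x ^ α * Real.exp (-x) * lag (n + 1) α x ^ 2 =
      ∫ x in Ioi (0 : ℝ), x ^ (α + 1) * Real.exp (-x) * lag n (α + 1) x ^ 2 := by
  set F : ℝ → ℝ := fun x => x ^ (α + 1) * Real.exp (-x) * (lag n (α + 1) x * lag (n + 1) α x)
    with hF
  have hi1 := integrableOn_lag_sq hα (n + 1) α
  have hi2 := integrableOn_lag_sq (s := α + 1) (by linarith) n (α + 1)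
  have hd : ∀ x ∈ Ioi (0 : ℝ), HasDerivAt F ((n + 1) *
      (x ^ α * Real.exp (-x) * lag (n + 1) α x ^ 2) -
        x ^ (α + 1) * Real.exp (-x) * lag n (α + 1) x ^ 2) x := by
    intro x hx
    have hx : 0 < x := hx
    have h := (hasDerivAt_laguerre_weight α hx).mul
      ((hasDerivAt_lag n (α + 1) x).mul (hasDerivAt_lag (n + 1) α x))
    refine h.congr_deriv ?_
    rw [lagDeriv_succ, Real.rpow_add_one hx.ne', Pi.mul_apply]
    linear_combination (-x ^ α * Real.exp (-x) * lag (n + 1) α x) * succ_mul_lag_succ n α x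
  have hc : Continuous F := (continuous_laguerre_weight (by linarith)).mul
    ((continuous_lag _ _).mul (continuous_lag _ _))
  have hlim : Tendsto F atTop (𝓝 0) := by
    obtain ⟨P, hP⟩ := exists_lag_eq_eval n (α + 1)
    obtain ⟨Q, hQ⟩ := exists_lag_eq_eval (n + 1) α
    refine (tendsto_laguerre_weight (α + 1) (P * Q)).congr fun x => ?_
    rw [Polynomial.eval_mul, ← hP, ← hQ]
  have h := integral_Ioi_of_hasDerivAt_of_tendsto (hc.continuousWithinAt) hd
    ((hi1.const_mul _).sub hi2) hlim
  rw [integral_sub (hi1.const_mul _) hi2, integral_const_mul] at h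
  have h0 : F 0 = 0 := by simp [hF, Real.zero_rpow (show α + 1 ≠ 0 by linarith)]
  rw [h0] at h
  linarith

theorem integral_lag_sq (n : ℕ) {α : ℝ} (hα : -1 < α) :
    ∫ x in Ioi (0 : ℝ), x ^ α * Real.exp (-x) * lag n α x ^ 2 = Real.Gamma (n + α + 1) / n ! := by
  induction n generalizing α with
  | zero =>
    simp only [lag_zero hα]
    rw [Real.Gamma_eq_integral (by simp; linarith)]
    simp [mul_comm]
  | succ n ih =>
    have h := integral_lag_sq_succ n hα
    rw [ih (by linarith)] at h
    have hn : (n : ℝ) + 1 ≠ 0 := by positivity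
    rw [Nat.factorial_succ]
    push_cast
    rw [show (n : ℝ) + 1 + α + 1 = n + (α + 1) + 1 by ring]
    rw [← div_div, div_right_comm, ← h, mul_div_cancel_left₀ _ hn]

theorem integrableOn_lagDeriv_sq (n : ℕ) {α : ℝ} (hα : -1 < α) :
    IntegrableOn (fun x : ℝ => x ^ (α + 1) * Real.exp (-x) * lagDeriv n α x ^ 2) (Ioi 0) := by
  cases n with
  | zero => simp [lagDeriv_zero]
  | succ n =>
    simp only [lagDeriv_succ, neg_sq]
    exact integrableOn_lag_sq (by linarith) n (α + 1)

theorem integral_lagDeriv_sq (n : ℕ) {α : ℝ} (hα : -1 < α) :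
    ∫ x in Ioi (0 : ℝ), x ^ (α + 1) * Real.exp (-x) * lagDeriv n α x ^ 2 =
      n * (Real.Gamma (n + α + 1) / n !) := by
  cases n with
  | zero => simp [lagDeriv_zero]
  | succ n =>
    simp only [lagDeriv_succ, neg_sq]
    rw [← integral_lag_sq_succ n hα, integral_lag_sq _ hα]
    push_cast
    rfl

theorem Gamma_div_factorial_le {α : ℝ} (hα : 1 ≤ α) {k n : ℕ} (hkn : k ≤ n) :
    Real.Gamma (k + α) / k ! ≤ Real.Gamma (n + α) / n ! := by
  induction n, hkn using Nat.le_induction with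
  | base => exact le_rfl
  | succ n _ ih =>
    refine ih.trans ?_
    have hn : (0 : ℝ) ≤ n := n.cast_nonneg
    have hG : 0 < Real.Gamma (n + α) := Real.Gamma_pos_of_pos (by positivity)
    have h1 : Real.Gamma (((n + 1 : ℕ) : ℝ) + α) = (n + α) * Real.Gamma (n + α) := by
      rw [← Real.Gamma_add_one (by positivity)]; push_cast; ring_nf
    rw [h1, Nat.factorial_succ]
    push_cast
    rw [mul_div_mul_comm]
    refine le_mul_of_one_le_left (by positivity) ?_
    rw [one_le_div (by positivity)]
    linarith

/-- The weight is one power below the natural one for `L_n^α`, but natural for the `L_k^{α-1}` in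
its expansion. Cauchy–Schwarz costs `n + 1`; for `α ≥ 1` the norms increase with `k`, and summing
them costs another `n + 1`. -/
theorem integral_lag_sq_le (n : ℕ) {α : ℝ} (hα : 1 ≤ α) :
    ∫ x in Ioi (0 : ℝ), x ^ (α - 1) * Real.exp (-x) * lag n α x ^ 2 ≤
      (n + 1) ^ 2 * (Real.Gamma (n + α + 1) / n !) := by
  have hα' : -1 < α - 1 := by linarith
  have hn : (0 : ℝ) ≤ n := n.cast_nonneg
  have hi : ∀ k ∈ Finset.range (n + 1), Integrable
      (fun x : ℝ => x ^ (α - 1) * Real.exp (-x) * lag k (α - 1) x ^ 2) (volume.restrict (Ioi 0)) :=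
    fun k _ => integrableOn_lag_sq hα' k (α - 1)
  calc _ ≤ ∫ x in Ioi (0 : ℝ), (n + 1) * ∑ k ∈ Finset.range (n + 1),
        x ^ (α - 1) * Real.exp (-x) * lag k (α - 1) x ^ 2 := by
        refine setIntegral_mono_on (integrableOn_lag_sq hα' n α)
          ((integrable_finsetSum _ hi).const_mul _) measurableSet_Ioi fun x hx => ?_
        have hx : 0 < x := hx
        rw [← Finset.mul_sum, mul_left_comm, lag_eq_sum n (by linarith)]
        refine mul_le_mul_of_nonneg_left ?_ (by positivity)
        simpa using sq_sum_le_card_mul_sum_sq (s := Finset.range (n + 1))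
          (f := fun k => lag k (α - 1) x)
    _ = (n + 1) * ∑ k ∈ Finset.range (n + 1), Real.Gamma (k + α) / k ! := by
        rw [integral_const_mul, integral_finsetSum _ hi]
        congr 1
        refine Finset.sum_congr rfl fun k _ => ?_
        rw [integral_lag_sq k hα']
        congr 2
        ring
    _ ≤ (n + 1) * ∑ k ∈ Finset.range (n + 1), Real.Gamma (n + α) / n ! := by
        refine mul_le_mul_of_nonneg_left (Finset.sum_le_sum fun k hk => ?_) (by positivity)
        exact Gamma_div_factorial_le hα (by simpa [Nat.lt_succ_iff] using hk)
    _ = (n + 1) ^ 2 * (Real.Gamma (n + α) / n !) := by simp; ring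
    _ ≤ _ := by
        have hG : 0 < Real.Gamma (n + α) := Real.Gamma_pos_of_pos (by positivity)
        rw [Real.Gamma_add_one (by positivity)]
        gcongr
        exact le_mul_of_one_le_left hG.le (by linarith)

/-- A one-dimensional Sobolev argument: the left side vanishes at `0`, and its derivative is at most
a nonnegative function whose integral over the half-line is controlled by the Laguerre norms. -/
theorem weight_mul_lag_sq_le (n : ℕ) {α y : ℝ} (hα : 1 ≤ α) (hy : 0 < y) :
    y ^ α * Real.exp (-y) * lag n α y ^ 2 ≤
      (α + 2) * (n + 1) ^ 2 * (Real.Gamma (n + α + 1) / n !) := by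
  have hα' : -1 < α - 1 := by linarith
  have hn : (0 : ℝ) ≤ n := n.cast_nonneg
  have hG : 0 < Real.Gamma (n + α + 1) := Real.Gamma_pos_of_pos (by positivity)
  set w : ℝ → ℝ := fun x => α * (x ^ (α - 1) * Real.exp (-x) * lag n α x ^ 2) +
    (x ^ (α - 1) * Real.exp (-x) * lag n α x ^ 2 +
      x ^ (α + 1) * Real.exp (-x) * lagDeriv n α x ^ 2) with hw
  set g : ℝ → ℝ := fun x => x ^ α * Real.exp (-x) * lag n α x ^ 2 with hg
  have hi1 := integrableOn_lag_sq hα' n α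
  have hi2 := integrableOn_lagDeriv_sq n (α := α) (by linarith)
  have hwi : IntegrableOn w (Ioi 0) := (hi1.const_mul α).add (hi1.add hi2)
  have hcont : Continuous g :=
    (continuous_laguerre_weight (by linarith)).mul ((continuous_lag n α).pow 2)
  have hd : ∀ x ∈ Ioo 0 y, HasDerivWithinAt g (x ^ (α - 1) * Real.exp (-x) *
      (α - x) * lag n α x ^ 2 + x ^ α * Real.exp (-x) * (2 * lag n α x * lagDeriv n α x))
      (Ioi x) x := by
    intro x hx
    have h := hasDerivAt_laguerre_weight (α - 1) hx.1
    simp only [sub_add_cancel] at h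
    refine ((h.mul ((hasDerivAt_lag n α x).pow 2)).congr_deriv ?_).hasDerivWithinAt
    simp
  have hwi' : IntegrableOn w (Icc 0 y) :=
    (integrableOn_Icc_iff_integrableOn_Ioc (by simp)).2 (hwi.mono_set Ioc_subset_Ioi_self)
  have hle := intervalIntegral.sub_le_integral_of_hasDeriv_right_of_le hy.le hcont.continuousOn hd
    hwi' fun x hx => by
      have hx0 : 0 < x := hx.1
      have e1 : x ^ α = x ^ (α - 1) * x := by
        rw [← Real.rpow_add_one hx0.ne', sub_add_cancel]
      have e2 : x ^ (α + 1) = x ^ (α - 1) * x * x := by rw [Real.rpow_add_one hx0.ne', e1]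
      simp only [hw]
      rw [e1, e2]
      have hw : 0 ≤ x ^ (α - 1) * Real.exp (-x) := by positivity
      -- This is `w` minus the derivative: the dropped term `-x L²`, together with the square from
      -- `2xLL' ≤ L² + x²L'²`.
      have h1 : 0 ≤ x ^ (α - 1) * Real.exp (-x) *
          (x * lag n α x ^ 2 + (lag n α x - x * lagDeriv n α x) ^ 2) := by positivity
      linarith
  have h0 : g 0 = 0 := by simp [hg, Real.zero_rpow (show α ≠ 0 by linarith)]
  rw [h0, sub_zero, intervalIntegral.integral_of_le hy.le] at hle
  have hle2 : ∫ x in Ioc 0 y, w x ≤ ∫ x in Ioi 0, w x := by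
    refine setIntegral_mono_set hwi ?_ (Ioc_subset_Ioi_self.eventuallyLE)
    filter_upwards [ae_restrict_mem measurableSet_Ioi] with x hx
    have hx : 0 < x := hx
    simp only [hw, Pi.zero_apply]
    positivity
  have hval : ∫ x in Ioi 0, w x = α * (∫ x in Ioi 0, x ^ (α - 1) * Real.exp (-x) * lag n α x ^ 2) +
      ((∫ x in Ioi 0, x ^ (α - 1) * Real.exp (-x) * lag n α x ^ 2) +
        n * (Real.Gamma (n + α + 1) / n !)) := by
    refine (integral_add (hi1.const_mul α) (hi1.add hi2)).trans ?_
    rw [integral_const_mul]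
    congr 1
    rw [← integral_lagDeriv_sq n (show -1 < α by linarith)]
    exact integral_add hi1 hi2
  have hJ := integral_lag_sq_le n hα
  have hG' : 0 ≤ Real.Gamma (n + α + 1) / n ! := by positivity
  generalize ∫ x in Ioi (0 : ℝ), x ^ (α - 1) * Real.exp (-x) * lag n α x ^ 2 = J at *
  generalize Real.Gamma (n + α + 1) / n ! = G at *
  have h1 : (α + 1) * J ≤ (α + 1) * ((n + 1) ^ 2 * G) :=
    mul_le_mul_of_nonneg_left hJ (by linarith)
  have h2 : n * G ≤ (n + 1) ^ 2 * G := mul_le_mul_of_nonneg_right (by nlinarith) hG'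
  calc _ ≤ _ := hle
    _ ≤ _ := hle2
    _ = (α + 1) * J + n * G := by rw [hval]; ring
    _ ≤ _ := by linarith

end Whittaker

/-! ### Discrete series estimates -/

namespace Whittaker

open Complex Filter Topology Nat Set
open scoped Real

theorem norm_whittakerN_eq {p ν y : ℝ} {n : ℕ} (h : p - ν - 1 / 2 = n) (hy : 0 < y) :
    ‖whittakerN p ν y‖ =
      y ^ (ν + 1 / 2) * Real.exp (-y / 2) * |(kummerR (-n) ((2 * ν : ℝ) + 1) y).re| := by
  have e1 : (1 / 2 + ν - p : ℂ) = -n := by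
    rw [show p = ν + 1 / 2 + n by linarith]; push_cast; ring
  have e2 : (ν : ℂ) + 1 / 2 = ((ν + 1 / 2 : ℝ) : ℂ) := by push_cast; ring
  have e3 : -(y : ℂ) / 2 = ((-y / 2 : ℝ) : ℂ) := by push_cast; ring
  rw [← norm_kummerR_neg_nat, whittakerN, e1, e2, e3, norm_mul, norm_mul,
    norm_cpow_eq_rpow_re_of_pos hy, ofReal_re, norm_exp, ofReal_re]
  congr 3
  push_cast
  ring

theorem norm_whittakerW_discrete {p ν y : ℝ} {n : ℕ} (h : p - ν - 1 / 2 = n) (hν : -(1 / 2) < ν)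
    (hy : 0 < y) :
    ‖whittakerW p ν y‖ = Real.Gamma (n + 2 * ν + 1) * ‖whittakerN p ν y‖ := by
  have hG : 0 < Real.Gamma (n + 2 * ν + 1) :=
    Real.Gamma_pos_of_pos (by have : (0 : ℝ) ≤ n := n.cast_nonneg
                              linarith)
  rw [whittakerW_discrete h hν hy, norm_mul, norm_mul, norm_pow, norm_neg, norm_one, one_pow,
    one_mul, show (2 * ν + 1 + n : ℂ) = ((n + 2 * ν + 1 : ℝ) : ℂ) by push_cast; ring,
    Complex.Gamma_ofReal, Complex.norm_of_nonneg hG.le]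

theorem norm_whittakerW_le_of_half_le {p ν y : ℝ} {n : ℕ} (h : p - ν - 1 / 2 = n)
    (hν : 1 / 2 ≤ ν) (hy : 0 < y) :
    ‖whittakerW p ν y‖ ≤
      (2 * ν + 2) * (n + 1) * y ^ (1 / 2 : ℝ) * √(n ! * Real.Gamma (n + 2 * ν + 1)) := by
  have hn : (0 : ℝ) ≤ n := n.cast_nonneg
  have hG : 0 < Real.Gamma (n + 2 * ν + 1) := Real.Gamma_pos_of_pos (by linarith)
  have hf : (0 : ℝ) < n ! := by positivity
  have key := weight_mul_lag_sq_le n (α := 2 * ν) (by linarith) hy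
  refine le_of_sq_le_sq ?_ (by positivity)
  -- With `α = 2ν` the Gamma factor of `W` matches the Laguerre normalization, and `y^{2ν+1}` leaves
  -- one spare factor `y`, the source of `y^{1/2}`.
  have e1 : ‖whittakerW p ν y‖ ^ 2 =
      n ! ^ 2 * y * (y ^ (2 * ν) * Real.exp (-y) * lag n (2 * ν) y ^ 2) := by
    have e2 : (y ^ (ν + 1 / 2)) ^ 2 = y * y ^ (2 * ν) := by
      rw [← Real.rpow_natCast, ← Real.rpow_mul hy.le, mul_comm y, ← Real.rpow_add_one hy.ne']
      congr 1; push_cast; ring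
    have e3 : Real.exp (-y / 2) ^ 2 = Real.exp (-y) := by
      rw [← Real.exp_nat_mul]; congr 1; push_cast; ring
    rw [norm_whittakerW_discrete h (by linarith) hy, norm_whittakerN_eq h hy, mul_pow, mul_pow,
      mul_pow, sq_abs, e2, e3, lag]
    field_simp
  have e4 : (y ^ (1 / 2 : ℝ)) ^ 2 = y := by
    rw [← Real.rpow_natCast, ← Real.rpow_mul hy.le]; norm_num
  rw [e1, mul_pow, mul_pow, mul_pow, Real.sq_sqrt (by positivity), e4]
  calc _ ≤ n ! ^ 2 * y * ((2 * ν + 2) * (n + 1) ^ 2 * (Real.Gamma (n + 2 * ν + 1) / n !)) := by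
        gcongr
    _ = (2 * ν + 2) * ((n + 1) ^ 2 * y * (n ! * Real.Gamma (n + 2 * ν + 1))) := by
        field_simp
    _ ≤ (2 * ν + 2) ^ 2 * ((n + 1) ^ 2 * y * (n ! * Real.Gamma (n + 2 * ν + 1))) := by
        gcongr
        nlinarith
    _ = _ := by ring

theorem Gamma_le_sq_mul_factorial {n : ℕ} {α : ℝ} (hn : 1 ≤ n) (hα : -1 < α) (hα' : α ≤ 1) :
    Real.Gamma (n + α + 1) ≤ (n + 2) ^ 2 * n ! := by
  have hn' : (1 : ℝ) ≤ n := by exact_mod_cast hn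
  have hG : 0 < Real.Gamma (n + α + 1) := Real.Gamma_pos_of_pos (by linarith)
  calc Real.Gamma (n + α + 1) ≤ (n + α + 1) * Real.Gamma (n + α + 1) :=
        le_mul_of_one_le_left hG.le (by linarith)
    _ = Real.Gamma (n + α + 1 + 1) := (Real.Gamma_add_one (by linarith)).symm
    _ ≤ Real.Gamma (n + 2 + 1) := by
        refine Real.Gamma_strictMonoOn_Ici.monotoneOn ?_ ?_ (by linarith) <;>
          simp only [mem_Ici] <;> linarith
    _ = (n + 2) * (n + 1) * n ! := by
        rw [show (n : ℝ) + 2 + 1 = ((n + 2 : ℕ) : ℝ) + 1 by push_cast; ring,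
          Real.Gamma_nat_eq_factorial, Nat.factorial_succ, Nat.factorial_succ]
        push_cast
        ring
    _ ≤ _ := by
        gcongr
        nlinarith

theorem exists_norm_whittakerW_le_of_lt_half : ∃ C : ℝ, 0 < C ∧ ∀ (p ν y : ℝ) (n : ℕ),
    p - ν - 1 / 2 = n → -(1 / 2) < ν → ν < 1 / 2 → 0 < y → y < 1 →
      ‖whittakerW p ν y‖ / √(n ! * Real.Gamma (n + 2 * ν + 1)) ≤
        C * (|p| + 2) ^ 6 * y ^ (ν + 1 / 2) := by
  obtain ⟨C₁, hC₁0, hC₁⟩ := exists_norm_inv_Gamma_le 2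
  obtain ⟨C₂, hC₂0, hC₂⟩ := exists_norm_kummerR_le 2
  refine ⟨(C₁ + 1) + 40 * (C₂ * Real.exp 3), by positivity, ?_⟩
  intro p ν y n h hν hν' hy hy1
  have hn : (0 : ℝ) ≤ n := n.cast_nonneg
  have hp0 := abs_nonneg p
  have hf : (0 : ℝ) < n ! := by positivity
  have hG : 0 < Real.Gamma (n + 2 * ν + 1) := Real.Gamma_pos_of_pos (by linarith)
  have hD : 0 < √(n ! * Real.Gamma (n + 2 * ν + 1)) := by positivity
  have hT6 : 1 ≤ (|p| + 2) ^ 6 := one_le_pow₀ (by linarith)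
  -- For `n = 0` the ratio `κ` would involve `Γ(2ν + 1)`, unbounded as `ν → -1/2`. There `|W| =
  -- y^{ν+1/2} e^{-y/2}` exactly, and the normalization only contributes `Γ(2ν + 1)^{-1/2}`, which
  -- is bounded.
  rcases Nat.eq_zero_or_pos n with rfl | hn1
  · have e1 : ‖whittakerW p ν y‖ ≤ y ^ (ν + 1 / 2) := by
      have hl := lag_zero (α := 2 * ν) (by linarith) y
      rw [lag] at hl
      have hab : Real.Gamma ((0 : ℕ) + 2 * ν + 1) *
          |(kummerR (-(0 : ℕ)) ((2 * ν : ℝ) + 1) y).re| = 1 := by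
        conv_lhs => rw [← abs_of_pos hG, ← abs_mul]
        rw [Nat.factorial_zero, Nat.cast_one, div_one] at hl
        rw [hl, abs_one]
      rw [norm_whittakerW_discrete h hν hy, norm_whittakerN_eq h hy, mul_left_comm, hab, mul_one]
      refine mul_le_of_le_one_right (by positivity) (Real.exp_le_one_iff.2 (by linarith))
    have e2 : (√(0 ! * Real.Gamma ((0 : ℕ) + 2 * ν + 1)))⁻¹ ≤ C₁ + 1 := by
      have h1 := hC₁ ((2 * ν + 1 : ℝ) : ℂ) (by
        rw [norm_real, Real.norm_eq_abs, abs_le]; constructor <;> linarith)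
      rw [Complex.Gamma_ofReal, ← ofReal_inv, norm_real, Real.norm_eq_abs] at h1
      have h2 := (le_abs_self _).trans h1
      rw [← Real.sqrt_inv]
      refine Real.sqrt_le_iff.2 ⟨by positivity, ?_⟩
      simp only [Nat.factorial_zero, Nat.cast_one, one_mul, Nat.cast_zero, zero_add]
      nlinarith
    rw [div_eq_mul_inv, mul_comm]
    refine mul_le_mul (e2.trans ?_) e1 (norm_nonneg _) (by positivity)
    have : 0 < 40 * (C₂ * Real.exp 3) := by positivity
    nlinarith
  · set κ : ℝ := Real.Gamma (n + 2 * ν + 1) / √(n ! * Real.Gamma (n + 2 * ν + 1)) with hκ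
    have hκ0 : 0 ≤ κ := by positivity
    have hnp : (n : ℝ) ≤ |p| := by linarith [le_abs_self p]
    have hκT : κ ≤ |p| + 2 := by
      refine le_of_sq_le_sq ?_ (by linarith)
      have hb := Gamma_le_sq_mul_factorial hn1 (α := 2 * ν) (by linarith) (by linarith)
      rw [hκ, div_pow, Real.sq_sqrt (by positivity), div_le_iff₀ (by positivity)]
      have h1 : Real.Gamma (n + 2 * ν + 1) ≤ (|p| + 2) ^ 2 * n ! := hb.trans (by gcongr)
      nlinarith
    set T : ℝ := |p| + 2 with hT
    have hT1 : 1 ≤ T := by linarith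
    have hW := (isWhittaker_whittakerN p ν).const_mul κ
    have hmain := norm_le_rpow_of_initial (p := p) (c := 1 / 4 - ν ^ 2) (T := T)
      (M := T * (C₂ * Real.exp 3)) (e := ν + 1 / 2) hT1 (by linarith) (by nlinarith) (by nlinarith)
      (by positivity) (by linarith) (by linarith) hW.1 (fun y hy => ?_) (fun y hy hyT => ?_)
      (fun hp => ?_) hy hy1.le
    · have e : ‖whittakerW p ν y‖ / √(n ! * Real.Gamma (n + 2 * ν + 1)) =
          ‖(κ : ℂ) * whittakerN p ν y‖ := by
        rw [norm_whittakerW_discrete h hν hy, norm_mul, Complex.norm_of_nonneg hκ0, hκ]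
        ring
      rw [e]
      refine hmain.trans ?_
      have : 0 ≤ (C₁ + 1) * T ^ 6 := by positivity
      refine mul_le_mul_of_nonneg_right ?_ (by positivity)
      calc _ = 40 * (C₂ * Real.exp 3) * T ^ 6 := by ring
        _ ≤ _ := by linarith
    · refine (hW.2 y hy).congr_deriv ?_
      push_cast
      ring
    · have hk : ‖kummerR (-n) ((2 * ν : ℝ) + 1) y‖ ≤ C₂ * Real.exp 3 := by
        refine (hC₂ _ ?_ _ T hT1 ?_ y).trans ?_
        · rw [← ofReal_one, ← ofReal_add, norm_real, Real.norm_eq_abs, abs_le]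
          constructor <;> linarith
        · rw [norm_neg, Complex.norm_natCast]; linarith
        · rw [Complex.norm_of_nonneg hy.le]
          gcongr
          rw [le_div_iff₀ (by linarith)] at hyT
          linarith
      rw [norm_mul, Complex.norm_of_nonneg hκ0, norm_whittakerN_eq h hy, ← norm_kummerR_neg_nat]
      have h1 : Real.exp (-y / 2) ≤ 1 := Real.exp_le_one_iff.2 (by linarith)
      have hyp : 0 ≤ y ^ (ν + 1 / 2) := by positivity
      calc _ ≤ T * (y ^ (ν + 1 / 2) * 1 * (C₂ * Real.exp 3)) := by
            refine mul_le_mul hκT (mul_le_mul (mul_le_mul_of_nonneg_left h1 hyp) hk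
              (norm_nonneg _) (by positivity)) (by positivity) (by positivity)
        _ = _ := by ring
    -- Here `p = ν + 1/2 + n > 0`, so the decay hypothesis is vacuous.
    · linarith [le_abs_self p]

theorem exists_discrete_bound : ∃ C : ℝ, 0 < C ∧ ∀ ε : ℝ, 0 < ε → ∀ (p ν y : ℝ) (n : ℕ),
    p - ν - 1 / 2 = n → -(1 / 2) < ν → 0 < y → y < 1 →
      ‖whittakerW p ν y‖ / √|Real.Gamma (1 / 2 + p - ν) * Real.Gamma (1 / 2 + p + ν)| ≤
        C * (|p| + |ν| + 1) ^ 6 * y ^ (1 / 2 + min ν 0 - ε) := by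
  obtain ⟨C, hC0, hC⟩ := exists_norm_whittakerW_le_of_lt_half
  refine ⟨2 + C * 2 ^ 6, by positivity, ?_⟩
  intro ε hε p ν y n h hν hy hy1
  have hn : (0 : ℝ) ≤ n := n.cast_nonneg
  have hG : 0 < Real.Gamma (n + 2 * ν + 1) := Real.Gamma_pos_of_pos (by linarith)
  have hf : (0 : ℝ) < n ! := by positivity
  have hp0 := abs_nonneg p
  have hν0 := abs_nonneg ν
  have hS1 : 1 ≤ |p| + |ν| + 1 := by linarith
  rw [show 1 / 2 + p - ν = n + 1 by linarith, show 1 / 2 + p + ν = n + 2 * ν + 1 by linarith,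
    Real.Gamma_nat_eq_factorial, abs_of_pos (by positivity)]
  have hD : 0 < √(n ! * Real.Gamma (n + 2 * ν + 1)) := by positivity
  rcases le_or_gt (1 / 2) ν with h1 | h1
  · rw [div_le_iff₀ hD]
    refine (norm_whittakerW_le_of_half_le h h1 hy).trans ?_
    refine mul_le_mul_of_nonneg_right (mul_le_mul ?_ ?_ (by positivity) (by positivity)) hD.le
    · have hS6 : (|p| + |ν| + 1) ^ 2 ≤ (|p| + |ν| + 1) ^ 6 := pow_le_pow_right₀ hS1 (by norm_num)
      calc _ ≤ 2 * (|p| + |ν| + 1) * (|p| + |ν| + 1) := by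
            refine mul_le_mul (by linarith [le_abs_self ν])
              (by linarith [le_abs_self p, neg_abs_le ν]) (by positivity) (by positivity)
        _ = 2 * (|p| + |ν| + 1) ^ 2 := by ring
        _ ≤ (2 + C * 2 ^ 6) * (|p| + |ν| + 1) ^ 6 :=
            mul_le_mul (by have : 0 ≤ C * 2 ^ 6 := by positivity
                           linarith) hS6 (by positivity) (by positivity)
    · refine Real.rpow_le_rpow_of_exponent_ge hy hy1.le ?_
      linarith [min_le_right ν 0]
  · refine (hC p ν y n h hν h1 hy hy1).trans (mul_le_mul ?_ ?_ (by positivity) (by positivity))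
    · calc C * (|p| + 2) ^ 6 ≤ C * (2 * (|p| + |ν| + 1)) ^ 6 := by
            gcongr
            linarith
        _ = C * 2 ^ 6 * (|p| + |ν| + 1) ^ 6 := by ring
        _ ≤ _ := by gcongr; linarith
    · refine Real.rpow_le_rpow_of_exponent_ge hy hy1.le ?_
      linarith [min_le_left ν 0]

end Whittaker

/-! ### Assembly of the three series -/

theorem mainTheorem4 :
    ∃ A : ℝ, 0 < A ∧ ∀ ε : ℝ, 0 < ε → ∃ C : ℝ, 0 < C ∧
      (∀ p r y : ℝ, 0 < y → y < 1 →
        ‖Whittaker.whittakerW (p : ℂ) (Complex.I * (r : ℂ)) y /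
            Complex.Gamma (1 / 2 + (p : ℂ) + Complex.I * (r : ℂ))‖ ≤
          C * (|p| + |r| + 1) ^ A * y ^ (1 / 2 - ε)) ∧
      (∀ p ν y : ℝ, 0 < ν → ν < 1 / 2 → 0 < y → y < 1 →
        ‖Whittaker.whittakerW (p : ℂ) (ν : ℂ) y / Complex.Gamma (1 / 2 + (p : ℂ))‖ ≤
          C * (|p| + 1) ^ A * y ^ (1 / 2 - ν - ε)) ∧
      (∀ (p ν y : ℝ) (n : ℕ), p - ν - 1 / 2 = (n : ℝ) → -(1 / 2) < ν → 0 < y → y < 1 →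
        ‖Whittaker.whittakerW (p : ℂ) (ν : ℂ) y‖ /
            Real.sqrt |Real.Gamma (1 / 2 + p - ν) * Real.Gamma (1 / 2 + p + ν)| ≤
          C * (|p| + |ν| + 1) ^ A * y ^ (1 / 2 + min ν 0 - ε)) := by
  obtain ⟨C₃, hC₃0, hC₃⟩ := Whittaker.exists_discrete_bound
  -- The largest of the exponents `6`, `7`, `6`; all three bases are at least `1`, so the smaller
  -- powers may be raised to it.
  refine ⟨7, by norm_num, fun ε hε => ?_⟩
  obtain ⟨C₁, hC₁0, hC₁⟩ := Whittaker.exists_principal_bound hε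
  obtain ⟨C₂, hC₂0, hC₂⟩ := Whittaker.exists_complementary_bound hε
  have key : ∀ (c S Y : ℝ) (k : ℕ), k ≤ 7 → c ≤ C₁ + C₂ + C₃ → 0 ≤ c → 1 ≤ S → 0 ≤ Y →
      c * S ^ k * Y ≤ (C₁ + C₂ + C₃) * S ^ (7 : ℝ) * Y := by
    intro c S Y k hk hc hc0 hS hY
    rw [show (7 : ℝ) = ((7 : ℕ) : ℝ) by norm_num, Real.rpow_natCast]
    have : S ^ k ≤ S ^ 7 := pow_le_pow_right₀ hS hk
    gcongr
  refine ⟨C₁ + C₂ + C₃, by positivity, ?_, ?_, ?_⟩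
  · intro p r y hy hy1
    refine (hC₁ p r y hy hy1).trans (key _ _ _ 6 (by norm_num) (by linarith) hC₁0.le ?_
      (by positivity))
    linarith [abs_nonneg p, abs_nonneg r]
  · intro p ν y hν hν' hy hy1
    refine (hC₂ p ν y hν hν' hy hy1).trans (key _ _ _ 7 le_rfl (by linarith) hC₂0.le ?_
      (by positivity))
    linarith [abs_nonneg p]
  · intro p ν y n h hν hy hy1
    refine (hC₃ ε hε p ν y n h hν hy hy1).trans (key _ _ _ 6 (by norm_num) (by linarith) hC₃0.le ?_
      (by positivity))
    linarith [abs_nonneg p, abs_nonneg ν]
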